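/- Let $B\subset\mathbb R^3$ be a bounded region (nonempty, open, connected) bounded by a smooth ($C^\infty$) surface $\partial B$ with outward unit normal $n$, and let $I=[0,\infty)$. Latin indices range over $1,2,3$, repeated indices are summed, $f_{,i}=\partial f/\partial x_i$, and a dot is the time derivative. A function is of class $C^{M,N}(\bar B\times I)$ if its derivatives of order $m\le M$ in space and $n\le N$ in time with $m+n\le\max\{M,N\}$ exist and are continuous on $\bar B\times I$. Let real constants $\rho>0$, $T_0>0$, $\beta\ne0$, $\gamma$, $c\neq 0$ and constant coefficients $a^{(11)}_{ijkl},a^{(14)}_{ij},a^{(17)}_{ijkl},a^{(22)}_{ijklhm},a^{(23)}_{ijkl},a^{(33)}_{ij},a^{(47)}_{ij},a^{(77)}_{ijkl},k_{ij}$ be given with the symmetries $$a^{(11)}_{ijkl}=a^{(11)}_{jikl}=a^{(11)}_{klij},\quad a^{(14)}_{ij}=a^{(14)}_{ji},\quad a^{(22)}_{ijklhm}=a^{(22)}_{jiklhm}=a^{(22)}_{lhmijk},\quad a^{(23)}_{ijkl}=a^{(23)}_{jikl},\quad a^{(33)}_{ij}=a^{(33)}_{ji},$$ $$k_{ij}=k_{ji},\quad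 a^{(17)}_{ijkl}=a^{(17)}_{jikl},\quad a^{(77)}_{ijkl}=a^{(77)}_{jikl}=a^{(77)}_{klij},\quad a^{(47)}_{ij}=a^{(47)}_{ji},$$ and with $\gamma/\beta\ge0$ and $k_{ij}\eta_i\eta_j\ge0$ for all $(\eta_i)$. Put $\beta'=\beta+\gamma/(c\beta)$. An admissible process is an array $\pi=(u_i,\theta,\varphi,e_{ij},\kappa_{ijk},\beta_i,E_i,V_{ij},\tau_{ij},\mu_{ijk},\sigma_i,Q_{ij},\eta,q_i)$ of functions on $\bar B\times I$ with $u_i\in C^{4,2}$, $\varphi\in C^{4,0}$, $\theta\in C^{2,2}$, $e_{ij},V_{ij}\in C^{2,1}$, $\eta\in C^{0,1}$, $\kappa_{ijk},E_i,\mu_{ijk},Q_{ij}\in C^{2,0}$, $\beta_i,\tau_{ij},q_i\in C^{1,0}$ and $e_{ij}=e_{ji}$, $\kappa_{ijk}=\kappa_{jik}$, $V_{ij}=V_{ji}$, $\tau_{ij}=\tau_{ji}$, $\mu_{kji}=\mu_{jki}$, $Q_{ij}=Q_{ji}$. Let $S_1,\dots,S_5$ and $\Sigma_1,\dots,\Sigma_5$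 be subsets of $\partial B$ with $\bar S_r\cup\Sigma_r=\partial B$ and $S_r\cap\Sigma_r=\varnothing$. Given functions $f_i,g,h,u_i^0,v_i^0,\theta^0,\eta^0,\hat u_i,\hat d_i,\hat\theta,\hat\varphi,\hat\omega,\hat P_i,\hat R_i,\hat q,\hat\Lambda,\hat H$, a solution of the problem $\Pi$ is an admissible process satisfying: * on $B\times I$: $\ \tau_{ji,j}-\mu_{kji,kj}+\rho f_i=\rho\ddot u_i$, $\ \sigma_{i,i}-Q_{ji,ji}=g$, $\ \rho T_0\dot\eta+q_{j,j}-\rho h=0$, $\ e_{ij}=\tfrac12(u_{i,j}+u_{j,i})$, $\kappa_{ijk}=u_{k,ij}$, $\beta_i=\theta_{,i}$, $E_i=-\varphi_{,i}$, $V_{ij}=-\varphi_{,ij}$; * on $\bar B\times I$: $\ \tau_{ij}=a^{(11)}_{ijkl}e_{kl}+a^{(17)}_{ijkl}V_{kl}+a^{(14)}_{ij}(\theta+\beta\dot\theta)$, $\ \mu_{ijk}=a^{(22)}_{ijklhm}\kappa_{lhm}+a^{(23)}_{ijkl}E_l$, $\ -\sigma_i=a^{(23)}_{jkli}\kappa_{jkl}+a^{(33)}_{ij}E_j$,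 $\ -Q_{ij}=a^{(17)}_{klij}e_{kl}+a^{(77)}_{ijkl}V_{kl}+a^{(47)}_{ij}(\theta+\beta\dot\theta)$, $\ -\rho\eta=a^{(14)}_{ij}e_{ij}+a^{(47)}_{ij}V_{ij}+c(\theta+\beta'\dot\theta)$, $\ -q_i/T_0=k_{ij}\beta_j$; * on $\bar B$ at $t=0$: $u_i=u_i^0$, $\dot u_i=v_i^0$, $\theta=\theta^0$, $\eta=\eta^0$; * for all $t\in I$: $u_i=\hat u_i$ on $S_1$, $P_i=\hat P_i$ on $\Sigma_1$; $\mathcal Du_i=\hat d_i$ on $S_2$, $R_i=\hat R_i$ on $\Sigma_2$; $\theta=\hat\theta$ on $S_3$, $q_in_i=\hat q$ on $\Sigma_3$; $\varphi=\hat\varphi$ on $S_4$, $\Lambda=\hat\Lambda$ on $\Sigma_4$; $\mathcal D\varphi=\hat\omega$ on $S_5$, $H=\hat H$ on $\Sigma_5$, where $\mathcal D=n_i\,\partial/\partial x_i$, $\mathcal D_i=(\delta_{ij}-n_in_j)\,\partial/\partial x_j$, and $$P_i=(\tau_{ji}-\mu_{kji,k})n_j-\mathcal D_j(\mu_{kji}n_k)+(\mathcal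 D_ln_l)\mu_{kji}n_kn_j,\qquad R_i=\mu_{kji}n_kn_j,$$ $$\Lambda=(\sigma_j-Q_{kj,k})n_j-\mathcal D_j(Q_{kj}n_k)+(\mathcal D_ln_l)Q_{kj}n_kn_j,\qquad H=Q_{kj}n_kn_j.$$ **Theorem.** Assume that $\beta>0$, $\gamma>0$, and that the quadratic form $F=a^{(33)}_{ij}E_iE_j+a^{(77)}_{ijkl}V_{kl}V_{ij}$ in the vector $(E_i)$ and the symmetric tensor $(V_{ij})$ is definite (positive definite or negative definite). If $S_4$ is nonempty, then $\Pi$ has at most one solution: for the same data, any two solutions coincide in all their components on $\bar B\times I$. -/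

import Mathlib

open Set
open scoped ContDiff BigOperators

namespace Thermopiezo

/-- Euclidean three-dimensional space, with its Cartesian coordinates `x i`. -/
abbrev E3 := EuclideanSpace ℝ (Fin 3)

/-- A scalar field depending on position and time. Only its values on the closure of the body and
for times `t ≥ 0` matter. Vector and tensor fields are families of components. -/
abbrev ScalarField := E3 → ℝ → ℝ

/-! ### The body -/

/-- A bounded region (nonempty connected open set) of space bounded by a smooth surface. The
smoothness of the boundary is expressed by a smooth defining function `ψ`: the region is
`{ψ < 0}`, and the differential of `ψ` does not vanish on `{ψ = 0}` (which is then the boundary). -/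
structure Body where
  B : Set E3
  ψ : E3 → ℝ
  bounded : Bornology.IsBounded B
  connected : IsConnected B
  smooth : ContDiff ℝ ∞ ψ
  region_eq : B = {x | ψ x < 0}
  regular : ∀ x, ψ x = 0 → fderiv ℝ ψ x ≠ 0

/-- The `j`-th Cartesian basis vector. -/
noncomputable def basisVec (j : Fin 3) : E3 := EuclideanSpace.single j 1

/-- The `i`-th component of the outward unit normal `∇ψ / |∇ψ|`, as a function that is smooth
near the boundary surface. -/
noncomputable def Body.normal (b : Body) (i : Fin 3) (x : E3) : ℝ :=
  gradient b.ψ x i / ‖gradient b.ψ x‖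

/-! ### Differential operators -/

/-- Spatial partial derivative of a function of position on the closed body. In the interior it is
the usual partial derivative; on the boundary it is the one-sided derivative. -/
noncomputable def Body.pdx (b : Body) (j : Fin 3) (w : E3 → ℝ) (x : E3) : ℝ :=
  fderivWithin ℝ w (closure b.B) x (basisVec j)

/-- Spatial partial derivative `f_{,j}` of a field. -/
noncomputable def Body.pd (b : Body) (j : Fin 3) (f : ScalarField) : ScalarField :=
  fun x t => b.pdx j (fun y => f y t) x

/-- Time derivative on `[0, ∞)` (one-sided at `t = 0`). -/
noncomputable def dt (f : ScalarField) : ScalarField :=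
  fun x t => derivWithin (f x) (Ici 0) t

/-- Normal derivative `𝒟 f = n_i f_{,i}` on the boundary. -/
noncomputable def Body.normalDeriv (b : Body) (f : ScalarField) : ScalarField :=
  fun x t => ∑ i, b.normal i x * b.pd i f x t

/-- Surface gradient `𝒟_i w = (δ_{ij} - n_i n_j) w_{,j}` on the boundary, for a function `w` of
position. -/
noncomputable def Body.surfGrad (b : Body) (i : Fin 3) (w : E3 → ℝ) (x : E3) : ℝ :=
  ∑ j, ((if i = j then 1 else 0) - b.normal i x * b.normal j x) * b.pdx j w x

/-- The surface divergence `𝒟_l n_l` of the normal. -/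
noncomputable def Body.surfDivNormal (b : Body) (x : E3) : ℝ :=
  ∑ l, b.surfGrad l (b.normal l) x

/-- The class `C^{M,N}(B̄ × [0,∞))`: all derivatives of order `m ≤ M` in space and `n ≤ N` in time
with `m + n ≤ max M N` exist and are continuous on `B̄ × [0,∞)`. -/
def Body.ClassC (b : Body) (M N : ℕ) (f : ScalarField) : Prop :=
  (∀ x ∈ closure b.B, ContDiffOn ℝ N (f x) (Ici 0)) ∧
  ∀ m ≤ M, ∀ n ≤ N, m + n ≤ max M N →
    (∀ t ∈ Ici (0 : ℝ),
      ContDiffOn ℝ m (fun x => iteratedDerivWithin n (f x) (Ici 0) t) (closure b.B)) ∧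
    ContinuousOn
      (fun p : E3 × ℝ => iteratedFDerivWithin ℝ m
        (fun x => iteratedDerivWithin n (f x) (Ici 0) p.2) (closure b.B) p.1)
      (closure b.B ×ˢ Ici 0)

/-! ### The material -/

/-- The constants of a homogeneous centrosymmetric thermopiezoelectric nonsimple material. -/
structure Material where
  ρ : ℝ
  T₀ : ℝ
  β : ℝ
  γ : ℝ
  c : ℝ
  a11 : Fin 3 → Fin 3 → Fin 3 → Fin 3 → ℝ
  a14 : Fin 3 → Fin 3 → ℝ
  a17 : Fin 3 → Fin 3 → Fin 3 → Fin 3 → ℝ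
  a22 : Fin 3 → Fin 3 → Fin 3 → Fin 3 → Fin 3 → Fin 3 → ℝ
  a23 : Fin 3 → Fin 3 → Fin 3 → Fin 3 → ℝ
  a33 : Fin 3 → Fin 3 → ℝ
  a47 : Fin 3 → Fin 3 → ℝ
  a77 : Fin 3 → Fin 3 → Fin 3 → Fin 3 → ℝ
  k : Fin 3 → Fin 3 → ℝ

namespace Material

/-- The constant `β' = β + γ / (c β)`. -/
noncomputable def betaPrime (M : Material) : ℝ := M.β + M.γ / (M.c * M.β)

/-- The symmetry relations of the constitutive coefficients. -/
structure Symmetric (M : Material) : Prop where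
  a11_swap : ∀ i j k l, M.a11 i j k l = M.a11 j i k l
  a11_major : ∀ i j k l, M.a11 i j k l = M.a11 k l i j
  a14_symm : ∀ i j, M.a14 i j = M.a14 j i
  a22_swap : ∀ i j k l h m, M.a22 i j k l h m = M.a22 j i k l h m
  a22_major : ∀ i j k l h m, M.a22 i j k l h m = M.a22 l h m i j k
  a23_swap : ∀ i j k l, M.a23 i j k l = M.a23 j i k l
  a33_symm : ∀ i j, M.a33 i j = M.a33 j i
  k_symm : ∀ i j, M.k i j = M.k j i
  a17_swap : ∀ i j k l, M.a17 i j k l = M.a17 j i k l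
  a77_swap : ∀ i j k l, M.a77 i j k l = M.a77 j i k l
  a77_major : ∀ i j k l, M.a77 i j k l = M.a77 k l i j
  a47_symm : ∀ i j, M.a47 i j = M.a47 j i

/-- The standing assumptions on the material: positive density and reference temperature,
nonzero `β` and `c`, the symmetry relations, and the restriction imposed by the dissipation
inequality (`γ/β ≥ 0` and `k_{ij}` positive semidefinite). -/
structure Standing (M : Material) : Prop where
  ρ_pos : 0 < M.ρ
  T₀_pos : 0 < M.T₀
  β_ne : M.β ≠ 0
  c_ne : M.c ≠ 0
  symmetric : M.Symmetric
  dissipation_γ : 0 ≤ M.γ / M.β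
  dissipation_k : ∀ v : Fin 3 → ℝ, 0 ≤ ∑ i, ∑ j, M.k i j * v i * v j

/-- The quadratic form `F = a³³_{ij} E_i E_j + a⁷⁷_{ijkl} V_{kl} V_{ij}`. -/
def F (M : Material) (E : Fin 3 → ℝ) (V : Fin 3 → Fin 3 → ℝ) : ℝ :=
  (∑ i, ∑ j, M.a33 i j * E i * E j) + ∑ i, ∑ j, ∑ k, ∑ l, M.a77 i j k l * V k l * V i j

/-- `F` is definite, positive or negative, as a quadratic form in a vector `E` and a symmetric
tensor `V`. -/
def FDefinite (M : Material) : Prop :=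
  (∀ E V, (∀ i j, V i j = V j i) → (E ≠ 0 ∨ V ≠ 0) → 0 < M.F E V) ∨
  (∀ E V, (∀ i j, V i j = V j i) → (E ≠ 0 ∨ V ≠ 0) → M.F E V < 0)

end Material

/-! ### Processes -/

/-- An ordered array
`π = (u_i, θ, φ, e_{ij}, κ_{ijk}, β_i, E_i, V_{ij}, τ_{ij}, μ_{ijk}, σ_i, Q_{ij}, η, q_i)`.
The temperature gradient `β_i` is the component `gradθ`. -/
structure ThermoProcess where
  u : Fin 3 → ScalarField
  θ : ScalarField
  φ : ScalarField
  e : Fin 3 → Fin 3 → ScalarField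
  κ : Fin 3 → Fin 3 → Fin 3 → ScalarField
  gradθ : Fin 3 → ScalarField
  E : Fin 3 → ScalarField
  V : Fin 3 → Fin 3 → ScalarField
  τ : Fin 3 → Fin 3 → ScalarField
  μ : Fin 3 → Fin 3 → Fin 3 → ScalarField
  σ : Fin 3 → ScalarField
  Q : Fin 3 → Fin 3 → ScalarField
  η : ScalarField
  q : Fin 3 → ScalarField

/-- Admissible processes on `B̄ × [0,∞)`: regularity and symmetry. -/
structure Admissible (b : Body) (π : ThermoProcess) : Prop where
  u_class : ∀ i, b.ClassC 4 2 (π.u i)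
  φ_class : b.ClassC 4 0 π.φ
  θ_class : b.ClassC 2 2 π.θ
  e_class : ∀ i j, b.ClassC 2 1 (π.e i j)
  V_class : ∀ i j, b.ClassC 2 1 (π.V i j)
  η_class : b.ClassC 0 1 π.η
  κ_class : ∀ i j k, b.ClassC 2 0 (π.κ i j k)
  E_class : ∀ i, b.ClassC 2 0 (π.E i)
  μ_class : ∀ i j k, b.ClassC 2 0 (π.μ i j k)
  Q_class : ∀ i j, b.ClassC 2 0 (π.Q i j)
  gradθ_class : ∀ i, b.ClassC 1 0 (π.gradθ i)
  τ_class : ∀ i j, b.ClassC 1 0 (π.τ i j)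
  q_class : ∀ i, b.ClassC 1 0 (π.q i)
  e_symm : ∀ x ∈ closure b.B, ∀ t ∈ Ici (0 : ℝ), ∀ i j, π.e i j x t = π.e j i x t
  κ_symm : ∀ x ∈ closure b.B, ∀ t ∈ Ici (0 : ℝ), ∀ i j k, π.κ i j k x t = π.κ j i k x t
  V_symm : ∀ x ∈ closure b.B, ∀ t ∈ Ici (0 : ℝ), ∀ i j, π.V i j x t = π.V j i x t
  τ_symm : ∀ x ∈ closure b.B, ∀ t ∈ Ici (0 : ℝ), ∀ i j, π.τ j i x t = π.τ i j x t
  μ_symm : ∀ x ∈ closure b.B, ∀ t ∈ Ici (0 : ℝ), ∀ i j k, π.μ k j i x t = π.μ j k i x t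
  Q_symm : ∀ x ∈ closure b.B, ∀ t ∈ Ici (0 : ℝ), ∀ i j, π.Q j i x t = π.Q i j x t

/-- The local balance equations and the geometric equations on `B × [0,∞)`, for the body force
`f`, the charge density `g` and the heat supply `h`. -/
structure Balance (b : Body) (M : Material) (f : Fin 3 → ScalarField) (g h : ScalarField)
    (π : ThermoProcess) : Prop where
  motion : ∀ x ∈ b.B, ∀ t ∈ Ici (0 : ℝ), ∀ i,
    (∑ j, b.pd j (π.τ j i) x t) - (∑ j, ∑ k, b.pd j (b.pd k (π.μ k j i)) x t) + M.ρ * f i x t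
      = M.ρ * dt (dt (π.u i)) x t
  electric : ∀ x ∈ b.B, ∀ t ∈ Ici (0 : ℝ),
    (∑ i, b.pd i (π.σ i) x t) - (∑ i, ∑ j, b.pd i (b.pd j (π.Q j i)) x t) = g x t
  energy : ∀ x ∈ b.B, ∀ t ∈ Ici (0 : ℝ),
    M.ρ * M.T₀ * dt π.η x t + (∑ j, b.pd j (π.q j) x t) - M.ρ * h x t = 0
  strain : ∀ x ∈ b.B, ∀ t ∈ Ici (0 : ℝ), ∀ i j,
    π.e i j x t = 1 / 2 * (b.pd j (π.u i) x t + b.pd i (π.u j) x t)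
  strain_grad : ∀ x ∈ b.B, ∀ t ∈ Ici (0 : ℝ), ∀ i j k,
    π.κ i j k x t = b.pd j (b.pd i (π.u k)) x t
  temp_grad : ∀ x ∈ b.B, ∀ t ∈ Ici (0 : ℝ), ∀ i, π.gradθ i x t = b.pd i π.θ x t
  field : ∀ x ∈ b.B, ∀ t ∈ Ici (0 : ℝ), ∀ i, π.E i x t = - b.pd i π.φ x t
  field_grad : ∀ x ∈ b.B, ∀ t ∈ Ici (0 : ℝ), ∀ i j,
    π.V i j x t = - b.pd j (b.pd i π.φ) x t

/-- The constitutive equations on `B̄ × [0,∞)`. -/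
structure Constitutive (b : Body) (M : Material) (π : ThermoProcess) : Prop where
  stress : ∀ x ∈ closure b.B, ∀ t ∈ Ici (0 : ℝ), ∀ i j,
    π.τ i j x t = (∑ k, ∑ l, M.a11 i j k l * π.e k l x t)
      + (∑ k, ∑ l, M.a17 i j k l * π.V k l x t)
      + M.a14 i j * (π.θ x t + M.β * dt π.θ x t)
  hyperstress : ∀ x ∈ closure b.B, ∀ t ∈ Ici (0 : ℝ), ∀ i j k,
    π.μ i j k x t = (∑ l, ∑ h, ∑ m, M.a22 i j k l h m * π.κ l h m x t)
      + ∑ l, M.a23 i j k l * π.E l x t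
  sigma : ∀ x ∈ closure b.B, ∀ t ∈ Ici (0 : ℝ), ∀ i,
    - π.σ i x t = (∑ j, ∑ k, ∑ l, M.a23 j k l i * π.κ j k l x t)
      + ∑ j, M.a33 i j * π.E j x t
  quadrupole : ∀ x ∈ closure b.B, ∀ t ∈ Ici (0 : ℝ), ∀ i j,
    - π.Q i j x t = (∑ k, ∑ l, M.a17 k l i j * π.e k l x t)
      + (∑ k, ∑ l, M.a77 i j k l * π.V k l x t)
      + M.a47 i j * (π.θ x t + M.β * dt π.θ x t)
  entropy : ∀ x ∈ closure b.B, ∀ t ∈ Ici (0 : ℝ),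
    - (M.ρ * π.η x t) = (∑ i, ∑ j, M.a14 i j * π.e i j x t)
      + (∑ i, ∑ j, M.a47 i j * π.V i j x t)
      + M.c * (π.θ x t + M.betaPrime * dt π.θ x t)
  heat_flux : ∀ x ∈ closure b.B, ∀ t ∈ Ici (0 : ℝ), ∀ i,
    - (π.q i x t / M.T₀) = ∑ j, M.k i j * π.gradθ j x t

/-! ### Boundary quantities -/

/-- `P_i = (τ_{ji} - μ_{kji,k}) n_j - 𝒟_j(μ_{kji} n_k) + (𝒟_l n_l) μ_{kji} n_k n_j`. -/
noncomputable def ThermoProcess.P (π : ThermoProcess) (b : Body) (i : Fin 3) : ScalarField := fun x t =>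
  (∑ j, (π.τ j i x t - ∑ k, b.pd k (π.μ k j i) x t) * b.normal j x)
    - (∑ j, b.surfGrad j (fun y => ∑ k, π.μ k j i y t * b.normal k y) x)
    + b.surfDivNormal x * ∑ j, ∑ k, π.μ k j i x t * b.normal k x * b.normal j x

/-- `R_i = μ_{kji} n_k n_j`. -/
noncomputable def ThermoProcess.R (π : ThermoProcess) (b : Body) (i : Fin 3) : ScalarField := fun x t =>
  ∑ j, ∑ k, π.μ k j i x t * b.normal k x * b.normal j x

/-- `Λ = (σ_j - Q_{kj,k}) n_j - 𝒟_j(Q_{kj} n_k) + (𝒟_l n_l) Q_{kj} n_k n_j`. -/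
noncomputable def ThermoProcess.Lam (π : ThermoProcess) (b : Body) : ScalarField := fun x t =>
  (∑ j, (π.σ j x t - ∑ k, b.pd k (π.Q k j) x t) * b.normal j x)
    - (∑ j, b.surfGrad j (fun y => ∑ k, π.Q k j y t * b.normal k y) x)
    + b.surfDivNormal x * ∑ j, ∑ k, π.Q k j x t * b.normal k x * b.normal j x

/-- `H = Q_{kj} n_k n_j`. -/
noncomputable def ThermoProcess.H (π : ThermoProcess) (b : Body) : ScalarField := fun x t =>
  ∑ j, ∑ k, π.Q k j x t * b.normal k x * b.normal j x

/-- The normal heat flux `q = q_i n_i`. -/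
noncomputable def ThermoProcess.normalFlux (π : ThermoProcess) (b : Body) : ScalarField := fun x t =>
  ∑ i, π.q i x t * b.normal i x

/-! ### The mixed initial-boundary value problem -/

/-- The five pairs of complementary parts `S_i`, `Σ_i` (written `Sg i`) of the boundary, with
`S̄_i ∪ Σ_i = ∂B` and `S_i ∩ Σ_i = ∅`. -/
structure BoundaryParts (b : Body) where
  S₁ : Set E3
  S₂ : Set E3
  S₃ : Set E3
  S₄ : Set E3
  S₅ : Set E3
  Sg₁ : Set E3
  Sg₂ : Set E3
  Sg₃ : Set E3
  Sg₄ : Set E3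
  Sg₅ : Set E3
  cover₁ : closure S₁ ∪ Sg₁ = frontier b.B
  cover₂ : closure S₂ ∪ Sg₂ = frontier b.B
  cover₃ : closure S₃ ∪ Sg₃ = frontier b.B
  cover₄ : closure S₄ ∪ Sg₄ = frontier b.B
  cover₅ : closure S₅ ∪ Sg₅ = frontier b.B
  disj₁ : S₁ ∩ Sg₁ = ∅
  disj₂ : S₂ ∩ Sg₂ = ∅
  disj₃ : S₃ ∩ Sg₃ = ∅
  disj₄ : S₄ ∩ Sg₄ = ∅
  disj₅ : S₅ ∩ Sg₅ = ∅

/-- The given data: supply terms, initial data and boundary data. -/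
structure ProblemData where
  f : Fin 3 → ScalarField
  g : ScalarField
  h : ScalarField
  u₀ : Fin 3 → E3 → ℝ
  v₀ : Fin 3 → E3 → ℝ
  θ₀ : E3 → ℝ
  η₀ : E3 → ℝ
  uHat : Fin 3 → ScalarField
  dHat : Fin 3 → ScalarField
  θHat : ScalarField
  φHat : ScalarField
  ωHat : ScalarField
  PHat : Fin 3 → ScalarField
  RHat : Fin 3 → ScalarField
  qHat : ScalarField
  LamHat : ScalarField
  HHat : ScalarField

/-- The initial conditions on `B̄`. -/
structure InitialConditions (b : Body) (D : ProblemData) (π : ThermoProcess) : Prop where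
  u_init : ∀ x ∈ closure b.B, ∀ i, π.u i x 0 = D.u₀ i x
  v_init : ∀ x ∈ closure b.B, ∀ i, dt (π.u i) x 0 = D.v₀ i x
  θ_init : ∀ x ∈ closure b.B, π.θ x 0 = D.θ₀ x
  η_init : ∀ x ∈ closure b.B, π.η x 0 = D.η₀ x

/-- The mixed boundary conditions. -/
structure BoundaryConditions (b : Body) (p : BoundaryParts b) (D : ProblemData) (π : ThermoProcess) :
    Prop where
  u_bc : ∀ x ∈ p.S₁, ∀ t ∈ Ici (0 : ℝ), ∀ i, π.u i x t = D.uHat i x t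
  P_bc : ∀ x ∈ p.Sg₁, ∀ t ∈ Ici (0 : ℝ), ∀ i, π.P b i x t = D.PHat i x t
  d_bc : ∀ x ∈ p.S₂, ∀ t ∈ Ici (0 : ℝ), ∀ i, b.normalDeriv (π.u i) x t = D.dHat i x t
  R_bc : ∀ x ∈ p.Sg₂, ∀ t ∈ Ici (0 : ℝ), ∀ i, π.R b i x t = D.RHat i x t
  θ_bc : ∀ x ∈ p.S₃, ∀ t ∈ Ici (0 : ℝ), π.θ x t = D.θHat x t
  q_bc : ∀ x ∈ p.Sg₃, ∀ t ∈ Ici (0 : ℝ), π.normalFlux b x t = D.qHat x t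
  φ_bc : ∀ x ∈ p.S₄, ∀ t ∈ Ici (0 : ℝ), π.φ x t = D.φHat x t
  Lam_bc : ∀ x ∈ p.Sg₄, ∀ t ∈ Ici (0 : ℝ), π.Lam b x t = D.LamHat x t
  ω_bc : ∀ x ∈ p.S₅, ∀ t ∈ Ici (0 : ℝ), b.normalDeriv π.φ x t = D.ωHat x t
  H_bc : ∀ x ∈ p.Sg₅, ∀ t ∈ Ici (0 : ℝ), π.H b x t = D.HHat x t

/-- `π` is a solution of the mixed initial-boundary value problem. -/
structure IsSolution (b : Body) (M : Material) (p : BoundaryParts b) (D : ProblemData)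
    (π : ThermoProcess) : Prop where
  admissible : Admissible b π
  balance : Balance b M D.f D.g D.h π
  constitutive : Constitutive b M π
  initial : InitialConditions b D π
  boundary : BoundaryConditions b p D π

/-- Two processes coincide, in all their components, at the point `x` and the time `t`. -/
structure SameAt (π₁ π₂ : ThermoProcess) (x : E3) (t : ℝ) : Prop where
  u : ∀ i, π₁.u i x t = π₂.u i x t
  θ : π₁.θ x t = π₂.θ x t
  φ : π₁.φ x t = π₂.φ x t
  e : ∀ i j, π₁.e i j x t = π₂.e i j x t
  κ : ∀ i j k, π₁.κ i j k x t = π₂.κ i j k x t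
  gradθ : ∀ i, π₁.gradθ i x t = π₂.gradθ i x t
  E : ∀ i, π₁.E i x t = π₂.E i x t
  V : ∀ i j, π₁.V i j x t = π₂.V i j x t
  τ : ∀ i j, π₁.τ i j x t = π₂.τ i j x t
  μ : ∀ i j k, π₁.μ i j k x t = π₂.μ i j k x t
  σ : ∀ i, π₁.σ i x t = π₂.σ i x t
  Q : ∀ i j, π₁.Q i j x t = π₂.Q i j x t
  η : π₁.η x t = π₂.η x t
  q : ∀ i, π₁.q i x t = π₂.q i x t

end Thermopiezo

namespace Thermopiezo

open MeasureTheory Filter Topology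

/-! ### Geometry of the body: the region, its closure and its frontier in terms of `ψ`. -/

namespace Body

variable (b : Body)

/-! By linearity the difference of two solutions solves the problem with zero data, so it is enough
to show that such a solution vanishes (`IsSolution.sub`, `IsSolution.eq_zero`). No sign is imposed
on the elastic coefficients, so a standard energy argument is not available; the proof compares the
solution with itself at two different times.

Write ⟨f(r), h(s)⟩ for the L² pairing over the body and T for θ + βθ̇. The choice of β' turns the
entropy law into ρη + (γ/β)θ̇ = -(a¹⁴e + a⁴⁷V + cT), so the constitutive equations form a symmetric
system and their bilinear form at times r, s is symmetric in r and s (`Constitutive.reciprocal`).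
Green's identity for second-gradient stresses (`Body.green`) replaces the mechanical power by
-ρ⟨ü(r), u(s)⟩ and removes the electric power. After the symmetric term γ⟨θ̇(r), θ̇(s)⟩ is
discarded, `IsSolution.reciprocity` says that ρ⟨ü(r), u(s)⟩ + ρ⟨η(r), θ(s)⟩ + ρβ⟨η(r), θ̇(s)⟩ +
(γ/β)⟨θ̇(r), θ(s)⟩ is symmetric in r and s.

Now take r = t - a, s = t + a and integrate the antisymmetric part over 0 ≤ a ≤ t. Each term is an
exact derivative in a, and the zero initial data remove the contribution of a = t, so only values at
time t remain (`Body.integral_reflect`). With G the time primitive of grad θ and K(t) = ∫ k G·G, the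
energy equation gives `IsSolution.energy_identity`: 2ρ⟨u, u̇⟩ + K + 2β∫ k G·grad θ + (γ/β)‖θ‖² = 0.
Its first and third terms are time derivatives, so one more integration yields ρ‖u‖² + ∫₀ᵗK + βK +
(γ/β)∫₀ᵗ‖θ‖² = 0. For β, γ > 0 every summand is nonnegative, hence u = 0 and θ = 0
(`IsSolution.u_θ_eq_zero`).

With u and θ gone, the electric power is -F(E, V) pointwise and has zero integral; definiteness of F
gives E = 0 and V = 0. Then φ has zero gradient on a connected region and vanishes at a point of S₄.
The constitutive equations annihilate the remaining fields.

The integrations by parts rest on a divergence theorem for fields tangent to the boundary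
(`Body.integral_div_eq_zero`), proved with cutoffs and requiring no surface measure. In Green's
identity, a divergence-free correction (`Body.curlField`) brings the flux pointwise into the form
traction times f plus double traction times the normal derivative of f. -/

theorem isOpen : IsOpen b.B := by
  rw [b.region_eq]
  exact isOpen_lt b.smooth.continuous continuous_const

theorem neg_of_mem {x : E3} (hx : x ∈ b.B) : b.ψ x < 0 := by
  rw [b.region_eq] at hx
  exact hx

theorem mem_of_neg {x : E3} (hx : b.ψ x < 0) : x ∈ b.B := by
  rw [b.region_eq]
  exact hx

theorem isCompact_closure : IsCompact (closure b.B) := b.bounded.isCompact_closure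

theorem nonpos_of_mem_closure {x : E3} (hx : x ∈ closure b.B) : b.ψ x ≤ 0 :=
  closure_minimal (fun _ hy => (b.neg_of_mem hy).le)
    (isClosed_le b.smooth.continuous continuous_const) hx

theorem mem_frontier_iff {x : E3} : x ∈ frontier b.B ↔ x ∈ closure b.B ∧ b.ψ x = 0 := by
  rw [b.isOpen.frontier_eq]
  constructor
  · rintro ⟨h, h'⟩
    exact ⟨h, le_antisymm (b.nonpos_of_mem_closure h) (not_lt.1 fun hh => h' (b.mem_of_neg hh))⟩
  · rintro ⟨h, h'⟩
    exact ⟨h, fun hh => (b.neg_of_mem hh).ne h'⟩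

theorem mem_or_mem_frontier {x : E3} (hx : x ∈ closure b.B) : x ∈ b.B ∨ x ∈ frontier b.B := by
  rw [b.isOpen.frontier_eq]
  by_cases h : x ∈ b.B
  · exact Or.inl h
  · exact Or.inr ⟨hx, h⟩

theorem frontier_subset : frontier b.B ⊆ closure b.B := frontier_subset_closure

theorem closure_mem_nhds {x : E3} (hx : x ∈ b.B) : closure b.B ∈ 𝓝 x :=
  mem_of_superset (b.isOpen.mem_nhds hx) subset_closure

theorem differentiable_ψ : Differentiable ℝ b.ψ := b.smooth.differentiable (by simp)

/-- A vector along which the defining function decreases is tangent to the body. -/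
theorem mem_tangentConeAt {x v : E3} (hx : b.ψ x = 0) (hv : fderiv ℝ b.ψ x v < 0) :
    v ∈ tangentConeAt ℝ b.B x := by
  have hd : HasDerivAt (fun s : ℝ => b.ψ (x + s • v)) (fderiv ℝ b.ψ x v) 0 := by
    have h1 : HasDerivAt (fun s : ℝ => x + s • v) v 0 := by
      simpa using ((hasDerivAt_id (0 : ℝ)).smul_const v).const_add x
    have h2 : HasFDerivAt b.ψ (fderiv ℝ b.ψ x) (x + (0 : ℝ) • v) := by
      simpa using (b.differentiable_ψ x).hasFDerivAt
    exact h2.comp_hasDerivAt (0 : ℝ) h1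
  have hneg : ∀ᶠ s in 𝓝[>] (0 : ℝ), b.ψ (x + s • v) < 0 := by
    have h := hd.tendsto_slope_zero_right.eventually (gt_mem_nhds hv)
    filter_upwards [h, self_mem_nhdsWithin] with s hs hs0
    simp only [zero_add, zero_smul, add_zero, hx, sub_zero, smul_eq_mul] at hs
    by_contra hcon
    exact absurd hs (not_lt.2 (mul_nonneg (inv_nonneg.2 (le_of_lt hs0)) (not_lt.1 hcon)))
  have hpos : ∀ᶠ s in 𝓝[>] (0 : ℝ), s ≠ 0 := by
    filter_upwards [self_mem_nhdsWithin] with s hs using ne_of_gt hs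
  refine mem_tangentConeAt_of_seq (𝓝[>] (0 : ℝ)) (fun s => s⁻¹) (fun s => s • v) ?_ ?_ ?_
  · have : Tendsto (fun s : ℝ => s • v) (𝓝 0) (𝓝 ((0 : ℝ) • v)) :=
      (continuous_id.smul continuous_const).tendsto 0
    rw [zero_smul] at this
    exact this.mono_left nhdsWithin_le_nhds
  · filter_upwards [hneg] with s hs using b.mem_of_neg hs
  · refine tendsto_const_nhds.congr' ?_
    filter_upwards [hpos] with s hs
    rw [smul_smul, inv_mul_cancel₀ hs, one_smul]

/-- At a boundary point the tangent cone contains the open half-space where the differential of `ψ`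
is negative, nonempty by regularity, and a set with interior spans. This makes the one-sided partial
derivatives on the closed body obey the usual rules. -/
theorem uniqueDiffOn : UniqueDiffOn ℝ (closure b.B) := by
  intro x hx
  refine UniqueDiffWithinAt.mono ?_ subset_closure
  rcases b.mem_or_mem_frontier hx with h | h
  · exact b.isOpen.uniqueDiffWithinAt h
  · have h0 := (b.mem_frontier_iff.1 h).2
    refine ⟨?_, hx⟩
    have hne := b.regular x h0
    have hopen : IsOpen {v : E3 | fderiv ℝ b.ψ x v < 0} :=
      isOpen_lt (fderiv ℝ b.ψ x).continuous continuous_const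
    obtain ⟨v, hv⟩ : ∃ v, fderiv ℝ b.ψ x v < 0 := by
      by_contra! hcon
      refine hne (ContinuousLinearMap.ext fun v => ?_)
      have h1 := hcon v
      have h2 := hcon (-v)
      rw [map_neg] at h2
      simpa using le_antisymm (by linarith) h1
    have htop : Submodule.span ℝ (tangentConeAt ℝ b.B x) = ⊤ := by
      refine Submodule.eq_top_of_nonempty_interior' _ ⟨v, mem_interior.2 ⟨_, ?_, hopen, hv⟩⟩
      exact fun w hw => Submodule.subset_span (b.mem_tangentConeAt h0 hw)
    rw [htop]
    exact dense_univ

/-! ### Calculus of partial derivatives -/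

variable {b}

theorem pdx_congr {f g : E3 → ℝ} {x : E3} (h : ∀ y ∈ closure b.B, f y = g y)
    (hx : x ∈ closure b.B) (j : Fin 3) : b.pdx j f x = b.pdx j g x := by
  unfold pdx
  rw [fderivWithin_congr h (h x hx)]

theorem pdx_congr_nhds {f g : E3 → ℝ} {x : E3} (h : f =ᶠ[𝓝 x] g)
    (j : Fin 3) : b.pdx j f x = b.pdx j g x := by
  unfold pdx
  rw [Filter.EventuallyEq.fderivWithin_eq (h.filter_mono nhdsWithin_le_nhds) h.eq_of_nhds]

theorem pdx_eq_fderiv {f : E3 → ℝ} {x : E3} (hx : x ∈ b.B) (j : Fin 3) :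
    b.pdx j f x = fderiv ℝ f x (basisVec j) := by
  unfold pdx
  rw [fderivWithin_of_mem_nhds (b.closure_mem_nhds hx)]

theorem pdx_add {f g : E3 → ℝ} {x : E3} (hx : x ∈ closure b.B)
    (hf : DifferentiableWithinAt ℝ f (closure b.B) x)
    (hg : DifferentiableWithinAt ℝ g (closure b.B) x) (j : Fin 3) :
    b.pdx j (fun y => f y + g y) x = b.pdx j f x + b.pdx j g x := by
  unfold pdx
  rw [fderivWithin_fun_add (b.uniqueDiffOn x hx) hf hg]
  rfl

theorem pdx_sub {f g : E3 → ℝ} {x : E3} (hx : x ∈ closure b.B)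
    (hf : DifferentiableWithinAt ℝ f (closure b.B) x)
    (hg : DifferentiableWithinAt ℝ g (closure b.B) x) (j : Fin 3) :
    b.pdx j (fun y => f y - g y) x = b.pdx j f x - b.pdx j g x := by
  unfold pdx
  rw [fderivWithin_fun_sub (b.uniqueDiffOn x hx) hf hg]
  rfl

theorem pdx_mul {f g : E3 → ℝ} {x : E3} (hx : x ∈ closure b.B)
    (hf : DifferentiableWithinAt ℝ f (closure b.B) x)
    (hg : DifferentiableWithinAt ℝ g (closure b.B) x) (j : Fin 3) :
    b.pdx j (fun y => f y * g y) x = b.pdx j f x * g x + f x * b.pdx j g x := by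
  unfold pdx
  rw [fderivWithin_fun_mul (b.uniqueDiffOn x hx) hf hg]
  simp only [_root_.add_apply, _root_.smul_apply, smul_eq_mul]
  ring

theorem pdx_sum {f : Fin 3 → E3 → ℝ} {x : E3} (hx : x ∈ closure b.B)
    (hf : ∀ i, DifferentiableWithinAt ℝ (f i) (closure b.B) x) (j : Fin 3) :
    b.pdx j (fun y => ∑ i, f i y) x = ∑ i, b.pdx j (f i) x := by
  unfold pdx
  rw [fderivWithin_fun_sum (b.uniqueDiffOn x hx) fun i _ => hf i]
  simp

theorem pdx_const (a : ℝ) (x : E3) (j : Fin 3) : b.pdx j (fun _ => a) x = 0 := by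
  simp [pdx]

theorem contDiffOn_pdx {m n : WithTop ℕ∞} {f : E3 → ℝ} (hf : ContDiffOn ℝ n f (closure b.B))
    (h : m + 1 ≤ n) (j : Fin 3) : ContDiffOn ℝ m (b.pdx j f) (closure b.B) :=
  (hf.fderivWithin b.uniqueDiffOn h).clm_apply contDiffOn_const

theorem contDiffOn_pdx_one {f : E3 → ℝ} (hf : ContDiffOn ℝ 2 f (closure b.B)) (j : Fin 3) :
    ContDiffOn ℝ 1 (b.pdx j f) (closure b.B) :=
  contDiffOn_pdx hf (by norm_num) j

theorem continuousOn_pdx {f : E3 → ℝ} (hf : ContDiffOn ℝ 1 f (closure b.B)) (j : Fin 3) :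
    ContinuousOn (b.pdx j f) (closure b.B) :=
  (contDiffOn_pdx (m := 0) hf (by norm_num) j).continuousOn

/-- Second partial derivatives commute in the interior. -/
theorem pdx_comm {f : E3 → ℝ} (hf : ContDiffOn ℝ 2 f (closure b.B)) {x : E3} (hx : x ∈ b.B)
    (j k : Fin 3) : b.pdx j (b.pdx k f) x = b.pdx k (b.pdx j f) x := by
  have hc : ContDiffAt ℝ 2 f x := hf.contDiffAt (b.closure_mem_nhds hx)
  have hs : IsSymmSndFDerivAt ℝ f x := hc.isSymmSndFDerivAt (by simp)
  have hd : DifferentiableAt ℝ (fderiv ℝ f) x :=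
    (hc.fderiv_right (m := 1) (by norm_num)).differentiableAt (by norm_num)
  have key : ∀ i l : Fin 3, b.pdx i (b.pdx l f) x
      = fderiv ℝ (fderiv ℝ f) x (basisVec i) (basisVec l) := by
    intro i l
    have he : b.pdx l f =ᶠ[𝓝 x] fun y => fderiv ℝ f y (basisVec l) := by
      filter_upwards [b.isOpen.mem_nhds hx] with y hy using pdx_eq_fderiv hy l
    rw [pdx_congr_nhds he, pdx_eq_fderiv hx, fderiv_clm_apply hd (differentiableAt_const _)]
    simp
  rw [key, key, hs.eq]

theorem integrableOn_of_continuousOn {f : E3 → ℝ} (hf : ContinuousOn f (closure b.B)) :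
    IntegrableOn f b.B :=
  (hf.integrableOn_compact b.isCompact_closure).mono_set subset_closure

theorem volume_lt_top (b : Body) : volume b.B < ⊤ :=
  b.bounded.measure_lt_top

end Body

namespace Body

variable {b : Body}

/-! ### The divergence theorem for fields tangent to the boundary -/

/-- Near a boundary point, a `C¹` function vanishing on the boundary is controlled by the defining
function. -/
theorem bound_near_frontier {f : E3 → ℝ} (hf : ContDiffOn ℝ 1 f (closure b.B))
    (h0 : ∀ x ∈ frontier b.B, f x = 0) {x₀ : E3} (hx₀ : x₀ ∈ frontier b.B) :
    ∃ C : ℝ, ∀ᶠ x in 𝓝 x₀, x ∈ b.B → |f x| ≤ C * |b.ψ x| := by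
  have hψ0 := (b.mem_frontier_iff.1 hx₀).2
  -- A direction pointing out of the body, normalised so that `ψ` grows at unit rate at `x₀`, hence
  -- at rate above 1/2 nearby.
  obtain ⟨v, hv⟩ : ∃ v, fderiv ℝ b.ψ x₀ v = 1 := by
    obtain ⟨w, hw⟩ : ∃ w, fderiv ℝ b.ψ x₀ w ≠ 0 := by
      by_contra! hcon
      exact b.regular x₀ hψ0 (ContinuousLinearMap.ext hcon)
    exact ⟨(fderiv ℝ b.ψ x₀ w)⁻¹ • w, by simp [hw]⟩
  have hcont : Continuous fun y => fderiv ℝ b.ψ y v :=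
    (b.smooth.continuous_fderiv (by simp)).clm_apply continuous_const
  have hev : ∀ᶠ y in 𝓝 x₀, 1 / 2 < fderiv ℝ b.ψ y v :=
    hcont.continuousAt.eventually (lt_mem_nhds (by simp only [hv]; norm_num))
  obtain ⟨r, hr, hball⟩ := Metric.eventually_nhds_iff_ball.1 hev
  have hfd : ContinuousOn (fderivWithin ℝ f (closure b.B)) (closure b.B) :=
    hf.continuousOn_fderivWithin b.uniqueDiffOn (by norm_num)
  obtain ⟨L, hL⟩ := b.isCompact_closure.exists_bound_of_continuousOn hfd
  -- Moving from `x` along `v` reaches the frontier within time 2|ψ(x)|, since `ψ` grows at rate at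
  -- least 1/2; over that distance `f`, which ends at 0, changes by at most `L` times the length.
  refine ⟨L * (2 * ‖v‖), ?_⟩
  have hsmall : ∀ᶠ x in 𝓝 x₀, dist x x₀ + 2 * |b.ψ x| * ‖v‖ < r := by
    have hc : Continuous fun x => dist x x₀ + 2 * |b.ψ x| * ‖v‖ := by
      have := b.smooth.continuous
      fun_prop
    exact hc.continuousAt.eventually (gt_mem_nhds (by simpa [hψ0] using hr))
  filter_upwards [hsmall] with x hx hxB
  have hψx := b.neg_of_mem hxB
  rw [abs_of_neg hψx] at hx ⊢
  set s₁ : ℝ := 2 * -b.ψ x with hs₁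
  have hs₁0 : 0 ≤ s₁ := by rw [hs₁]; linarith
  have hpath : ∀ s ∈ Icc (0 : ℝ) s₁, x + s • v ∈ Metric.ball x₀ r := by
    intro s hs
    rw [Metric.mem_ball]
    calc dist (x + s • v) x₀ ≤ dist (x + s • v) x + dist x x₀ := dist_triangle _ _ _
      _ = s * ‖v‖ + dist x x₀ := by
          rw [dist_eq_norm, add_sub_cancel_left, norm_smul, Real.norm_of_nonneg hs.1]
      _ ≤ s₁ * ‖v‖ + dist x x₀ := by gcongr; exact hs.2
      _ < r := by linarith
  have hderiv : ∀ s : ℝ, HasDerivAt (fun s : ℝ => b.ψ (x + s • v))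
      (fderiv ℝ b.ψ (x + s • v) v) s := by
    intro s
    have h1 : HasDerivAt (fun s : ℝ => x + s • v) v s := by
      simpa using ((hasDerivAt_id s).smul_const v).const_add x
    exact (b.differentiable_ψ (x + s • v)).hasFDerivAt.comp_hasDerivAt s h1
  have hend : 0 ≤ b.ψ (x + s₁ • v) := by
    have h := (convex_Icc (0 : ℝ) s₁).mul_sub_le_image_sub_of_le_deriv
      (f := fun s : ℝ => b.ψ (x + s • v)) (C := 1 / 2)
      (fun s _ => (hderiv s).continuousAt.continuousWithinAt)
      (fun s _ => (hderiv s).differentiableAt.differentiableWithinAt)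
      (fun s hs => by
        rw [(hderiv s).deriv]
        exact (hball _ (hpath s (interior_subset hs))).le)
      0 (left_mem_Icc.2 hs₁0) s₁ (right_mem_Icc.2 hs₁0) hs₁0
    simp only [zero_smul, add_zero, sub_zero] at h
    rw [hs₁] at h ⊢
    linarith
  have hcpath : Continuous fun s : ℝ => x + s • v := by fun_prop
  have hK : IsCompact (Icc (0 : ℝ) s₁ ∩ (fun s : ℝ => x + s • v) ⁻¹' b.Bᶜ) :=
    isCompact_Icc.inter_right (b.isOpen.isClosed_compl.preimage hcpath)
  -- The first exit time: the path stays in the body before it, so the whole segment lies in the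
  -- closure, where the bound on the derivative of `f` is available.
  obtain ⟨s, ⟨hsI, hsB⟩, hmin⟩ := hK.exists_isLeast
    ⟨s₁, right_mem_Icc.2 hs₁0, fun h => (b.neg_of_mem h).not_ge hend⟩
  have hin : ∀ s' ∈ Ico (0 : ℝ) s, x + s' • v ∈ b.B := by
    intro s' hs'
    by_contra hcon
    exact hs'.2.not_ge (hmin ⟨⟨hs'.1, hs'.2.le.trans hsI.2⟩, hcon⟩)
  have hs0 : 0 < s := by
    rcases hsI.1.eq_or_lt with h | h
    · refine absurd hxB ?_
      have : x + s • v ∉ b.B := hsB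
      rwa [← h, zero_smul, add_zero] at this
    · exact h
  have hcl : ∀ s' ∈ Icc (0 : ℝ) s, x + s' • v ∈ closure b.B := by
    intro s' hs'
    have : s' ∈ closure (Ico (0 : ℝ) s) := by rwa [closure_Ico hs0.ne]
    exact map_mem_closure (f := fun s : ℝ => x + s • v) hcpath this hin
  have hseg : segment ℝ x (x + s • v) ⊆ closure b.B := by
    rw [segment_eq_image']
    rintro _ ⟨a, ha, rfl⟩
    simp only [add_sub_cancel_left, smul_smul]
    exact hcl _ ⟨mul_nonneg ha.1 hs0.le, by nlinarith [ha.2]⟩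
  have hfr : x + s • v ∈ frontier b.B := by
    rw [b.isOpen.frontier_eq]
    exact ⟨hcl s (right_mem_Icc.2 hs0.le), hsB⟩
  have hmv := (convex_segment (𝕜 := ℝ) x (x + s • v)).norm_image_sub_le_of_norm_hasFDerivWithin_le
    (f := f) (f' := fderivWithin ℝ f (closure b.B)) (C := L)
    (fun y hy => ((hf.differentiableOn (by norm_num)) y (hseg hy)).hasFDerivWithinAt.mono hseg)
    (fun y hy => hL y (hseg hy)) (right_mem_segment ℝ _ _) (left_mem_segment ℝ _ _)
  rw [h0 _ hfr, sub_zero, Real.norm_eq_abs, sub_add_cancel_left, norm_neg, norm_smul,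
    Real.norm_of_nonneg hs0.le] at hmv
  have hL0 : 0 ≤ L := (norm_nonneg _).trans (hL x (subset_closure hxB))
  calc |f x| ≤ L * (s * ‖v‖) := hmv
    _ ≤ L * (s₁ * ‖v‖) := by gcongr; exact hsI.2
    _ = L * (2 * ‖v‖) * -b.ψ x := by rw [hs₁]; ring

/-- A `C¹` function vanishing on the boundary is controlled by the defining function. -/
theorem exists_bound_of_frontier_eq_zero {f : E3 → ℝ} (hf : ContDiffOn ℝ 1 f (closure b.B))
    (h0 : ∀ x ∈ frontier b.B, f x = 0) : ∃ C : ℝ, ∀ x ∈ b.B, |f x| ≤ C * |b.ψ x| := by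
  have hloc : ∀ x₀ ∈ closure b.B, ∃ C : ℝ, ∀ᶠ x in 𝓝 x₀, x ∈ b.B → |f x| ≤ C * |b.ψ x| := by
    intro x₀ hx₀
    rcases b.mem_or_mem_frontier hx₀ with h | h
    · have hψ : 0 < |b.ψ x₀| := abs_pos.2 (b.neg_of_mem h).ne
      have hfc : ContinuousAt f x₀ := hf.continuousOn.continuousAt (b.closure_mem_nhds h)
      -- With this constant the right side exceeds |f| by exactly 1 at `x₀`, so the strict
      -- inequality persists nearby.
      refine ⟨(|f x₀| + 1) / |b.ψ x₀|, ?_⟩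
      have hc : ContinuousAt (fun x => (|f x₀| + 1) / |b.ψ x₀| * |b.ψ x| - |f x|) x₀ :=
        (continuousAt_const.mul b.smooth.continuous.continuousAt.abs).sub hfc.abs
      filter_upwards [hc.eventually (lt_mem_nhds (a := 0) (by
        simp only [div_mul_cancel₀ _ hψ.ne']; linarith))] with x hx _
      linarith
    · exact bound_near_frontier hf h0 h
  have := b.isCompact_closure.induction_on
    (p := fun s => ∃ C : ℝ, ∀ x ∈ s, x ∈ b.B → |f x| ≤ C * |b.ψ x|) ⟨0, by simp⟩
    (fun s t hst ⟨C, hC⟩ => ⟨C, fun x hx => hC x (hst hx)⟩)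
    (fun s t ⟨C, hC⟩ ⟨C', hC'⟩ => ⟨max C C', by
      rintro x (hx | hx) hxB
      · exact (hC x hx hxB).trans (by gcongr; exact le_max_left _ _)
      · exact (hC' x hx hxB).trans (by gcongr; exact le_max_right _ _)⟩)
    (fun x hx => by
      obtain ⟨C, hC⟩ := hloc x hx
      exact ⟨_, mem_nhdsWithin_of_mem_nhds hC, C, fun y hy => hy⟩)
  obtain ⟨C, hC⟩ := this
  exact ⟨C, fun x hx => hC x (subset_closure hx) hx⟩

/-- A smooth cutoff, equal to `1` where `ψ ≤ -2/s` and to `0` where `ψ ≥ -1/s`. -/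
noncomputable def cutoff (b : Body) (s : ℝ) (x : E3) : ℝ := Real.smoothTransition (-s * b.ψ x - 1)

theorem contDiff_cutoff (s : ℝ) : ContDiff ℝ 1 (b.cutoff s) := by
  have h : ContDiff ℝ 1 b.ψ := b.smooth.of_le (by simp)
  exact Real.smoothTransition.contDiff.comp ((contDiff_const.mul h).sub contDiff_const)

theorem fderiv_cutoff (s : ℝ) (x v : E3) : fderiv ℝ (b.cutoff s) x v
    = deriv Real.smoothTransition (-s * b.ψ x - 1) * (-s * fderiv ℝ b.ψ x v) := by
  have h1 : HasFDerivAt (fun x => -s * b.ψ x - 1) (-s • fderiv ℝ b.ψ x) x :=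
    ((b.differentiable_ψ x).hasFDerivAt.const_mul (-s)).sub_const 1
  have h2 : HasDerivAt Real.smoothTransition (deriv Real.smoothTransition (-s * b.ψ x - 1))
      (-s * b.ψ x - 1) :=
    ((Real.smoothTransition.contDiff (n := 1)).differentiable (by norm_num) _).hasDerivAt
  have h3 : HasFDerivAt (b.cutoff s) _ x := h2.comp_hasFDerivAt x h1
  rw [h3.fderiv]
  simp

theorem cutoff_eq_zero {s : ℝ} {x : E3} (h : -1 ≤ s * b.ψ x) : b.cutoff s x = 0 :=
  Real.smoothTransition.zero_of_nonpos (by linarith)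

theorem eventually_cutoff_eq_zero {s : ℝ} {x : E3} (h : -1 < s * b.ψ x) :
    ∀ᶠ y in 𝓝 x, b.cutoff s y = 0 := by
  have hc : Continuous fun y => s * b.ψ y := continuous_const.mul b.smooth.continuous
  filter_upwards [hc.continuousAt.eventually (lt_mem_nhds h)] with y hy using cutoff_eq_zero hy.le

theorem deriv_smoothTransition_eq_zero {t : ℝ} (h : t < 0 ∨ 1 < t) :
    deriv Real.smoothTransition t = 0 := by
  rcases h with h | h
  · have : Real.smoothTransition =ᶠ[𝓝 t] fun _ => (0 : ℝ) := by
      filter_upwards [gt_mem_nhds h] with y hy using Real.smoothTransition.zero_of_nonpos hy.le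
    rw [this.deriv_eq, deriv_const]
  · have : Real.smoothTransition =ᶠ[𝓝 t] fun _ => (1 : ℝ) := by
      filter_upwards [lt_mem_nhds h] with y hy using Real.smoothTransition.one_of_one_le hy.le
    rw [this.deriv_eq, deriv_const]

theorem exists_bound_deriv_smoothTransition :
    ∃ A : ℝ, ∀ t, |deriv Real.smoothTransition t| ≤ A := by
  have hc : Continuous (deriv Real.smoothTransition) :=
    (Real.smoothTransition.contDiff (n := 1)).continuous_deriv (by norm_num)
  obtain ⟨A, hA⟩ := (isCompact_Icc (a := (0 : ℝ)) (b := 1)).exists_bound_of_continuousOn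
    hc.continuousOn
  refine ⟨A, fun t => ?_⟩
  by_cases h : t ∈ Icc (0 : ℝ) 1
  · exact hA t h
  · have hA0 : 0 ≤ A := (norm_nonneg _).trans (hA 0 (by simp))
    rw [deriv_smoothTransition_eq_zero, abs_zero]
    · exact hA0
    · by_contra! hcon
      exact h hcon

/-- The cutoff vanishes in a neighbourhood of every point where `ψ` ≥ 0, so the values of `f`
outside the body, over which there is no control, play no role. -/
theorem contDiff_cutoff_mul {f : E3 → ℝ} (hf : ContDiffOn ℝ 1 f (closure b.B)) {s : ℝ}
    (hs : 0 < s) : ContDiff ℝ 1 fun x => b.cutoff s x * f x := by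
  rw [contDiff_iff_contDiffAt]
  intro x
  by_cases hx : x ∈ b.B
  · exact (contDiff_cutoff s).contDiffAt.mul (hf.contDiffAt (b.closure_mem_nhds hx))
  · have hψ : 0 ≤ b.ψ x := not_lt.1 fun h => hx (b.mem_of_neg h)
    refine (contDiffAt_const (c := (0 : ℝ))).congr_of_eventuallyEq ?_
    filter_upwards [eventually_cutoff_eq_zero (s := s) (x := x) (by nlinarith)] with y hy
    rw [hy, zero_mul]

theorem hasCompactSupport_cutoff_mul (f : E3 → ℝ) {s : ℝ} (hs : 0 < s) :
    HasCompactSupport fun x => b.cutoff s x * f x := by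
  refine HasCompactSupport.intro b.isCompact_closure fun x hx => ?_
  have hψ : 0 ≤ b.ψ x := not_lt.1 fun h => hx (subset_closure (b.mem_of_neg h))
  rw [cutoff_eq_zero (by nlinarith), zero_mul]

/-- The integral of a partial derivative of a compactly supported `C¹` function vanishes. -/
theorem integral_fderiv_eq_zero_of_hasCompactSupport {F : E3 → ℝ} (hF : ContDiff ℝ 1 F)
    (hc : HasCompactSupport F) (v : E3) : ∫ x, fderiv ℝ F x v = 0 := by
  have hcf : Continuous fun x => fderiv ℝ F x v :=
    (hF.continuous_fderiv (by norm_num)).clm_apply continuous_const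
  have hi : Integrable fun x => fderiv ℝ F x v :=
    hcf.integrable_of_hasCompactSupport (hc.fderiv_apply ℝ v)
  have := integral_mul_fderiv_eq_neg_fderiv_mul_of_integrable (μ := volume) (𝕜 := ℝ)
    (f := fun _ : E3 => (1 : ℝ)) (g := F) (v := v) (by simp) (by simpa using hi)
    (by simpa using hF.continuous.integrable_of_hasCompactSupport hc)
    (fun x _ => differentiableAt_const _) (fun x _ => hF.differentiable (by norm_num) x)
  simpa using this

/-- The integrand is the divergence of the cutoff times `w`, expanded by the product rule. That
field is globally C¹ with compact support, so its divergence integrates to zero over the whole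
space, and it vanishes off the body. -/
theorem integral_cutoff_eq_zero {w : Fin 3 → E3 → ℝ}
    (hw : ∀ j, ContDiffOn ℝ 1 (w j) (closure b.B)) {s : ℝ} (hs : 0 < s) :
    ∫ x in b.B, (b.cutoff s x * ∑ j, b.pdx j (w j) x
      + deriv Real.smoothTransition (-s * b.ψ x - 1)
        * (-s * ∑ j, w j x * fderiv ℝ b.ψ x (basisVec j))) = 0 := by
  have hF := fun j => contDiff_cutoff_mul (hw j) hs
  have hc := fun j => hasCompactSupport_cutoff_mul (b := b) (w j) hs
  have hsum : ∫ x, ∑ j, fderiv ℝ (fun x => b.cutoff s x * w j x) x (basisVec j) = 0 := by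
    rw [integral_finsetSum]
    · exact Finset.sum_eq_zero fun j _ =>
        integral_fderiv_eq_zero_of_hasCompactSupport (hF j) (hc j) _
    · intro j _
      exact (((hF j).continuous_fderiv (by norm_num)).clm_apply
        continuous_const).integrable_of_hasCompactSupport ((hc j).fderiv_apply ℝ _)
  have hset := setIntegral_eq_integral_of_forall_compl_eq_zero (μ := volume) (s := b.B)
    (f := fun x => ∑ j, fderiv ℝ (fun x => b.cutoff s x * w j x) x (basisVec j)) (by
    intro x hx
    have hψ : 0 ≤ b.ψ x := not_lt.1 fun h => hx (b.mem_of_neg h)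
    refine Finset.sum_eq_zero fun j _ => ?_
    have : (fun x => b.cutoff s x * w j x) =ᶠ[𝓝 x] fun _ => (0 : ℝ) := by
      filter_upwards [eventually_cutoff_eq_zero (s := s) (x := x) (by nlinarith)] with y hy
      rw [hy, zero_mul]
    rw [this.fderiv_eq]
    simp)
  rw [← hsum, ← hset]
  refine setIntegral_congr_fun b.isOpen.measurableSet fun x hx => ?_
  have hd : ∀ j, fderiv ℝ (fun x => b.cutoff s x * w j x) x (basisVec j)
      = b.cutoff s x * b.pdx j (w j) x
        + w j x * fderiv ℝ (b.cutoff s) x (basisVec j) := by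
    intro j
    have hwd : DifferentiableAt ℝ (w j) x :=
      ((hw j).contDiffAt (b.closure_mem_nhds hx)).differentiableAt (by norm_num)
    rw [fderiv_fun_mul ((contDiff_cutoff s).differentiable (by norm_num) x) hwd,
      pdx_eq_fderiv hx]
    simp
  simp only [hd, fderiv_cutoff, Fin.sum_univ_three]
  ring

/-- The divergence theorem for a `C¹` field that is tangent to the boundary. -/
theorem integral_div_eq_zero {w : Fin 3 → E3 → ℝ}
    (hw : ∀ j, ContDiffOn ℝ 1 (w j) (closure b.B))
    (htan : ∀ x ∈ frontier b.B, ∑ j, w j x * fderiv ℝ b.ψ x (basisVec j) = 0) :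
    ∫ x in b.B, ∑ j, b.pdx j (w j) x = 0 := by
  have hψd : ∀ j, ContDiff ℝ 1 fun x => fderiv ℝ b.ψ x (basisVec j) := fun j =>
    (b.smooth.fderiv_right (m := 1) (by norm_cast)).clm_apply contDiff_const
  have hwψ : ContDiffOn ℝ 1 (fun x => ∑ j, w j x * fderiv ℝ b.ψ x (basisVec j)) (closure b.B) :=
    ContDiffOn.sum fun j _ => (hw j).mul (hψd j).contDiffOn
  obtain ⟨C, hC⟩ := exists_bound_of_frontier_eq_zero hwψ htan
  obtain ⟨A, hA⟩ := exists_bound_deriv_smoothTransition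
  have hA0 : 0 ≤ A := (abs_nonneg _).trans (hA 0)
  have hdivc : ContinuousOn (fun x => ∑ j, b.pdx j (w j) x) (closure b.B) :=
    continuousOn_finsetSum _ fun j _ => continuousOn_pdx (hw j) j
  obtain ⟨D, hD⟩ := b.isCompact_closure.exists_bound_of_continuousOn hdivc
  have hcs : Continuous (deriv Real.smoothTransition) :=
    (Real.smoothTransition.contDiff (n := 1)).continuous_deriv (by norm_num)
  have hlim := tendsto_integral_of_dominated_convergence (μ := volume.restrict b.B)
    (F := fun (n : ℕ) x => b.cutoff (n + 1) x * ∑ j, b.pdx j (w j) x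
      + deriv Real.smoothTransition (-(n + 1 : ℝ) * b.ψ x - 1)
        * (-(n + 1 : ℝ) * ∑ j, w j x * fderiv ℝ b.ψ x (basisVec j)))
    -- `D` bounds the divergence, `A` the derivative of the transition function. Where that
    -- derivative is nonzero, (n+1)|ψ| ≤ 2, and tangency gives |w·∇ψ| ≤ C|ψ|, so the large factor
    -- n+1 is compensated. The absolute value is there because the sign of `C` is unknown.
    (f := fun x => ∑ j, b.pdx j (w j) x) (fun _ => D + A * (2 * |C|)) ?_ ?_ ?_ ?_
  · simp only [integral_cutoff_eq_zero hw (Nat.cast_add_one_pos _)] at hlim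
    exact tendsto_nhds_unique hlim tendsto_const_nhds
  · intro n
    refine ContinuousOn.aestronglyMeasurable ?_ b.isOpen.measurableSet
    refine ContinuousOn.mono ?_ subset_closure
    have h1 := (contDiff_cutoff (b := b) (n + 1)).continuous
    have h2 := b.smooth.continuous
    exact (h1.continuousOn.mul hdivc).add ((hcs.comp (by fun_prop)).continuousOn.mul
      (continuousOn_const.mul hwψ.continuousOn))
  · have := b.volume_lt_top
    exact integrableOn_const this.ne
  · intro n
    refine (ae_restrict_iff' b.isOpen.measurableSet).2 (ae_of_all _ fun x hx => ?_)
    refine (norm_add_le _ _).trans (add_le_add ?_ ?_)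
    · rw [norm_mul]
      have h1 : ‖b.cutoff (n + 1) x‖ ≤ 1 := by
        rw [cutoff, Real.norm_of_nonneg (Real.smoothTransition.nonneg _)]
        exact Real.smoothTransition.le_one _
      have h2 := hD x (subset_closure hx)
      calc _ ≤ 1 * D := by gcongr
        _ = D := one_mul D
    · by_cases hcase : 1 < -(n + 1 : ℝ) * b.ψ x - 1
      · rw [deriv_smoothTransition_eq_zero (Or.inr hcase), zero_mul, norm_zero]
        positivity
      · have hn : (0 : ℝ) < n + 1 := Nat.cast_add_one_pos n
        have hx' := b.neg_of_mem hx
        rw [norm_mul, norm_mul, norm_neg, Real.norm_of_nonneg hn.le]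
        refine mul_le_mul (hA _) ?_ (by positivity) hA0
        have h3 : |b.ψ x| * (n + 1) ≤ 2 := by
          rw [abs_of_neg hx']
          linarith
        calc (n + 1 : ℝ) * ‖∑ j, w j x * fderiv ℝ b.ψ x (basisVec j)‖
            ≤ (n + 1 : ℝ) * (|C| * |b.ψ x|) := by
              refine mul_le_mul_of_nonneg_left ((hC x hx).trans ?_) hn.le
              gcongr
              exact le_abs_self C
          _ = |C| * (|b.ψ x| * (n + 1)) := by ring
          _ ≤ |C| * 2 := by gcongr
          _ = 2 * |C| := mul_comm _ _
  · refine (ae_restrict_iff' b.isOpen.measurableSet).2 (ae_of_all _ fun x hx => ?_)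
    refine tendsto_const_nhds.congr' ?_
    have hx' := b.neg_of_mem hx
    -- Beyond this index the point lies where the cutoff is identically 1, so the approximating
    -- integrand equals the limit from then on.
    obtain ⟨N, hN⟩ := exists_nat_gt (2 / -b.ψ x)
    filter_upwards [eventually_ge_atTop N] with n hn
    have hn' : (N : ℝ) ≤ n := Nat.cast_le.2 hn
    have h2 : 2 < (n + 1 : ℝ) * -b.ψ x := by
      rw [div_lt_iff₀ (by linarith)] at hN
      nlinarith
    have h1 : 1 < -(n + 1 : ℝ) * b.ψ x - 1 := by linarith
    rw [deriv_smoothTransition_eq_zero (Or.inr h1), cutoff,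
      Real.smoothTransition.one_of_one_le h1.le]
    ring

end Body

namespace Body

variable {b : Body}

/-! ### The unit normal -/

theorem gradient_apply (b : Body) (x : E3) (i : Fin 3) :
    gradient b.ψ x i = fderiv ℝ b.ψ x (basisVec i) := by
  have h1 : inner ℝ (gradient b.ψ x) (basisVec i) = fderiv ℝ b.ψ x (basisVec i) := by
    rw [gradient, InnerProductSpace.toDual_symm_apply]
  rw [← h1, basisVec, EuclideanSpace.inner_single_right]
  simp

theorem gradient_ne_zero {x : E3} (hx : x ∈ frontier b.B) : gradient b.ψ x ≠ 0 := by
  intro h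
  refine b.regular x (b.mem_frontier_iff.1 hx).2 ?_
  rw [gradient] at h
  exact (map_eq_zero_iff _ (LinearIsometryEquiv.injective _)).1 h

theorem normal_eq (b : Body) (i : Fin 3) (x : E3) : b.normal i x
    = fderiv ℝ b.ψ x (basisVec i) / √(∑ j, (fderiv ℝ b.ψ x (basisVec j)) ^ 2) := by
  rw [normal, EuclideanSpace.norm_eq]
  simp only [gradient_apply, Real.norm_eq_abs, sq_abs]

theorem continuous_gradient (b : Body) : Continuous (gradient b.ψ) := by
  unfold gradient
  exact (LinearIsometryEquiv.continuous _).comp (b.smooth.continuous_fderiv (by simp))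

theorem contDiffAt_normal {x : E3} (hx : gradient b.ψ x ≠ 0) (i : Fin 3) :
    ContDiffAt ℝ 2 (b.normal i) x := by
  have hψd : ∀ j, ContDiff ℝ 2 fun x => fderiv ℝ b.ψ x (basisVec j) := fun j =>
    (b.smooth.fderiv_right (m := 2) (by norm_cast)).clm_apply contDiff_const
  have heq : b.normal i = fun x => fderiv ℝ b.ψ x (basisVec i)
      / √(∑ j, (fderiv ℝ b.ψ x (basisVec j)) ^ 2) := funext fun x => b.normal_eq i x
  have hnorm : √(∑ j, (fderiv ℝ b.ψ x (basisVec j)) ^ 2) = ‖gradient b.ψ x‖ := by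
    rw [EuclideanSpace.norm_eq]
    simp only [gradient_apply, Real.norm_eq_abs, sq_abs]
  have hne : √(∑ j, (fderiv ℝ b.ψ x (basisVec j)) ^ 2) ≠ 0 := by
    rw [hnorm]
    exact norm_ne_zero_iff.2 hx
  have hne' : ∑ j, (fderiv ℝ b.ψ x (basisVec j)) ^ 2 ≠ 0 := by
    intro h
    rw [h, Real.sqrt_zero] at hne
    exact hne rfl
  rw [heq]
  refine (hψd i).contDiffAt.div ?_ hne
  exact (ContDiff.sum fun j _ => (hψd j).pow 2).contDiffAt.sqrt hne'

theorem contDiffAt_normal_of_frontier {x : E3} (hx : x ∈ frontier b.B) (i : Fin 3) :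
    ContDiffAt ℝ 2 (b.normal i) x :=
  contDiffAt_normal (gradient_ne_zero hx) i

theorem differentiableWithinAt_normal {x : E3} (hx : x ∈ frontier b.B) (i : Fin 3) :
    DifferentiableWithinAt ℝ (b.normal i) (closure b.B) x :=
  ((contDiffAt_normal_of_frontier hx i).differentiableAt (by norm_num)).differentiableWithinAt

theorem sum_normal_sq {x : E3} (hx : gradient b.ψ x ≠ 0) :
    ∑ j, b.normal j x * b.normal j x = 1 := by
  have hn : ‖gradient b.ψ x‖ ≠ 0 := norm_ne_zero_iff.2 hx
  have h := EuclideanSpace.norm_sq_eq (gradient b.ψ x)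
  simp only [Real.norm_eq_abs, sq_abs, Fin.sum_univ_three] at h
  simp only [normal, Fin.sum_univ_three]
  field_simp
  exact h.symm

/-- Differentiate |n|² = 1, which holds in a full neighbourhood of a boundary point because the
gradient of `ψ` stays nonzero there. -/
theorem sum_normal_mul_pdx_normal {x : E3} (hx : x ∈ frontier b.B) (k : Fin 3) :
    ∑ j, b.normal j x * b.pdx k (b.normal j) x = 0 := by
  have hev : (fun y => ∑ j, b.normal j y * b.normal j y) =ᶠ[𝓝 x] fun _ => (1 : ℝ) := by
    filter_upwards [b.continuous_gradient.continuousAt.eventually_ne (gradient_ne_zero hx)]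
      with y hy using sum_normal_sq hy
  have hcl := b.frontier_subset hx
  have h := pdx_congr_nhds (b := b) hev k
  have hd := fun j => differentiableWithinAt_normal hx j
  rw [pdx_const, pdx_sum (f := fun j y => b.normal j y * b.normal j y) hcl fun j => (hd j).mul (hd j)] at h
  simp only [pdx_mul hcl (hd _) (hd _), Fin.sum_univ_three] at h ⊢
  linarith

theorem fderiv_ψ_eq {x : E3} (hx : x ∈ frontier b.B) (j : Fin 3) :
    fderiv ℝ b.ψ x (basisVec j) = ‖gradient b.ψ x‖ * b.normal j x := by
  have hn : ‖gradient b.ψ x‖ ≠ 0 := norm_ne_zero_iff.2 (gradient_ne_zero hx)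
  rw [normal, gradient_apply]
  field_simp

/-- The unit normal agrees near the boundary with a globally regular field. -/
theorem exists_extension_normal (b : Body) : ∃ N : Fin 3 → E3 → ℝ,
    (∀ i, ContDiff ℝ 2 (N i)) ∧ ∀ x ∈ frontier b.B, ∀ i, N i =ᶠ[𝓝 x] b.normal i := by
  have hs : IsClosed {x | gradient b.ψ x = 0} :=
    isClosed_eq b.continuous_gradient continuous_const
  -- The formula for the normal is singular at critical points of `ψ`. These form a closed set
  -- disjoint from the frontier, so a cutoff removes them while leaving the normal, with all its
  -- derivatives, intact at the boundary.
  obtain ⟨ζ, h0, h1, -⟩ := exists_contMDiffMap_zero_one_nhds_of_isClosed (n := 2)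
    (modelWithCornersSelf ℝ E3) hs
    (isClosed_frontier (s := b.B)) (Set.disjoint_left.2 fun x hx hx' => gradient_ne_zero hx' hx)
  have hζ : ContDiff ℝ 2 ζ := ζ.contMDiff.contDiff
  refine ⟨fun i x => ζ x * b.normal i x, fun i => ?_, fun x hx i => ?_⟩
  · rw [contDiff_iff_contDiffAt]
    intro x
    by_cases hx : gradient b.ψ x = 0
    · refine (contDiffAt_const (c := (0 : ℝ))).congr_of_eventuallyEq ?_
      filter_upwards [h0.filter_mono (nhds_le_nhdsSet (s := {x | gradient b.ψ x = 0}) hx)] with y hy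
      rw [hy, zero_mul]
    · exact hζ.contDiffAt.mul (contDiffAt_normal hx i)
  · filter_upwards [h1.filter_mono (nhds_le_nhdsSet hx)] with y hy
    rw [hy, one_mul]

/-! ### Green's identity for second-gradient stresses -/

/-- The boundary traction of a stress `t` and a hyperstress `m`. -/
noncomputable def traction (b : Body) (t : Fin 3 → E3 → ℝ) (m : Fin 3 → Fin 3 → E3 → ℝ)
    (x : E3) : ℝ :=
  (∑ j, (t j x - ∑ k, b.pdx k (m k j) x) * b.normal j x)
    - (∑ j, b.surfGrad j (fun y => ∑ k, m k j y * b.normal k y) x)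
    + b.surfDivNormal x * ∑ j, ∑ k, m k j x * b.normal k x * b.normal j x

/-- The boundary double traction of a hyperstress `m`. -/
noncomputable def doubleTraction (b : Body) (m : Fin 3 → Fin 3 → E3 → ℝ) (x : E3) : ℝ :=
  ∑ j, ∑ k, m k j x * b.normal k x * b.normal j x

/-- The pointwise algebra behind Green's identity, with `c` = mᵀn, `dn k j` = ∂ₖnⱼ, `dc k j` = ∂ₖcⱼ
and `f'` = ∇f. The raw flux contains c·∇f, tangential part included; subtracting the flux of the
curl-type field, a surface divergence of c f, leaves only the normal derivative of f. The identity
uses |n| = 1 and n·∂ₖn = 0 and no symmetry of `m`. -/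
theorem normal_flux_identity (n c f' t p : Fin 3 → ℝ) (m dn dc : Fin 3 → Fin 3 → ℝ) (f : ℝ)
    (hn : ∑ j, n j * n j = 1) (hdn : ∀ k, ∑ j, n j * dn k j = 0)
    (hc : ∀ k, ∑ l, m l k * n l = c k) :
    ∑ j, ((t j - p j) * f + ∑ k, m j k * f' k
        - ∑ k, ((dn k j * (c k * f) + n j * (dc k k * f + c k * f' k))
          - (dn k k * (c j * f) + n k * (dc k j * f + c j * f' k)))) * n j
      = ((∑ j, (t j - p j) * n j)
          - (∑ j, ∑ k, ((if j = k then 1 else 0) - n j * n k) * dc k j)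
          + (∑ l, ∑ j, ((if l = j then 1 else 0) - n l * n j) * dn j l)
            * ∑ j, ∑ k, m k j * n k * n j) * f
        + (∑ j, ∑ k, m k j * n k * n j) * ∑ i, n i * f' i := by
  have hR : ∑ j, ∑ k, m k j * n k * n j = ∑ j, c j * n j :=
    Finset.sum_congr rfl fun j _ => by rw [← hc j, Finset.sum_mul]
  have hL : ∑ j, (∑ k, m j k * f' k) * n j = ∑ k, c k * f' k := by
    simp only [← hc, Finset.sum_mul]
    rw [Finset.sum_comm]
    exact Finset.sum_congr rfl fun k _ => Finset.sum_congr rfl fun j _ => by ring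
  rw [hR]
  have h0 := hdn 0
  have h1 := hdn 1
  have h2 := hdn 2
  have hd01 : (0 : Fin 3) ≠ 1 := by decide
  have hd02 : (0 : Fin 3) ≠ 2 := by decide
  have hd12 : (1 : Fin 3) ≠ 2 := by decide
  simp only [Fin.sum_univ_three] at hn h0 h1 h2 hL ⊢
  simp only [if_true, hd01, hd02, hd12, hd01.symm, hd02.symm, hd12.symm, if_false]
  linear_combination hL - c 0 * f * h0 - c 1 * f * h1 - c 2 * f * h2
    - (dc 0 0 * f + c 0 * f' 0 + dc 1 1 * f + c 1 * f' 1 + dc 2 2 * f + c 2 * f' 2) * hn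
    + (n 0 * h0 + n 1 * h1 + n 2 * h2) * (c 0 * n 0 + c 1 * n 1 + c 2 * n 2) * f

/-- The vector field `∂_k (N_j v_k - N_k v_j)`, with `v_k = N_l m_{lk} f`, whose divergence
vanishes and whose flux is a surface divergence. -/
noncomputable def curlField (b : Body) (N : Fin 3 → E3 → ℝ) (m : Fin 3 → Fin 3 → E3 → ℝ)
    (f : E3 → ℝ) (j : Fin 3) (x : E3) : ℝ :=
  ∑ k, b.pdx k (fun y => N j y * ((∑ l, m l k y * N l y) * f y)
    - N k y * ((∑ l, m l j y * N l y) * f y)) x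

section Green

variable {t : Fin 3 → E3 → ℝ} {m : Fin 3 → Fin 3 → E3 → ℝ} {f : E3 → ℝ} {N : Fin 3 → E3 → ℝ}

theorem contDiffOn_wedge (hm : ∀ k j, ContDiffOn ℝ 2 (m k j) (closure b.B))
    (hf : ContDiffOn ℝ 2 f (closure b.B)) (hN : ∀ i, ContDiff ℝ 2 (N i)) (j k : Fin 3) :
    ContDiffOn ℝ 2 (fun y => N j y * ((∑ l, m l k y * N l y) * f y)
      - N k y * ((∑ l, m l j y * N l y) * f y)) (closure b.B) := by
  have hc : ∀ k, ContDiffOn ℝ 2 (fun y => ∑ l, m l k y * N l y) (closure b.B) := fun k =>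
    ContDiffOn.sum fun l _ => (hm l k).mul (hN l).contDiffOn
  exact ((hN j).contDiffOn.mul ((hc k).mul hf)).sub ((hN k).contDiffOn.mul ((hc j).mul hf))

theorem contDiffOn_curlField (hm : ∀ k j, ContDiffOn ℝ 2 (m k j) (closure b.B))
    (hf : ContDiffOn ℝ 2 f (closure b.B)) (hN : ∀ i, ContDiff ℝ 2 (N i)) (j : Fin 3) :
    ContDiffOn ℝ 1 (b.curlField N m f j) (closure b.B) :=
  ContDiffOn.sum fun k _ => contDiffOn_pdx_one (contDiffOn_wedge hm hf hN j k) k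

/-- The double derivative ∂ⱼ∂ₖ is symmetric and is contracted with an array antisymmetric in j and
k. It does not matter that `N` is a normal: any C² field would do, which is why the extension may be
arbitrary inside the body. -/
theorem div_curlField (hm : ∀ k j, ContDiffOn ℝ 2 (m k j) (closure b.B))
    (hf : ContDiffOn ℝ 2 f (closure b.B)) (hN : ∀ i, ContDiff ℝ 2 (N i)) {x : E3}
    (hx : x ∈ b.B) : ∑ j, b.pdx j (b.curlField N m f j) x = 0 := by
  have hcl := subset_closure hx
  set A : Fin 3 → Fin 3 → E3 → ℝ := fun j k y => N j y * ((∑ l, m l k y * N l y) * f y)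
      - N k y * ((∑ l, m l j y * N l y) * f y) with hA
  have hAc : ∀ j k, ContDiffOn ℝ 2 (A j k) (closure b.B) := contDiffOn_wedge hm hf hN
  have hd : ∀ j k, DifferentiableWithinAt ℝ (b.pdx k (A j k)) (closure b.B) x := fun j k =>
    ((contDiffOn_pdx_one (hAc j k) k).differentiableOn (by norm_num)) x hcl
  have hanti : ∀ j k y, A j k y = 0 - A k j y := fun j k y => by
    rw [hA]
    ring
  have h1 : ∑ j, b.pdx j (b.curlField N m f j) x = ∑ j, ∑ k, b.pdx j (b.pdx k (A j k)) x :=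
    Finset.sum_congr rfl fun j _ => pdx_sum hcl (hd j) j
  have h2 : ∀ j k, b.pdx j (b.pdx k (A j k)) x = - b.pdx k (b.pdx j (A k j)) x := by
    intro j k
    have h3 : ∀ y ∈ closure b.B, b.pdx j (A j k) y = 0 - b.pdx j (A k j) y := by
      intro y hy
      rw [show A j k = fun y => 0 - A k j y from funext (hanti j k),
        pdx_sub hy (differentiableWithinAt_const _)
          ((hAc k j).differentiableOn (by norm_num) y hy), pdx_const]
    rw [pdx_comm (hAc j k) hx, pdx_congr h3 hcl,
      pdx_sub hcl (differentiableWithinAt_const _) (hd k j), pdx_const, zero_sub]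
  rw [h1]
  have h3 : ∑ j, ∑ k, b.pdx j (b.pdx k (A j k)) x = -∑ j, ∑ k, b.pdx j (b.pdx k (A j k)) x := by
    conv_lhs => rw [Finset.sum_comm]
    rw [← Finset.sum_neg_distrib]
    refine Finset.sum_congr rfl fun k _ => ?_
    rw [← Finset.sum_neg_distrib]
    exact Finset.sum_congr rfl fun j _ => h2 j k
  linarith

/-- `N` coincides with the normal near the boundary point, not just at it, so its first derivatives
may be replaced as well; the product rule then reduces the claim to `normal_flux_identity`. -/
theorem normal_flux_eq (hm : ∀ k j, ContDiffOn ℝ 2 (m k j) (closure b.B))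
    (hf : ContDiffOn ℝ 2 f (closure b.B))
    (hNn : ∀ x ∈ frontier b.B, ∀ i, N i =ᶠ[𝓝 x] b.normal i) {x : E3} (hx : x ∈ frontier b.B) :
    ∑ j, ((t j x - ∑ k, b.pdx k (m k j) x) * f x + ∑ k, m j k x * b.pdx k f x
        - b.curlField N m f j x) * b.normal j x
      = b.traction t m x * f x + b.doubleTraction m x * ∑ i, b.normal i x * b.pdx i f x := by
  have hcl := b.frontier_subset hx
  have hn := fun i => differentiableWithinAt_normal (b := b) hx i
  have hmd : ∀ k j, DifferentiableWithinAt ℝ (m k j) (closure b.B) x := fun k j =>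
    (hm k j).differentiableOn (by norm_num) x hcl
  have hfd : DifferentiableWithinAt ℝ f (closure b.B) x :=
    hf.differentiableOn (by norm_num) x hcl
  have hcd : ∀ k, DifferentiableWithinAt ℝ (fun y => ∑ l, m l k y * b.normal l y)
      (closure b.B) x := fun k => DifferentiableWithinAt.fun_sum fun l _ => (hmd l k).mul (hn l)
  have hA : ∀ j k, b.pdx k (fun y => N j y * ((∑ l, m l k y * N l y) * f y)
      - N k y * ((∑ l, m l j y * N l y) * f y)) x
      = (b.pdx k (b.normal j) x * ((∑ l, m l k x * b.normal l x) * f x)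
          + b.normal j x * (b.pdx k (fun y => ∑ l, m l k y * b.normal l y) x * f x
            + (∑ l, m l k x * b.normal l x) * b.pdx k f x))
        - (b.pdx k (b.normal k) x * ((∑ l, m l j x * b.normal l x) * f x)
          + b.normal k x * (b.pdx k (fun y => ∑ l, m l j y * b.normal l y) x * f x
            + (∑ l, m l j x * b.normal l x) * b.pdx k f x)) := by
    intro j k
    have hev : (fun y => N j y * ((∑ l, m l k y * N l y) * f y)
        - N k y * ((∑ l, m l j y * N l y) * f y)) =ᶠ[𝓝 x]
        fun y => b.normal j y * ((∑ l, m l k y * b.normal l y) * f y)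
        - b.normal k y * ((∑ l, m l j y * b.normal l y) * f y) := by
      filter_upwards [hNn x hx 0, hNn x hx 1, hNn x hx 2] with y h0 h1 h2
      have h : ∀ i, N i y = b.normal i y := by
        intro i
        fin_cases i
        exacts [h0, h1, h2]
      simp only [h]
    rw [pdx_congr_nhds hev, pdx_sub hcl ((hn j).fun_mul ((hcd k).fun_mul hfd))
      ((hn k).fun_mul ((hcd j).fun_mul hfd)), pdx_mul hcl (hn j) ((hcd k).fun_mul hfd),
      pdx_mul hcl (hn k) ((hcd j).fun_mul hfd), pdx_mul hcl (hcd k) hfd, pdx_mul hcl (hcd j) hfd]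
  have h := normal_flux_identity (fun j => b.normal j x) (fun k => ∑ l, m l k x * b.normal l x)
    (fun k => b.pdx k f x) (fun j => t j x) (fun j => ∑ k, b.pdx k (m k j) x)
    (fun j k => m j k x) (fun k j => b.pdx k (b.normal j) x)
    (fun k j => b.pdx k (fun y => ∑ l, m l j y * b.normal l y) x) (f x)
    (sum_normal_sq (gradient_ne_zero hx)) (sum_normal_mul_pdx_normal hx) (fun _ => rfl)
  simp only [curlField, hA]
  exact h

/-- Green's identity: integration by parts for a stress `t` and a hyperstress `m` against a
function `f` for which the power of the surface tractions vanishes. -/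
theorem green (ht : ∀ j, ContDiffOn ℝ 1 (t j) (closure b.B))
    (hm : ∀ k j, ContDiffOn ℝ 2 (m k j) (closure b.B)) (hf : ContDiffOn ℝ 2 f (closure b.B))
    (hbdry : ∀ x ∈ frontier b.B, b.traction t m x * f x
      + b.doubleTraction m x * ∑ i, b.normal i x * b.pdx i f x = 0) :
    ∫ x in b.B, ((∑ j, b.pdx j (t j) x) - ∑ j, ∑ k, b.pdx j (b.pdx k (m k j)) x) * f x
      = -∫ x in b.B, ((∑ j, t j x * b.pdx j f x)
        + ∑ j, ∑ k, m j k x * b.pdx j (b.pdx k f) x) := by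
  obtain ⟨N, hN, hNn⟩ := b.exists_extension_normal
  have hf1 : ContDiffOn ℝ 1 f (closure b.B) := hf.of_le (by norm_num)
  have hm1 : ∀ k j, ContDiffOn ℝ 1 (m k j) (closure b.B) := fun k j =>
    (hm k j).of_le (by norm_num)
  have hp : ∀ j, ContDiffOn ℝ 1 (fun x => ∑ k, b.pdx k (m k j) x) (closure b.B) := fun j =>
    ContDiffOn.sum fun k _ => contDiffOn_pdx_one (hm k j) k
  have hq : ∀ j, ContDiffOn ℝ 1 (fun x => ∑ k, m j k x * b.pdx k f x) (closure b.B) := fun j =>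
    ContDiffOn.sum fun k _ => (hm1 j k).mul (contDiffOn_pdx_one hf k)
  have hcurl := contDiffOn_curlField (b := b) hm hf hN
  have hw : ∀ j, ContDiffOn ℝ 1 (fun x => (t j x - ∑ k, b.pdx k (m k j) x) * f x
      + ∑ k, m j k x * b.pdx k f x - b.curlField N m f j x) (closure b.B) := fun j =>
    ((((ht j).sub (hp j)).mul hf1).add (hq j)).sub (hcurl j)
  -- The gradient of `ψ` is a multiple of the normal on the frontier, so by the flux formula the
  -- assumption on the boundary power says exactly that the corrected field is tangent.
  have hdiv := integral_div_eq_zero hw fun x hx => by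
    have h := normal_flux_eq (t := t) hm hf hNn hx
    rw [hbdry x hx] at h
    simp only [fderiv_ψ_eq hx]
    rw [← mul_zero ‖gradient b.ψ x‖, ← h, Finset.mul_sum]
    exact Finset.sum_congr rfl fun j _ => by ring
  rw [eq_neg_iff_add_eq_zero, ← integral_add, ← hdiv]
  · refine setIntegral_congr_fun b.isOpen.measurableSet fun x hx => ?_
    have hcl := subset_closure hx
    have hdiff : ∀ {g : E3 → ℝ}, ContDiffOn ℝ 1 g (closure b.B) →
        DifferentiableWithinAt ℝ g (closure b.B) x := fun hg =>
      hg.differentiableOn (by norm_num) x hcl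
    have hj : ∀ j, b.pdx j (fun x => (t j x - ∑ k, b.pdx k (m k j) x) * f x
        + ∑ k, m j k x * b.pdx k f x - b.curlField N m f j x) x
        = (b.pdx j (t j) x - ∑ k, b.pdx j (b.pdx k (m k j)) x) * f x
          + (t j x - ∑ k, b.pdx k (m k j) x) * b.pdx j f x
          + ∑ k, (b.pdx j (m j k) x * b.pdx k f x + m j k x * b.pdx j (b.pdx k f) x)
          - b.pdx j (b.curlField N m f j) x := by
      intro j
      rw [pdx_sub hcl (hdiff ((((ht j).sub (hp j)).mul hf1).add (hq j))) (hdiff (hcurl j)),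
        pdx_add hcl (hdiff (((ht j).sub (hp j)).mul hf1)) (hdiff (hq j)),
        pdx_mul hcl (hdiff ((ht j).sub (hp j))) (hdiff hf1),
        pdx_sub hcl (hdiff (ht j)) (hdiff (hp j)),
        pdx_sum hcl fun k => hdiff (contDiffOn_pdx_one (hm k j) k),
        pdx_sum hcl fun k => hdiff ((hm1 j k).mul (contDiffOn_pdx_one hf k))]
      simp only [pdx_mul hcl (hdiff (hm1 j _)) (hdiff (contDiffOn_pdx_one hf _))]
    -- The correction disappears from the divergence, and the terms (∂ₖmₖⱼ)∂ⱼf arising from the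
    -- stress and hyperstress parts cancel each other.
    have h0 := div_curlField (b := b) hm hf hN hx
    simp only [hj, Finset.sum_sub_distrib, Finset.sum_add_distrib]
    rw [h0]
    simp only [Fin.sum_univ_three]
    ring
  · refine integrableOn_of_continuousOn (ContinuousOn.mul (ContinuousOn.sub ?_ ?_)
      hf.continuousOn)
    · exact continuousOn_finsetSum _ fun j _ => continuousOn_pdx (ht j) j
    · exact continuousOn_finsetSum _ fun j _ => continuousOn_finsetSum _ fun k _ =>
        continuousOn_pdx (contDiffOn_pdx_one (hm k j) k) j
  · refine integrableOn_of_continuousOn (ContinuousOn.add ?_ ?_)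
    · exact continuousOn_finsetSum _ fun j _ => (ht j).continuousOn.mul (continuousOn_pdx hf1 j)
    · exact continuousOn_finsetSum _ fun j _ => continuousOn_finsetSum _ fun k _ =>
        (hm j k).continuousOn.mul (continuousOn_pdx (contDiffOn_pdx_one hf k) j)

/-- Integration by parts for a vector field `q` against a function `f` whose product has no normal
flux. -/
theorem integral_div_mul (ht : ∀ j, ContDiffOn ℝ 1 (t j) (closure b.B))
    (hf : ContDiffOn ℝ 1 f (closure b.B))
    (hbdry : ∀ x ∈ frontier b.B, (∑ j, t j x * b.normal j x) * f x = 0) :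
    ∫ x in b.B, (∑ j, b.pdx j (t j) x) * f x = -∫ x in b.B, ∑ j, t j x * b.pdx j f x := by
  have hw : ∀ j, ContDiffOn ℝ 1 (fun x => t j x * f x) (closure b.B) := fun j => (ht j).mul hf
  have hdiv := integral_div_eq_zero hw fun x hx => by
    have h := hbdry x hx
    simp only [fderiv_ψ_eq hx]
    rw [← mul_zero ‖gradient b.ψ x‖, ← h, Finset.sum_mul, Finset.mul_sum]
    exact Finset.sum_congr rfl fun j _ => by ring
  rw [eq_neg_iff_add_eq_zero, ← integral_add, ← hdiv]
  · refine setIntegral_congr_fun b.isOpen.measurableSet fun x hx => ?_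
    have hcl := subset_closure hx
    have hdiff : ∀ {g : E3 → ℝ}, ContDiffOn ℝ 1 g (closure b.B) →
        DifferentiableWithinAt ℝ g (closure b.B) x := fun hg =>
      hg.differentiableOn (by norm_num) x hcl
    simp only [pdx_mul hcl (hdiff (ht _)) (hdiff hf), Finset.sum_mul, Finset.sum_add_distrib]
  · exact integrableOn_of_continuousOn ((continuousOn_finsetSum _ fun j _ =>
      continuousOn_pdx (ht j) j).mul hf.continuousOn)
  · exact integrableOn_of_continuousOn (continuousOn_finsetSum _ fun j _ =>
      (ht j).continuousOn.mul (continuousOn_pdx hf j))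

end Green

end Body

/-! ### The classes `C^{M,N}` -/

namespace Body

variable {b : Body} {M N : ℕ} {f g : ScalarField}

theorem ClassC.contDiffOn_space (hf : b.ClassC M N f) {t : ℝ} (ht : 0 ≤ t) :
    ContDiffOn ℝ M (fun x => f x t) (closure b.B) := by
  have h := (hf.2 M le_rfl 0 (Nat.zero_le _) (by simp)).1 t ht
  simpa using h

theorem ClassC.contDiffOn_space_of_le (hf : b.ClassC M N f) {m : ℕ} (hm : m ≤ M) {t : ℝ}
    (ht : 0 ≤ t) : ContDiffOn ℝ m (fun x => f x t) (closure b.B) :=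
  (hf.contDiffOn_space ht).of_le (by exact_mod_cast hm)

/-- The case m = 0 of the definition: the zeroth spatial derivative is a multilinear map in no
variables, and evaluating it on the empty family is continuous. -/
theorem ClassC.continuousOn_iteratedDerivWithin (hf : b.ClassC M N f) {n : ℕ} (hn : n ≤ N) :
    ContinuousOn (fun p : E3 × ℝ => iteratedDerivWithin n (f p.1) (Ici 0) p.2)
      (closure b.B ×ˢ Ici 0) := by
  have h := (hf.2 0 (Nat.zero_le _) n hn (by rw [zero_add]; exact hn.trans (le_max_right _ _))).2
  have h' := (ContinuousMultilinearMap.apply ℝ (fun _ : Fin 0 => E3) ℝ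
    (fun i => i.elim0)).continuous.comp_continuousOn h
  exact h'.congr fun p _ => rfl

theorem ClassC.continuousOn (hf : b.ClassC M N f) :
    ContinuousOn (fun p : E3 × ℝ => f p.1 p.2) (closure b.B ×ˢ Ici 0) := by
  simpa using hf.continuousOn_iteratedDerivWithin (Nat.zero_le N)

theorem ClassC.continuousOn_dt (hf : b.ClassC M N f) (hN : 1 ≤ N) :
    ContinuousOn (fun p : E3 × ℝ => dt f p.1 p.2) (closure b.B ×ˢ Ici 0) := by
  simpa [dt] using hf.continuousOn_iteratedDerivWithin hN

theorem ClassC.continuousOn_dt_dt (hf : b.ClassC M N f) (hN : 2 ≤ N) :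
    ContinuousOn (fun p : E3 × ℝ => dt (dt f) p.1 p.2) (closure b.B ×ˢ Ici 0) := by
  refine (hf.continuousOn_iteratedDerivWithin hN).congr fun p _ => ?_
  change _ = iteratedDerivWithin (1 + 1) (f p.1) (Ici 0) p.2
  rw [iteratedDerivWithin_succ, iteratedDerivWithin_one]
  rfl

theorem ClassC.differentiableOn_time (hf : b.ClassC M N f) (hN : 1 ≤ N) {x : E3}
    (hx : x ∈ closure b.B) : DifferentiableOn ℝ (f x) (Ici 0) :=
  (hf.1 x hx).differentiableOn (by exact_mod_cast (by omega : N ≠ 0))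

theorem ClassC.hasDerivWithinAt (hf : b.ClassC M N f) (hN : 1 ≤ N) {x : E3}
    (hx : x ∈ closure b.B) {t : ℝ} (ht : 0 ≤ t) :
    HasDerivWithinAt (f x) (dt f x t) (Ici 0) t :=
  (hf.differentiableOn_time hN hx t ht).hasDerivWithinAt

theorem ClassC.differentiableOn_dt (hf : b.ClassC M N f) (hN : 2 ≤ N) {x : E3}
    (hx : x ∈ closure b.B) : DifferentiableOn ℝ (dt f x) (Ici 0) := by
  have h : ContDiffOn ℝ 2 (f x) (Ici 0) := (hf.1 x hx).of_le (by exact_mod_cast hN)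
  exact ((contDiffOn_succ_iff_derivWithin (n := 1) (uniqueDiffOn_Ici 0)).1
    (by simpa using! h)).2.2.differentiableOn (by norm_num)

theorem ClassC.hasDerivWithinAt_dt (hf : b.ClassC M N f) (hN : 2 ≤ N) {x : E3}
    (hx : x ∈ closure b.B) {t : ℝ} (ht : 0 ≤ t) :
    HasDerivWithinAt (dt f x) (dt (dt f) x t) (Ici 0) t :=
  (hf.differentiableOn_dt hN hx t ht).hasDerivWithinAt

theorem ClassC.sub (hf : b.ClassC M N f) (hg : b.ClassC M N g) :
    b.ClassC M N fun x t => f x t - g x t := by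
  refine ⟨fun x hx => (hf.1 x hx).sub (hg.1 x hx), fun m hm n hn hmn => ?_⟩
  have heq : ∀ x ∈ closure b.B, ∀ t ∈ Ici (0 : ℝ),
      iteratedDerivWithin n (fun t => f x t - g x t) (Ici 0) t
        = iteratedDerivWithin n (f x) (Ici 0) t - iteratedDerivWithin n (g x) (Ici 0) t := by
    intro x hx t ht
    have h1 : ContDiffOn ℝ n (f x) (Ici 0) := (hf.1 x hx).of_le (by exact_mod_cast hn)
    have h2 : ContDiffOn ℝ n (g x) (Ici 0) := (hg.1 x hx).of_le (by exact_mod_cast hn)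
    -- The iterated time derivative is the iterated Fréchet derivative evaluated on unit vectors,
    -- for which subtraction is available.
    exact congrArg (fun L => L fun _ => (1 : ℝ))
      (iteratedFDerivWithin_sub_apply (h1 t ht) (h2 t ht) (uniqueDiffOn_Ici 0) ht)
  obtain ⟨hf1, hf2⟩ := hf.2 m hm n hn hmn
  obtain ⟨hg1, hg2⟩ := hg.2 m hm n hn hmn
  refine ⟨fun t ht => ((hf1 t ht).sub (hg1 t ht)).congr fun x hx => heq x hx t ht, ?_⟩
  refine (hf2.sub hg2).congr fun p hp => ?_
  rw [iteratedFDerivWithin_congr (fun x hx => heq x hx p.2 hp.2) hp.1]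
  exact iteratedFDerivWithin_sub_apply (hf1 p.2 hp.2 p.1 hp.1) (hg1 p.2 hp.2 p.1 hp.1)
    b.uniqueDiffOn hp.1

theorem ClassC.dt_sub (hf : b.ClassC M N f) (hg : b.ClassC M N g) (hN : 1 ≤ N) {x : E3}
    (hx : x ∈ closure b.B) {t : ℝ} (ht : 0 ≤ t) :
    dt (fun x t => f x t - g x t) x t = dt f x t - dt g x t :=
  derivWithin_fun_sub (hf.differentiableOn_time hN hx t ht) (hg.differentiableOn_time hN hx t ht)

theorem ClassC.dt_dt_sub (hf : b.ClassC M N f) (hg : b.ClassC M N g) (hN : 2 ≤ N) {x : E3}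
    (hx : x ∈ closure b.B) {t : ℝ} (ht : 0 ≤ t) :
    dt (dt fun x t => f x t - g x t) x t = dt (dt f) x t - dt (dt g) x t := by
  have h : EqOn (dt (fun x t => f x t - g x t) x) (fun t => dt f x t - dt g x t) (Ici 0) :=
    fun s hs => hf.dt_sub hg (by omega) hx hs
  calc dt (dt fun x t => f x t - g x t) x t
      = derivWithin (fun t => dt f x t - dt g x t) (Ici 0) t := derivWithin_congr h (h ht)
    _ = _ := derivWithin_fun_sub (hf.differentiableOn_dt hN hx t ht)
        (hg.differentiableOn_dt hN hx t ht)

theorem pd_sub {x : E3} {t : ℝ} (hx : x ∈ closure b.B)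
    (hf : ContDiffOn ℝ 1 (fun x => f x t) (closure b.B))
    (hg : ContDiffOn ℝ 1 (fun x => g x t) (closure b.B)) (j : Fin 3) :
    b.pd j (fun x t => f x t - g x t) x t = b.pd j f x t - b.pd j g x t :=
  pdx_sub hx (hf.differentiableOn (by norm_num) x hx) (hg.differentiableOn (by norm_num) x hx) j

theorem pd_pd_sub {x : E3} {t : ℝ} (hx : x ∈ closure b.B)
    (hf : ContDiffOn ℝ 2 (fun x => f x t) (closure b.B))
    (hg : ContDiffOn ℝ 2 (fun x => g x t) (closure b.B)) (j k : Fin 3) :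
    b.pd j (b.pd k fun x t => f x t - g x t) x t
      = b.pd j (b.pd k f) x t - b.pd j (b.pd k g) x t := by
  have h : ∀ y ∈ closure b.B, b.pd k (fun x t => f x t - g x t) y t
      = b.pd k f y t - b.pd k g y t := fun y hy =>
    pd_sub hy (hf.of_le (by norm_num)) (hg.of_le (by norm_num)) k
  calc b.pd j (b.pd k fun x t => f x t - g x t) x t
      = b.pdx j (fun y => b.pd k f y t - b.pd k g y t) x := pdx_congr h hx j
    _ = _ := pdx_sub hx ((contDiffOn_pdx_one hf k).differentiableOn (by norm_num) x hx)
        ((contDiffOn_pdx_one hg k).differentiableOn (by norm_num) x hx) j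

theorem surfGrad_sub {v w : E3 → ℝ} {x : E3} (hx : x ∈ closure b.B)
    (hv : DifferentiableWithinAt ℝ v (closure b.B) x)
    (hw : DifferentiableWithinAt ℝ w (closure b.B) x) (i : Fin 3) :
    b.surfGrad i (fun y => v y - w y) x = b.surfGrad i v x - b.surfGrad i w x := by
  simp only [surfGrad, pdx_sub hx hv hw, mul_sub, Finset.sum_sub_distrib]

theorem traction_sub {t t' : Fin 3 → E3 → ℝ} {m m' : Fin 3 → Fin 3 → E3 → ℝ}
    (hm : ∀ k j, ContDiffOn ℝ 1 (m k j) (closure b.B))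
    (hm' : ∀ k j, ContDiffOn ℝ 1 (m' k j) (closure b.B)) {x : E3} (hx : x ∈ frontier b.B) :
    b.traction (fun j y => t j y - t' j y) (fun k j y => m k j y - m' k j y) x
      = b.traction t m x - b.traction t' m' x := by
  have hcl := b.frontier_subset hx
  have hd : ∀ {g : E3 → ℝ}, ContDiffOn ℝ 1 g (closure b.B) →
      DifferentiableWithinAt ℝ g (closure b.B) x := fun hg =>
    hg.differentiableOn (by norm_num) x hcl
  have hn := fun i => differentiableWithinAt_normal (b := b) hx i
  have hs : ∀ j, b.surfGrad j (fun y => ∑ k, (m k j y - m' k j y) * b.normal k y) x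
      = b.surfGrad j (fun y => ∑ k, m k j y * b.normal k y) x
        - b.surfGrad j (fun y => ∑ k, m' k j y * b.normal k y) x := by
    intro j
    rw [← surfGrad_sub hcl (DifferentiableWithinAt.fun_sum fun k _ => (hd (hm k j)).fun_mul (hn k))
      (DifferentiableWithinAt.fun_sum fun k _ => (hd (hm' k j)).fun_mul (hn k))]
    simp only [sub_mul, Finset.sum_sub_distrib]
  simp only [traction, hs, pdx_sub hcl (hd (hm _ _)) (hd (hm' _ _))]
  simp only [sub_mul, mul_sub, Finset.sum_sub_distrib]
  ring

theorem doubleTraction_sub (m m' : Fin 3 → Fin 3 → E3 → ℝ) (x : E3) :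
    b.doubleTraction (fun k j y => m k j y - m' k j y) x
      = b.doubleTraction m x - b.doubleTraction m' x := by
  simp only [doubleTraction, sub_mul, Finset.sum_sub_distrib]

end Body

/-! ### The difference of two solutions -/

/-- The componentwise difference of two processes. -/
def ThermoProcess.sub (π₁ π₂ : ThermoProcess) : ThermoProcess where
  u i x t := π₁.u i x t - π₂.u i x t
  θ x t := π₁.θ x t - π₂.θ x t
  φ x t := π₁.φ x t - π₂.φ x t
  e i j x t := π₁.e i j x t - π₂.e i j x t
  κ i j k x t := π₁.κ i j k x t - π₂.κ i j k x t
  gradθ i x t := π₁.gradθ i x t - π₂.gradθ i x t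
  E i x t := π₁.E i x t - π₂.E i x t
  V i j x t := π₁.V i j x t - π₂.V i j x t
  τ i j x t := π₁.τ i j x t - π₂.τ i j x t
  μ i j k x t := π₁.μ i j k x t - π₂.μ i j k x t
  σ i x t := π₁.σ i x t - π₂.σ i x t
  Q i j x t := π₁.Q i j x t - π₂.Q i j x t
  η x t := π₁.η x t - π₂.η x t
  q i x t := π₁.q i x t - π₂.q i x t

/-- The vanishing data. -/
def ProblemData.zero : ProblemData where
  f _ _ _ := 0
  g _ _ := 0
  h _ _ := 0
  u₀ _ _ := 0
  v₀ _ _ := 0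
  θ₀ _ := 0
  η₀ _ := 0
  uHat _ _ _ := 0
  dHat _ _ _ := 0
  θHat _ _ := 0
  φHat _ _ := 0
  ωHat _ _ := 0
  PHat _ _ _ := 0
  RHat _ _ _ := 0
  qHat _ _ := 0
  LamHat _ _ := 0
  HHat _ _ := 0

section Difference

variable {b : Body} {M : Material} {p : BoundaryParts b} {D : ProblemData} {π π₁ π₂ : ThermoProcess}

theorem Admissible.sub (h₁ : Admissible b π₁) (h₂ : Admissible b π₂) :
    Admissible b (π₁.sub π₂) where
  u_class i := (h₁.u_class i).sub (h₂.u_class i)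
  φ_class := h₁.φ_class.sub h₂.φ_class
  θ_class := h₁.θ_class.sub h₂.θ_class
  e_class i j := (h₁.e_class i j).sub (h₂.e_class i j)
  V_class i j := (h₁.V_class i j).sub (h₂.V_class i j)
  η_class := h₁.η_class.sub h₂.η_class
  κ_class i j k := (h₁.κ_class i j k).sub (h₂.κ_class i j k)
  E_class i := (h₁.E_class i).sub (h₂.E_class i)
  μ_class i j k := (h₁.μ_class i j k).sub (h₂.μ_class i j k)
  Q_class i j := (h₁.Q_class i j).sub (h₂.Q_class i j)
  gradθ_class i := (h₁.gradθ_class i).sub (h₂.gradθ_class i)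
  τ_class i j := (h₁.τ_class i j).sub (h₂.τ_class i j)
  q_class i := (h₁.q_class i).sub (h₂.q_class i)
  e_symm x hx t ht i j := congrArg₂ (· - ·) (h₁.e_symm x hx t ht i j) (h₂.e_symm x hx t ht i j)
  κ_symm x hx t ht i j k :=
    congrArg₂ (· - ·) (h₁.κ_symm x hx t ht i j k) (h₂.κ_symm x hx t ht i j k)
  V_symm x hx t ht i j := congrArg₂ (· - ·) (h₁.V_symm x hx t ht i j) (h₂.V_symm x hx t ht i j)
  τ_symm x hx t ht i j := congrArg₂ (· - ·) (h₁.τ_symm x hx t ht i j) (h₂.τ_symm x hx t ht i j)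
  μ_symm x hx t ht i j k :=
    congrArg₂ (· - ·) (h₁.μ_symm x hx t ht i j k) (h₂.μ_symm x hx t ht i j k)
  Q_symm x hx t ht i j := congrArg₂ (· - ·) (h₁.Q_symm x hx t ht i j) (h₂.Q_symm x hx t ht i j)

/-- The electric displacement inherits its regularity from the constitutive equation. -/
theorem Constitutive.contDiffOn_σ (hC : Constitutive b M π) (hA : Admissible b π) {t : ℝ}
    (ht : 0 ≤ t) (i : Fin 3) : ContDiffOn ℝ 1 (fun x => π.σ i x t) (closure b.B) := by
  have hκ : ∀ j k l, ContDiffOn ℝ 1 (fun x => π.κ j k l x t) (closure b.B) := fun j k l =>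
    (hA.κ_class j k l).contDiffOn_space_of_le (m := 1) (by norm_num) ht
  have hE : ∀ j, ContDiffOn ℝ 1 (fun x => π.E j x t) (closure b.B) := fun j =>
    (hA.E_class j).contDiffOn_space_of_le (m := 1) (by norm_num) ht
  have h : ContDiffOn ℝ 1 (fun x => -((∑ j, ∑ k, ∑ l, M.a23 j k l i * π.κ j k l x t)
      + ∑ j, M.a33 i j * π.E j x t)) (closure b.B) :=
    ((ContDiffOn.sum fun j _ => ContDiffOn.sum fun k _ => ContDiffOn.sum fun l _ =>
      contDiffOn_const.mul (hκ j k l)).add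
      (ContDiffOn.sum fun j _ => contDiffOn_const.mul (hE j))).neg
  exact h.congr fun x hx => by rw [← hC.sigma x hx t ht i, neg_neg]

theorem Constitutive.sub (hA₁ : Admissible b π₁) (hA₂ : Admissible b π₂)
    (h₁ : Constitutive b M π₁) (h₂ : Constitutive b M π₂) :
    Constitutive b M (π₁.sub π₂) := by
  have hθ : ∀ x ∈ closure b.B, ∀ t ∈ Ici (0 : ℝ),
      dt (fun x t => π₁.θ x t - π₂.θ x t) x t = dt π₁.θ x t - dt π₂.θ x t := fun x hx t ht =>
    hA₁.θ_class.dt_sub hA₂.θ_class (by norm_num) hx ht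
  constructor
  · intro x hx t ht i j
    simp only [ThermoProcess.sub, hθ x hx t ht, mul_sub, Finset.sum_sub_distrib]
    linear_combination h₁.stress x hx t ht i j - h₂.stress x hx t ht i j
  · intro x hx t ht i j k
    simp only [ThermoProcess.sub, mul_sub, Finset.sum_sub_distrib]
    linear_combination h₁.hyperstress x hx t ht i j k - h₂.hyperstress x hx t ht i j k
  · intro x hx t ht i
    simp only [ThermoProcess.sub, mul_sub, Finset.sum_sub_distrib]
    linear_combination h₁.sigma x hx t ht i - h₂.sigma x hx t ht i
  · intro x hx t ht i j
    simp only [ThermoProcess.sub, hθ x hx t ht, mul_sub, Finset.sum_sub_distrib]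
    linear_combination h₁.quadrupole x hx t ht i j - h₂.quadrupole x hx t ht i j
  · intro x hx t ht
    simp only [ThermoProcess.sub, hθ x hx t ht, mul_sub, Finset.sum_sub_distrib]
    linear_combination h₁.entropy x hx t ht - h₂.entropy x hx t ht
  · intro x hx t ht i
    simp only [ThermoProcess.sub, mul_sub, Finset.sum_sub_distrib]
    linear_combination h₁.heat_flux x hx t ht i - h₂.heat_flux x hx t ht i

theorem IsSolution.balance_sub (h₁ : IsSolution b M p D π₁) (h₂ : IsSolution b M p D π₂) :
    Balance b M (fun _ _ _ => 0) (fun _ _ => 0) (fun _ _ => 0) (π₁.sub π₂) := by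
  have hA₁ := h₁.admissible
  have hA₂ := h₂.admissible
  constructor
  · intro x hx t ht i
    have hcl := subset_closure hx
    have e1 : ∀ j, b.pd j ((π₁.sub π₂).τ j i) x t
        = b.pd j (π₁.τ j i) x t - b.pd j (π₂.τ j i) x t := fun j =>
      Body.pd_sub hcl ((hA₁.τ_class j i).contDiffOn_space ht)
        ((hA₂.τ_class j i).contDiffOn_space ht) j
    have e2 : ∀ j k, b.pd j (b.pd k ((π₁.sub π₂).μ k j i)) x t
        = b.pd j (b.pd k (π₁.μ k j i)) x t - b.pd j (b.pd k (π₂.μ k j i)) x t := fun j k =>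
      Body.pd_pd_sub hcl ((hA₁.μ_class k j i).contDiffOn_space ht)
        ((hA₂.μ_class k j i).contDiffOn_space ht) j k
    have e3 : dt (dt ((π₁.sub π₂).u i)) x t = dt (dt (π₁.u i)) x t - dt (dt (π₂.u i)) x t :=
      (hA₁.u_class i).dt_dt_sub (hA₂.u_class i) le_rfl hcl ht
    simp only [e1, e2, e3, Finset.sum_sub_distrib]
    linear_combination h₁.balance.motion x hx t ht i - h₂.balance.motion x hx t ht i
  · intro x hx t ht
    have hcl := subset_closure hx
    have e1 : ∀ j, b.pd j ((π₁.sub π₂).σ j) x t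
        = b.pd j (π₁.σ j) x t - b.pd j (π₂.σ j) x t := fun j =>
      Body.pd_sub hcl (h₁.constitutive.contDiffOn_σ hA₁ ht j)
        (h₂.constitutive.contDiffOn_σ hA₂ ht j) j
    have e2 : ∀ j k, b.pd j (b.pd k ((π₁.sub π₂).Q k j)) x t
        = b.pd j (b.pd k (π₁.Q k j)) x t - b.pd j (b.pd k (π₂.Q k j)) x t := fun j k =>
      Body.pd_pd_sub hcl ((hA₁.Q_class k j).contDiffOn_space ht)
        ((hA₂.Q_class k j).contDiffOn_space ht) j k
    simp only [e1, e2, Finset.sum_sub_distrib]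
    linear_combination h₁.balance.electric x hx t ht - h₂.balance.electric x hx t ht
  · intro x hx t ht
    have hcl := subset_closure hx
    have e1 : ∀ j, b.pd j ((π₁.sub π₂).q j) x t
        = b.pd j (π₁.q j) x t - b.pd j (π₂.q j) x t := fun j =>
      Body.pd_sub hcl ((hA₁.q_class j).contDiffOn_space ht)
        ((hA₂.q_class j).contDiffOn_space ht) j
    have e2 : dt (π₁.sub π₂).η x t = dt π₁.η x t - dt π₂.η x t :=
      hA₁.η_class.dt_sub hA₂.η_class le_rfl hcl ht
    simp only [e1, e2, Finset.sum_sub_distrib]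
    linear_combination h₁.balance.energy x hx t ht - h₂.balance.energy x hx t ht
  · intro x hx t ht i j
    have e1 : ∀ i j, b.pd j ((π₁.sub π₂).u i) x t
        = b.pd j (π₁.u i) x t - b.pd j (π₂.u i) x t := fun i j =>
      Body.pd_sub (subset_closure hx) ((hA₁.u_class i).contDiffOn_space_of_le (m := 1)
        (by norm_num) ht) ((hA₂.u_class i).contDiffOn_space_of_le (m := 1) (by norm_num) ht) j
    rw [e1, e1]
    simp only [ThermoProcess.sub]
    linear_combination h₁.balance.strain x hx t ht i j - h₂.balance.strain x hx t ht i j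
  · intro x hx t ht i j k
    have e1 : b.pd j (b.pd i ((π₁.sub π₂).u k)) x t
        = b.pd j (b.pd i (π₁.u k)) x t - b.pd j (b.pd i (π₂.u k)) x t :=
      Body.pd_pd_sub (subset_closure hx) ((hA₁.u_class k).contDiffOn_space_of_le (m := 2)
        (by norm_num) ht) ((hA₂.u_class k).contDiffOn_space_of_le (m := 2) (by norm_num) ht) j i
    rw [e1]
    simp only [ThermoProcess.sub]
    linear_combination h₁.balance.strain_grad x hx t ht i j k
      - h₂.balance.strain_grad x hx t ht i j k
  · intro x hx t ht i
    have e1 : b.pd i (π₁.sub π₂).θ x t = b.pd i π₁.θ x t - b.pd i π₂.θ x t :=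
      Body.pd_sub (subset_closure hx) (hA₁.θ_class.contDiffOn_space_of_le (m := 1)
        (by norm_num) ht) (hA₂.θ_class.contDiffOn_space_of_le (m := 1) (by norm_num) ht) i
    rw [e1]
    simp only [ThermoProcess.sub]
    linear_combination h₁.balance.temp_grad x hx t ht i - h₂.balance.temp_grad x hx t ht i
  · intro x hx t ht i
    have e1 : b.pd i (π₁.sub π₂).φ x t = b.pd i π₁.φ x t - b.pd i π₂.φ x t :=
      Body.pd_sub (subset_closure hx) (hA₁.φ_class.contDiffOn_space_of_le (m := 1)
        (by norm_num) ht) (hA₂.φ_class.contDiffOn_space_of_le (m := 1) (by norm_num) ht) i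
    rw [e1]
    simp only [ThermoProcess.sub]
    linear_combination h₁.balance.field x hx t ht i - h₂.balance.field x hx t ht i
  · intro x hx t ht i j
    have e1 : b.pd j (b.pd i (π₁.sub π₂).φ) x t
        = b.pd j (b.pd i π₁.φ) x t - b.pd j (b.pd i π₂.φ) x t :=
      Body.pd_pd_sub (subset_closure hx) (hA₁.φ_class.contDiffOn_space_of_le (m := 2)
        (by norm_num) ht) (hA₂.φ_class.contDiffOn_space_of_le (m := 2) (by norm_num) ht) j i
    rw [e1]
    simp only [ThermoProcess.sub]
    linear_combination h₁.balance.field_grad x hx t ht i j - h₂.balance.field_grad x hx t ht i j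

theorem IsSolution.initial_sub (h₁ : IsSolution b M p D π₁) (h₂ : IsSolution b M p D π₂) :
    InitialConditions b ProblemData.zero (π₁.sub π₂) where
  u_init x hx i := sub_eq_zero.2 ((h₁.initial.u_init x hx i).trans (h₂.initial.u_init x hx i).symm)
  v_init x hx i := by
    have e : dt ((π₁.sub π₂).u i) x 0 = dt (π₁.u i) x 0 - dt (π₂.u i) x 0 :=
      (h₁.admissible.u_class i).dt_sub (h₂.admissible.u_class i) (by norm_num) hx le_rfl
    rw [e, h₁.initial.v_init x hx i, h₂.initial.v_init x hx i, sub_self]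
    rfl
  θ_init x hx := sub_eq_zero.2 ((h₁.initial.θ_init x hx).trans (h₂.initial.θ_init x hx).symm)
  η_init x hx := sub_eq_zero.2 ((h₁.initial.η_init x hx).trans (h₂.initial.η_init x hx).symm)

theorem subset_frontier_of_cover {S Sg : Set E3} (h : closure S ∪ Sg = frontier b.B) :
    S ⊆ frontier b.B :=
  fun _ hx => h ▸ Or.inl (subset_closure hx)

theorem subset_frontier_of_cover' {S Sg : Set E3} (h : closure S ∪ Sg = frontier b.B) :
    Sg ⊆ frontier b.B :=
  fun _ hx => h ▸ Or.inr hx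

theorem IsSolution.boundary_sub (h₁ : IsSolution b M p D π₁) (h₂ : IsSolution b M p D π₂) :
    BoundaryConditions b p ProblemData.zero (π₁.sub π₂) := by
  have hA₁ := h₁.admissible
  have hA₂ := h₂.admissible
  have hB₁ := h₁.boundary
  have hB₂ := h₂.boundary
  constructor
  · intro x hx t ht i
    exact sub_eq_zero.2 ((hB₁.u_bc x hx t ht i).trans (hB₂.u_bc x hx t ht i).symm)
  · intro x hx t ht i
    have h := Body.traction_sub (b := b)
      (t := fun j y => π₁.τ j i y t) (t' := fun j y => π₂.τ j i y t)
      (fun k j => (hA₁.μ_class k j i).contDiffOn_space_of_le (m := 1) (by norm_num) ht)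
      (fun k j => (hA₂.μ_class k j i).contDiffOn_space_of_le (m := 1) (by norm_num) ht)
      (subset_frontier_of_cover' p.cover₁ hx)
    have h' : b.traction (fun j y => π₁.τ j i y t) (fun k j y => π₁.μ k j i y t) x
        = b.traction (fun j y => π₂.τ j i y t) (fun k j y => π₂.μ k j i y t) x :=
      (hB₁.P_bc x hx t ht i).trans (hB₂.P_bc x hx t ht i).symm
    exact h.trans (sub_eq_zero.2 h')
  · intro x hx t ht i
    have e : ∀ j, b.pd j ((π₁.sub π₂).u i) x t
        = b.pd j (π₁.u i) x t - b.pd j (π₂.u i) x t := fun j =>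
      Body.pd_sub (b.frontier_subset (subset_frontier_of_cover p.cover₂ hx))
        ((hA₁.u_class i).contDiffOn_space_of_le (m := 1) (by norm_num) ht)
        ((hA₂.u_class i).contDiffOn_space_of_le (m := 1) (by norm_num) ht) j
    simp only [Body.normalDeriv, e, mul_sub, Finset.sum_sub_distrib]
    exact sub_eq_zero.2 ((hB₁.d_bc x hx t ht i).trans (hB₂.d_bc x hx t ht i).symm)
  · intro x hx t ht i
    have h' : b.doubleTraction (fun k j y => π₁.μ k j i y t) x
        = b.doubleTraction (fun k j y => π₂.μ k j i y t) x :=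
      (hB₁.R_bc x hx t ht i).trans (hB₂.R_bc x hx t ht i).symm
    exact (Body.doubleTraction_sub _ _ x).trans (sub_eq_zero.2 h')
  · intro x hx t ht
    exact sub_eq_zero.2 ((hB₁.θ_bc x hx t ht).trans (hB₂.θ_bc x hx t ht).symm)
  · intro x hx t ht
    simp only [ThermoProcess.normalFlux, ThermoProcess.sub, sub_mul, Finset.sum_sub_distrib]
    exact sub_eq_zero.2 ((hB₁.q_bc x hx t ht).trans (hB₂.q_bc x hx t ht).symm)
  · intro x hx t ht
    exact sub_eq_zero.2 ((hB₁.φ_bc x hx t ht).trans (hB₂.φ_bc x hx t ht).symm)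
  · intro x hx t ht
    have h := Body.traction_sub (b := b)
      (t := fun j y => π₁.σ j y t) (t' := fun j y => π₂.σ j y t)
      (fun k j => (hA₁.Q_class k j).contDiffOn_space_of_le (m := 1) (by norm_num) ht)
      (fun k j => (hA₂.Q_class k j).contDiffOn_space_of_le (m := 1) (by norm_num) ht)
      (subset_frontier_of_cover' p.cover₄ hx)
    have h' : b.traction (fun j y => π₁.σ j y t) (fun k j y => π₁.Q k j y t) x
        = b.traction (fun j y => π₂.σ j y t) (fun k j y => π₂.Q k j y t) x :=
      (hB₁.Lam_bc x hx t ht).trans (hB₂.Lam_bc x hx t ht).symm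
    exact h.trans (sub_eq_zero.2 h')
  · intro x hx t ht
    have e : ∀ j, b.pd j (π₁.sub π₂).φ x t = b.pd j π₁.φ x t - b.pd j π₂.φ x t := fun j =>
      Body.pd_sub (b.frontier_subset (subset_frontier_of_cover p.cover₅ hx))
        (hA₁.φ_class.contDiffOn_space_of_le (m := 1) (by norm_num) ht)
        (hA₂.φ_class.contDiffOn_space_of_le (m := 1) (by norm_num) ht) j
    simp only [Body.normalDeriv, e, mul_sub, Finset.sum_sub_distrib]
    exact sub_eq_zero.2 ((hB₁.ω_bc x hx t ht).trans (hB₂.ω_bc x hx t ht).symm)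
  · intro x hx t ht
    have h' : b.doubleTraction (fun k j y => π₁.Q k j y t) x
        = b.doubleTraction (fun k j y => π₂.Q k j y t) x :=
      (hB₁.H_bc x hx t ht).trans (hB₂.H_bc x hx t ht).symm
    exact (Body.doubleTraction_sub _ _ x).trans (sub_eq_zero.2 h')

/-- The difference of two solutions solves the problem with vanishing data. -/
theorem IsSolution.sub (h₁ : IsSolution b M p D π₁) (h₂ : IsSolution b M p D π₂) :
    IsSolution b M p ProblemData.zero (π₁.sub π₂) where
  admissible := h₁.admissible.sub h₂.admissible
  balance := h₁.balance_sub h₂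
  constitutive := Constitutive.sub h₁.admissible h₂.admissible h₁.constitutive h₂.constitutive
  initial := h₁.initial_sub h₂
  boundary := h₁.boundary_sub h₂

end Difference

/-! ### Reciprocity at two times -/

namespace Body

variable {b : Body}

/-- Joint continuity of a field on `B̄ × [0,∞)`. -/
def Cont (b : Body) (f : ScalarField) : Prop :=
  ContinuousOn (fun p : E3 × ℝ => f p.1 p.2) (closure b.B ×ˢ Ici 0)

theorem Cont.slice {f : ScalarField} (hf : b.Cont f) {t : ℝ} (ht : 0 ≤ t) :
    ContinuousOn (fun x => f x t) (closure b.B) :=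
  ContinuousOn.comp (g := fun p : E3 × ℝ => f p.1 p.2) (f := fun x => (x, t)) hf
    (by fun_prop) fun _ hx => ⟨hx, ht⟩

theorem Cont.time {f : ScalarField} (hf : b.Cont f) {x : E3} (hx : x ∈ closure b.B) :
    ContinuousOn (f x) (Ici 0) :=
  ContinuousOn.comp (g := fun p : E3 × ℝ => f p.1 p.2) (f := fun t => (x, t)) hf
    (by fun_prop) fun _ ht => ⟨hx, ht⟩

/-- The `L²(B)` pairing of two fields, taken at the times `r` and `s`. -/
noncomputable def pair (b : Body) (f h : ScalarField) (r s : ℝ) : ℝ := ∫ x in b.B, f x r * h x s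

theorem pair_comm (f h : ScalarField) (r s : ℝ) : b.pair f h r s = b.pair h f s r := by
  simp only [pair, mul_comm]

theorem Cont.integrableOn_mul {f h : ScalarField} (hf : b.Cont f) (hh : b.Cont h) {r s : ℝ}
    (hr : 0 ≤ r) (hs : 0 ≤ s) : IntegrableOn (fun x => f x r * h x s) b.B :=
  integrableOn_of_continuousOn ((hf.slice hr).mul (hh.slice hs))

theorem eq_zero_of_mem_closure {f : E3 → ℝ} (hf : ContinuousOn f (closure b.B)) {S : Set E3}
    (hS : S ⊆ closure b.B) (h0 : ∀ x ∈ S, f x = 0) : ∀ x ∈ closure S, f x = 0 := by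
  have hS' : closure S ⊆ closure b.B := closure_minimal hS isClosed_closure
  exact EqOn.of_subset_closure (g := fun _ => (0 : ℝ)) h0 (hf.mono hS') continuousOn_const
    subset_closure subset_rfl

/-- A condition on a part of the boundary extends to its closure, hence a product of complementary
boundary quantities vanishes on the whole boundary. -/
theorem mul_eq_zero_of_cover {f g : E3 → ℝ} (hf : ContinuousOn f (frontier b.B)) {S Sg : Set E3}
    (hcov : closure S ∪ Sg = frontier b.B) (hfS : ∀ x ∈ S, f x = 0) (hg : ∀ x ∈ Sg, g x = 0) :
    ∀ x ∈ frontier b.B, g x * f x = 0 := by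
  intro x hx
  rw [← hcov] at hx
  rcases hx with hx | hx
  · have hS : closure S ⊆ frontier b.B := hcov ▸ subset_union_left
    rw [EqOn.of_subset_closure (g := fun _ => (0 : ℝ)) hfS (hf.mono hS) continuousOn_const
      subset_closure subset_rfl hx, mul_zero]
  · rw [hg x hx, zero_mul]

/-- Stated on the frontier only, since the normal may be discontinuous at critical points of `ψ`
inside the body. The continuity carries the condition on the normal derivative from S to its
closure. -/
theorem continuousOn_normalDeriv {f : E3 → ℝ} (hf : ContDiffOn ℝ 1 f (closure b.B)) :
    ContinuousOn (fun x => ∑ i, b.normal i x * b.pdx i f x) (frontier b.B) :=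
  continuousOn_finsetSum _ fun i _ => ContinuousOn.mul
    (fun _ hx => (contDiffAt_normal_of_frontier hx i).continuousAt.continuousWithinAt)
    ((continuousOn_pdx hf i).mono b.frontier_subset)

end Body

section Reciprocity

variable {b : Body} {M : Material} {p : BoundaryParts b} {π : ThermoProcess}

/-- Green's identity with the stresses at time `r` and the displacement at time `s` as test
function. The homogeneous boundary conditions hold at all times on fixed parts of the boundary, so
the boundary power vanishes even when the two times differ. -/
theorem IsSolution.integral_inertia (h : IsSolution b M p ProblemData.zero π) {r s : ℝ}
    (hr : 0 ≤ r) (hs : 0 ≤ s) (i : Fin 3) :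
    M.ρ * b.pair (dt (dt (π.u i))) (π.u i) r s
      = -∫ x in b.B, ((∑ j, π.τ j i x r * b.pd j (π.u i) x s)
        + ∑ j, ∑ k, π.μ j k i x r * b.pd j (b.pd k (π.u i)) x s) := by
  have hA := h.admissible
  have hu : ContDiffOn ℝ 2 (fun x => π.u i x s) (closure b.B) :=
    (hA.u_class i).contDiffOn_space_of_le (m := 2) (by norm_num) hs
  have hu1 : ContDiffOn ℝ 1 (fun x => π.u i x s) (closure b.B) := hu.of_le (by norm_num)
  have hg := Body.green (b := b) (t := fun j x => π.τ j i x r) (m := fun k j x => π.μ k j i x r)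
    (f := fun x => π.u i x s) (fun j => (hA.τ_class j i).contDiffOn_space hr)
    (fun k j => (hA.μ_class k j i).contDiffOn_space hr) hu fun x hx => by
      have h1 := Body.mul_eq_zero_of_cover (hu.continuousOn.mono b.frontier_subset) p.cover₁
        (fun x hx => h.boundary.u_bc x hx s hs i) (fun x hx => h.boundary.P_bc x hx r hr i) x hx
      have h2 := Body.mul_eq_zero_of_cover (Body.continuousOn_normalDeriv hu1) p.cover₂
        (fun x hx => h.boundary.d_bc x hx s hs i) (fun x hx => h.boundary.R_bc x hx r hr i) x hx
      exact (congrArg₂ (· + ·) h1 h2).trans (add_zero 0)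
  rw [Body.pair, ← integral_const_mul]
  refine Eq.trans (setIntegral_congr_fun b.isOpen.measurableSet fun x hx => ?_) hg
  have hm := h.balance.motion x hx r hr i
  rw [show ProblemData.zero.f i x r = 0 from rfl, mul_zero, add_zero] at hm
  change M.ρ * (dt (dt (π.u i)) x r * π.u i x s) = _
  rw [← mul_assoc, ← hm]
  rfl

/-- The power of the inertia forces at time `r` on the displacement at time `s`. -/
theorem IsSolution.sum_inertia (h : IsSolution b M p ProblemData.zero π) {r s : ℝ}
    (hr : 0 ≤ r) (hs : 0 ≤ s) :
    ∑ i, M.ρ * b.pair (dt (dt (π.u i))) (π.u i) r s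
      = -∫ x in b.B, ((∑ i, ∑ j, π.τ i j x r * π.e i j x s)
        + ∑ i, ∑ j, ∑ k, π.μ i j k x r * π.κ i j k x s) := by
  have hA := h.admissible
  have hu : ∀ i, ContDiffOn ℝ 2 (fun x => π.u i x s) (closure b.B) := fun i =>
    (hA.u_class i).contDiffOn_space_of_le (m := 2) (by norm_num) hs
  simp only [h.integral_inertia hr hs]
  rw [Finset.sum_neg_distrib, ← integral_finsetSum]
  · congr 1
    refine setIntegral_congr_fun b.isOpen.measurableSet fun x hx => ?_
    have hcl := subset_closure hx
    have hκ : ∀ i j k, b.pd j (b.pd k (π.u i)) x s = π.κ j k i x s := fun i j k => by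
      rw [hA.κ_symm x hcl s hs, h.balance.strain_grad x hx s hs]
    have hτ : ∀ i j, π.τ j i x r = π.τ i j x r := hA.τ_symm x hcl r hr
    -- Symmetry of the stress replaces the displacement gradient by its symmetric part.
    have he : ∑ i, ∑ j, π.τ j i x r * b.pd j (π.u i) x s = ∑ i, ∑ j, π.τ i j x r * π.e i j x s := by
      simp only [h.balance.strain x hx s hs, Fin.sum_univ_three, hτ 0 1, hτ 0 2, hτ 1 2]
      ring
    simp only [hκ, Finset.sum_add_distrib, he]
    congr 1
    rw [Finset.sum_comm]
    exact Finset.sum_congr rfl fun j _ => Finset.sum_comm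
  · intro i _
    refine Body.integrableOn_of_continuousOn (ContinuousOn.add ?_ ?_)
    · exact continuousOn_finsetSum _ fun j _ => (Body.Cont.slice (hA.τ_class j i).continuousOn hr).mul
        (Body.continuousOn_pdx ((hu i).of_le (by norm_num)) j)
    · exact continuousOn_finsetSum _ fun j _ => continuousOn_finsetSum _ fun k _ =>
        (Body.Cont.slice (hA.μ_class j k i).continuousOn hr).mul
          (Body.continuousOn_pdx (Body.contDiffOn_pdx_one (hu i) k) j)

/-- The electric quantities at two times are orthogonal. -/
theorem IsSolution.integral_electric (h : IsSolution b M p ProblemData.zero π) {r s : ℝ}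
    (hr : 0 ≤ r) (hs : 0 ≤ s) :
    ∫ x in b.B, ((∑ i, π.σ i x r * π.E i x s) + ∑ i, ∑ j, π.Q i j x r * π.V i j x s) = 0 := by
  have hA := h.admissible
  have hφ : ContDiffOn ℝ 2 (fun x => π.φ x s) (closure b.B) :=
    hA.φ_class.contDiffOn_space_of_le (m := 2) (by norm_num) hs
  have hφ1 : ContDiffOn ℝ 1 (fun x => π.φ x s) (closure b.B) := hφ.of_le (by norm_num)
  have hg := Body.green (b := b) (t := fun j x => π.σ j x r) (m := fun k j x => π.Q k j x r)
    (f := fun x => π.φ x s) (fun j => h.constitutive.contDiffOn_σ hA hr j)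
    (fun k j => (hA.Q_class k j).contDiffOn_space hr) hφ fun x hx => by
      have h1 := Body.mul_eq_zero_of_cover (hφ.continuousOn.mono b.frontier_subset) p.cover₄
        (fun x hx => h.boundary.φ_bc x hx s hs) (fun x hx => h.boundary.Lam_bc x hx r hr) x hx
      have h2 := Body.mul_eq_zero_of_cover (Body.continuousOn_normalDeriv hφ1) p.cover₅
        (fun x hx => h.boundary.ω_bc x hx s hs) (fun x hx => h.boundary.H_bc x hx r hr) x hx
      exact (congrArg₂ (· + ·) h1 h2).trans (add_zero 0)
  have hzero : ∫ x in b.B, ((∑ j, b.pdx j (fun x => π.σ j x r) x)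
      - ∑ j, ∑ k, b.pdx j (b.pdx k (fun x => π.Q k j x r)) x) * π.φ x s = 0 := by
    -- The electric equation has no time derivative and no charge, so the tested quantity vanishes
    -- whatever the two times are.
    refine Eq.trans (setIntegral_congr_fun (g := fun _ => (0 : ℝ)) b.isOpen.measurableSet
      fun x hx => ?_) (integral_zero _ _)
    have he := h.balance.electric x hx r hr
    exact mul_eq_zero_of_left he _
  rw [hzero, eq_comm, neg_eq_zero] at hg
  rw [← neg_eq_zero, ← hg, ← integral_neg]
  refine setIntegral_congr_fun b.isOpen.measurableSet fun x hx => ?_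
  have hcl := subset_closure hx
  have hV : ∀ j k, b.pdx j (b.pdx k fun x => π.φ x s) x = -π.V j k x s := fun j k => by
    rw [hA.V_symm x hcl s hs, h.balance.field_grad x hx s hs, neg_neg]
    rfl
  have hE : ∀ j, b.pdx j (fun x => π.φ x s) x = -π.E j x s := fun j => by
    rw [h.balance.field x hx s hs, neg_neg]
    rfl
  simp only [hV, hE, mul_neg, Finset.sum_neg_distrib]
  ring

/-- The entropy production at time `r` tested with the temperature at time `s`. -/
theorem IsSolution.integral_energy (hM : M.Standing) (h : IsSolution b M p ProblemData.zero π)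
    {r s : ℝ} (hr : 0 ≤ r) (hs : 0 ≤ s) :
    M.ρ * b.pair (dt π.η) π.θ r s
      = -∑ j, ∑ l, M.k j l * b.pair (π.gradθ l) (π.gradθ j) r s := by
  have hA := h.admissible
  have hT : M.T₀ ≠ 0 := hM.T₀_pos.ne'
  have hθ : ContDiffOn ℝ 1 (fun x => π.θ x s) (closure b.B) :=
    hA.θ_class.contDiffOn_space_of_le (m := 1) (by norm_num) hs
  have hg := Body.integral_div_mul (b := b) (t := fun j x => π.q j x r)
    (f := fun x => π.θ x s) (fun j => (hA.q_class j).contDiffOn_space hr) hθ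
    (Body.mul_eq_zero_of_cover (hθ.continuousOn.mono b.frontier_subset) p.cover₃
        (fun x hx => h.boundary.θ_bc x hx s hs) (fun x hx => h.boundary.q_bc x hx r hr))
  have h1 : ∫ x in b.B, (∑ j, b.pdx j (fun x => π.q j x r) x) * π.θ x s
      = -M.T₀ * (M.ρ * b.pair (dt π.η) π.θ r s) := by
    rw [Body.pair, ← integral_const_mul, ← integral_const_mul]
    refine setIntegral_congr_fun b.isOpen.measurableSet fun x hx => ?_
    have he := h.balance.energy x hx r hr
    rw [show ProblemData.zero.h x r = 0 from rfl] at he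
    have he' : ∑ j, b.pdx j (fun x => π.q j x r) x = -(M.ρ * M.T₀ * dt π.η x r) := by
      rw [mul_zero, sub_zero] at he
      exact (neg_eq_of_add_eq_zero_right he).symm
    simp only [he']
    ring
  have h2 : ∫ x in b.B, ∑ j, π.q j x r * b.pdx j (fun x => π.θ x s) x
      = -M.T₀ * ∑ j, ∑ l, M.k j l * b.pair (π.gradθ l) (π.gradθ j) r s := by
    have hint : ∀ j l, IntegrableOn (fun x => M.k j l * (π.gradθ l x r * π.gradθ j x s)) b.B :=
      fun j l => (Body.Cont.integrableOn_mul (hA.gradθ_class l).continuousOn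
        (hA.gradθ_class j).continuousOn hr hs).const_mul _
    simp only [Body.pair, ← integral_const_mul]
    simp only [← integral_finsetSum _ fun l _ => hint _ l]
    rw [← integral_finsetSum _ fun j _ => integrable_finsetSum _ fun l _ => hint j l,
      ← integral_const_mul]
    refine setIntegral_congr_fun b.isOpen.measurableSet fun x hx => ?_
    have hq : ∀ j, π.q j x r = -M.T₀ * ∑ l, M.k j l * π.gradθ l x r := fun j => by
      rw [← h.constitutive.heat_flux x (subset_closure hx) r hr j]
      field_simp
    have hθ' : ∀ j, b.pdx j (fun x => π.θ x s) x = π.gradθ j x s := fun j =>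
      (h.balance.temp_grad x hx s hs j).symm
    simp only [hq, hθ', Finset.mul_sum, Finset.sum_mul]
    exact Finset.sum_congr rfl fun j _ => Finset.sum_congr rfl fun l _ => by ring
  rw [h1, h2] at hg
  have := mul_left_cancel₀ (neg_ne_zero.2 hT) (hg.trans (mul_neg _ _).symm)
  exact this

/-- Transposition of a bilinear form. Arbitrary index types let pairs and triples of tensor indices
be treated as single indices, so that each constitutive tensor becomes a matrix. -/
theorem sum_mul_comm {ι κ : Type*} [Fintype ι] [Fintype κ] (A : ι → κ → ℝ) (x : κ → ℝ)
    (y : ι → ℝ) : ∑ i, (∑ k, A i k * x k) * y i = ∑ k, (∑ i, A i k * y i) * x k := by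
  simp only [Finset.sum_mul]
  rw [Finset.sum_comm]
  exact Finset.sum_congr rfl fun k _ => Finset.sum_congr rfl fun i _ => by ring

/-- The constitutive equations are reciprocal. -/
theorem Constitutive.reciprocal (hM : M.Standing) (hC : Constitutive b M π) {x : E3}
    (hx : x ∈ closure b.B) {r s : ℝ} (hr : 0 ≤ r) (hs : 0 ≤ s) :
    (∑ i, ∑ j, π.τ i j x r * π.e i j x s) + (∑ i, ∑ j, ∑ k, π.μ i j k x r * π.κ i j k x s)
        - ((∑ i, π.σ i x r * π.E i x s) + ∑ i, ∑ j, π.Q i j x r * π.V i j x s)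
        - (M.ρ * π.η x r + M.γ / M.β * dt π.θ x r) * (π.θ x s + M.β * dt π.θ x s)
      = (∑ i, ∑ j, π.τ i j x s * π.e i j x r) + (∑ i, ∑ j, ∑ k, π.μ i j k x s * π.κ i j k x r)
        - ((∑ i, π.σ i x s * π.E i x r) + ∑ i, ∑ j, π.Q i j x s * π.V i j x r)
        - (M.ρ * π.η x s + M.γ / M.β * dt π.θ x s) * (π.θ x r + M.β * dt π.θ x r) := by
  have hS := hM.symmetric
  have e11 : ∀ y z : Fin 3 → Fin 3 → ℝ, ∑ i, ∑ j, (∑ k, ∑ l, M.a11 i j k l * y k l) * z i j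
      = ∑ i, ∑ j, (∑ k, ∑ l, M.a11 i j k l * z k l) * y i j := fun y z => by
    have := sum_mul_comm (fun (i : Fin 3 × Fin 3) (k : Fin 3 × Fin 3) => M.a11 i.1 i.2 k.1 k.2)
      (fun k => y k.1 k.2) (fun i => z i.1 i.2)
    simp only [Fintype.sum_prod_type] at this
    rw [this]
    simp only [hS.a11_major]
  have e77 : ∀ y z : Fin 3 → Fin 3 → ℝ, ∑ i, ∑ j, (∑ k, ∑ l, M.a77 i j k l * y k l) * z i j
      = ∑ i, ∑ j, (∑ k, ∑ l, M.a77 i j k l * z k l) * y i j := fun y z => by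
    have := sum_mul_comm (fun (i : Fin 3 × Fin 3) (k : Fin 3 × Fin 3) => M.a77 i.1 i.2 k.1 k.2)
      (fun k => y k.1 k.2) (fun i => z i.1 i.2)
    simp only [Fintype.sum_prod_type] at this
    rw [this]
    simp only [hS.a77_major]
  have e17 : ∀ y z : Fin 3 → Fin 3 → ℝ, ∑ i, ∑ j, (∑ k, ∑ l, M.a17 i j k l * y k l) * z i j
      = ∑ i, ∑ j, (∑ k, ∑ l, M.a17 k l i j * z k l) * y i j := fun y z => by
    have := sum_mul_comm (fun (i : Fin 3 × Fin 3) (k : Fin 3 × Fin 3) => M.a17 i.1 i.2 k.1 k.2)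
      (fun k => y k.1 k.2) (fun i => z i.1 i.2)
    simp only [Fintype.sum_prod_type] at this
    exact this
  have e22 : ∀ y z : Fin 3 → Fin 3 → Fin 3 → ℝ,
      ∑ i, ∑ j, ∑ k, (∑ l, ∑ h, ∑ m, M.a22 i j k l h m * y l h m) * z i j k
      = ∑ i, ∑ j, ∑ k, (∑ l, ∑ h, ∑ m, M.a22 i j k l h m * z l h m) * y i j k := fun y z => by
    have := sum_mul_comm (fun (i : Fin 3 × Fin 3 × Fin 3) (k : Fin 3 × Fin 3 × Fin 3) =>
      M.a22 i.1 i.2.1 i.2.2 k.1 k.2.1 k.2.2)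
      (fun k => y k.1 k.2.1 k.2.2) (fun i => z i.1 i.2.1 i.2.2)
    simp only [Fintype.sum_prod_type] at this
    rw [this]
    simp only [hS.a22_major]
  have e23 : ∀ (y : Fin 3 → ℝ) (z : Fin 3 → Fin 3 → Fin 3 → ℝ),
      ∑ i, ∑ j, ∑ k, (∑ l, M.a23 i j k l * y l) * z i j k
      = ∑ i, (∑ j, ∑ k, ∑ l, M.a23 j k l i * z j k l) * y i := fun y z => by
    have := sum_mul_comm (fun (i : Fin 3 × Fin 3 × Fin 3) (k : Fin 3) =>
      M.a23 i.1 i.2.1 i.2.2 k) y (fun i => z i.1 i.2.1 i.2.2)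
    simp only [Fintype.sum_prod_type] at this
    exact this
  have e33 : ∀ y z : Fin 3 → ℝ, ∑ i, (∑ j, M.a33 i j * y j) * z i
      = ∑ i, (∑ j, M.a33 i j * z j) * y i := fun y z => by
    rw [sum_mul_comm]
    simp only [hS.a33_symm]
  have hσ : ∀ t, 0 ≤ t → ∀ i, π.σ i x t = -((∑ j, ∑ k, ∑ l, M.a23 j k l i * π.κ j k l x t)
      + ∑ j, M.a33 i j * π.E j x t) := fun t ht i => by
    rw [← hC.sigma x hx t ht i, neg_neg]
  have hQ : ∀ t, 0 ≤ t → ∀ i j, π.Q i j x t = -((∑ k, ∑ l, M.a17 k l i j * π.e k l x t)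
      + (∑ k, ∑ l, M.a77 i j k l * π.V k l x t)
      + M.a47 i j * (π.θ x t + M.β * dt π.θ x t)) := fun t ht i j => by
    rw [← hC.quadrupole x hx t ht i j, neg_neg]
  have hη : ∀ t, 0 ≤ t → M.ρ * π.η x t + M.γ / M.β * dt π.θ x t
      = -((∑ i, ∑ j, M.a14 i j * π.e i j x t) + (∑ i, ∑ j, M.a47 i j * π.V i j x t)
        + M.c * (π.θ x t + M.β * dt π.θ x t)) := fun t ht => by
    have h1 := hC.entropy x hx t ht
    have hc := hM.c_ne
    have hb := hM.β_ne
    -- The reason for adding (γ/β)θ̇ to the entropy: what remains depends on the temperature only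
    -- through θ + βθ̇, the same combination that enters the stress and the quadrupole.
    have h2 : M.c * M.betaPrime = M.c * M.β + M.γ / M.β := by
      rw [Material.betaPrime]
      field_simp
    linear_combination -h1 - dt π.θ x t * h2
  have m14 : ∀ (T : ℝ) (y : Fin 3 → Fin 3 → ℝ), ∑ i, ∑ j, M.a14 i j * T * y i j
      = T * ∑ i, ∑ j, M.a14 i j * y i j := fun T y => by
    simp only [Finset.mul_sum]
    exact Finset.sum_congr rfl fun i _ => Finset.sum_congr rfl fun j _ => by ring
  have m47 : ∀ (T : ℝ) (y : Fin 3 → Fin 3 → ℝ), ∑ i, ∑ j, M.a47 i j * T * y i j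
      = T * ∑ i, ∑ j, M.a47 i j * y i j := fun T y => by
    simp only [Finset.mul_sum]
    exact Finset.sum_congr rfl fun i _ => Finset.sum_congr rfl fun j _ => by ring
  rw [hη r hr, hη s hs]
  simp only [hC.stress x hx r hr, hC.stress x hx s hs, hC.hyperstress x hx r hr,
    hC.hyperstress x hx s hs, hσ r hr, hσ s hs, hQ r hr, hQ s hs, neg_mul, add_mul,
    Finset.sum_add_distrib, Finset.sum_neg_distrib, m14, m47]
  have f11 := e11 (fun i j => π.e i j x r) (fun i j => π.e i j x s)
  have f77 := e77 (fun i j => π.V i j x r) (fun i j => π.V i j x s)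
  have f17 := e17 (fun i j => π.V i j x r) (fun i j => π.e i j x s)
  have g17 := e17 (fun i j => π.V i j x s) (fun i j => π.e i j x r)
  have f22 := e22 (fun i j k => π.κ i j k x r) (fun i j k => π.κ i j k x s)
  have f23 := e23 (fun i => π.E i x r) (fun i j k => π.κ i j k x s)
  have g23 := e23 (fun i => π.E i x s) (fun i j k => π.κ i j k x r)
  have f33 := e33 (fun i => π.E i x r) (fun i => π.E i x s)
  -- Diagonal blocks are symmetric by the major symmetries. The coupling blocks `a17` and `a23` are
  -- matched with their transposes, once for each order of the two times; the thermal couplings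
  -- cancel directly.
  linear_combination f11 + f77 + f17 - g17 + f22 + f23 - g23 + f33

theorem Admissible.cont_σ (hA : Admissible b π) (hC : Constitutive b M π) {t : ℝ} (ht : 0 ≤ t)
    (i : Fin 3) : ContinuousOn (fun x => π.σ i x t) (closure b.B) :=
  (hC.contDiffOn_σ hA ht i).continuousOn

/-- The reciprocity relation between two times. -/
theorem IsSolution.reciprocity (hM : M.Standing) (h : IsSolution b M p ProblemData.zero π)
    {r s : ℝ} (hr : 0 ≤ r) (hs : 0 ≤ s) :
    (∑ i, M.ρ * b.pair (dt (dt (π.u i))) (π.u i) r s)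
        + (M.ρ * b.pair π.η π.θ r s + M.ρ * M.β * b.pair π.η (dt π.θ) r s
          + M.γ / M.β * b.pair (dt π.θ) π.θ r s)
      = (∑ i, M.ρ * b.pair (dt (dt (π.u i))) (π.u i) s r)
        + (M.ρ * b.pair π.η π.θ s r + M.ρ * M.β * b.pair π.η (dt π.θ) s r
          + M.γ / M.β * b.pair (dt π.θ) π.θ s r) := by
  have hA := h.admissible
  have hC := h.constitutive
  have hθ : b.Cont π.θ := hA.θ_class.continuousOn
  have hη : b.Cont π.η := hA.η_class.continuousOn
  have hθ' : b.Cont (dt π.θ) := hA.θ_class.continuousOn_dt (by norm_num)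
  have key : ∀ {r s : ℝ}, 0 ≤ r → 0 ≤ s →
      ∫ x in b.B, ((∑ i, ∑ j, π.τ i j x r * π.e i j x s)
        + (∑ i, ∑ j, ∑ k, π.μ i j k x r * π.κ i j k x s)
        - ((∑ i, π.σ i x r * π.E i x s) + ∑ i, ∑ j, π.Q i j x r * π.V i j x s)
        - (M.ρ * π.η x r + M.γ / M.β * dt π.θ x r) * (π.θ x s + M.β * dt π.θ x s))
      = -((∑ i, M.ρ * b.pair (dt (dt (π.u i))) (π.u i) r s)
        + (M.ρ * b.pair π.η π.θ r s + M.ρ * M.β * b.pair π.η (dt π.θ) r s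
          + M.γ / M.β * b.pair (dt π.θ) π.θ r s)) - M.γ * b.pair (dt π.θ) (dt π.θ) r s := by
    intro r s hr hs
    have i1 : IntegrableOn (fun x => (∑ i, ∑ j, π.τ i j x r * π.e i j x s)
        + (∑ i, ∑ j, ∑ k, π.μ i j k x r * π.κ i j k x s)) b.B := by
      refine Body.integrableOn_of_continuousOn (ContinuousOn.add ?_ ?_)
      · exact continuousOn_finsetSum _ fun i _ => continuousOn_finsetSum _ fun j _ =>
          (Body.Cont.slice (hA.τ_class i j).continuousOn hr).mul
            (Body.Cont.slice (hA.e_class i j).continuousOn hs)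
      · exact continuousOn_finsetSum _ fun i _ => continuousOn_finsetSum _ fun j _ =>
          continuousOn_finsetSum _ fun k _ =>
          (Body.Cont.slice (hA.μ_class i j k).continuousOn hr).mul
            (Body.Cont.slice (hA.κ_class i j k).continuousOn hs)
    have i2 : IntegrableOn (fun x => (∑ i, π.σ i x r * π.E i x s)
        + ∑ i, ∑ j, π.Q i j x r * π.V i j x s) b.B := by
      refine Body.integrableOn_of_continuousOn (ContinuousOn.add ?_ ?_)
      · exact continuousOn_finsetSum _ fun i _ => (hA.cont_σ hC hr i).mul
            (Body.Cont.slice (hA.E_class i).continuousOn hs)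
      · exact continuousOn_finsetSum _ fun i _ => continuousOn_finsetSum _ fun j _ =>
          (Body.Cont.slice (hA.Q_class i j).continuousOn hr).mul
            (Body.Cont.slice (hA.V_class i j).continuousOn hs)
    have j1 := (hη.integrableOn_mul hθ hr hs).const_mul M.ρ
    have j2 := (hη.integrableOn_mul hθ' hr hs).const_mul (M.ρ * M.β)
    have j3 := (hθ'.integrableOn_mul hθ hr hs).const_mul (M.γ / M.β)
    have j4 := (hθ'.integrableOn_mul hθ' hr hs).const_mul M.γ
    -- Only the last product, θ̇(r)θ̇(s), is symmetric in the two times; it is kept apart so that it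
    -- drops out when the two orders are compared.
    have hT : ∀ x, (M.ρ * π.η x r + M.γ / M.β * dt π.θ x r) * (π.θ x s + M.β * dt π.θ x s)
        = M.ρ * (π.η x r * π.θ x s) + M.ρ * M.β * (π.η x r * dt π.θ x s)
          + M.γ / M.β * (dt π.θ x r * π.θ x s) + M.γ * (dt π.θ x r * dt π.θ x s) := fun x => by
      have hb := hM.β_ne
      field_simp
      ring
    simp only [hT]
    have i12 : IntegrableOn (fun x => (∑ i, ∑ j, π.τ i j x r * π.e i j x s)
        + (∑ i, ∑ j, ∑ k, π.μ i j k x r * π.κ i j k x s)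
        - ((∑ i, π.σ i x r * π.E i x s) + ∑ i, ∑ j, π.Q i j x r * π.V i j x s)) b.B := i1.sub i2
    have j12 : IntegrableOn (fun x => M.ρ * (π.η x r * π.θ x s)
        + M.ρ * M.β * (π.η x r * dt π.θ x s)) b.B := j1.add j2
    have j123 : IntegrableOn (fun x => M.ρ * (π.η x r * π.θ x s)
        + M.ρ * M.β * (π.η x r * dt π.θ x s) + M.γ / M.β * (dt π.θ x r * π.θ x s)) b.B :=
      j12.add j3
    have j1234 : IntegrableOn (fun x => M.ρ * (π.η x r * π.θ x s)
        + M.ρ * M.β * (π.η x r * dt π.θ x s) + M.γ / M.β * (dt π.θ x r * π.θ x s)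
        + M.γ * (dt π.θ x r * dt π.θ x s)) b.B := j123.add j4
    rw [integral_sub i12 j1234, integral_sub i1 i2,
      integral_add j123 j4, integral_add j12 j3, integral_add j1 j2,
      h.integral_electric hr hs, h.sum_inertia hr hs]
    simp only [integral_const_mul, Body.pair]
    ring
  have h1 := key hr hs
  have h2 := key hs hr
  have h3 : ∫ x in b.B, ((∑ i, ∑ j, π.τ i j x r * π.e i j x s)
        + (∑ i, ∑ j, ∑ k, π.μ i j k x r * π.κ i j k x s)
        - ((∑ i, π.σ i x r * π.E i x s) + ∑ i, ∑ j, π.Q i j x r * π.V i j x s)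
        - (M.ρ * π.η x r + M.γ / M.β * dt π.θ x r) * (π.θ x s + M.β * dt π.θ x s))
      = ∫ x in b.B, ((∑ i, ∑ j, π.τ i j x s * π.e i j x r)
        + (∑ i, ∑ j, ∑ k, π.μ i j k x s * π.κ i j k x r)
        - ((∑ i, π.σ i x s * π.E i x r) + ∑ i, ∑ j, π.Q i j x s * π.V i j x r)
        - (M.ρ * π.η x s + M.γ / M.β * dt π.θ x s) * (π.θ x r + M.β * dt π.θ x r)) :=
    setIntegral_congr_fun b.isOpen.measurableSet fun x hx =>
      hC.reciprocal hM (subset_closure hx) hr hs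
  rw [h1, h2, Body.pair_comm (dt π.θ) (dt π.θ) r s] at h3
  linarith

end Reciprocity

/-! ### Evolution of pairings in time -/

namespace Body

variable {b : Body}

/-- `f'` is the time derivative of `f`, and both are continuous on `B̄ × [0,∞)`. -/
structure TimeDeriv (b : Body) (f f' : ScalarField) : Prop where
  cont : b.Cont f
  cont' : b.Cont f'
  hasDeriv : ∀ x ∈ closure b.B, ∀ t, 0 ≤ t → HasDerivWithinAt (f x) (f' x t) (Ici 0) t

/-- Serves to freeze one factor of a pairing at a fixed time while integrating in the other time. -/
theorem TimeDeriv.of_const {w : E3 → ℝ} (hw : ContinuousOn w (closure b.B)) :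
    b.TimeDeriv (fun x _ => w x) fun _ _ => 0 where
  cont := hw.comp continuousOn_fst fun _ hp => hp.1
  cont' := continuousOn_const
  hasDeriv _ _ t _ := hasDerivWithinAt_const t _ _

theorem ClassC.timeDeriv {m n : ℕ} {f : ScalarField} (hf : b.ClassC m n f) (hn : 1 ≤ n) :
    b.TimeDeriv f (dt f) where
  cont := hf.continuousOn
  cont' := hf.continuousOn_dt hn
  hasDeriv _ hx _ ht := hf.hasDerivWithinAt hn hx ht

theorem ClassC.timeDeriv_dt {m n : ℕ} {f : ScalarField} (hf : b.ClassC m n f) (hn : 2 ≤ n) :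
    b.TimeDeriv (dt f) (dt (dt f)) where
  cont := hf.continuousOn_dt (by omega)
  cont' := hf.continuousOn_dt_dt hn
  hasDeriv _ hx _ ht := hf.hasDerivWithinAt_dt hn hx ht

/-- The primitive in time of a field. -/
noncomputable def primitive (f : ScalarField) : ScalarField := fun x t => ∫ s in (0 : ℝ)..t, f x s

theorem primitive_zero (f : ScalarField) (x : E3) : primitive f x 0 = 0 :=
  intervalIntegral.integral_same

/-- Fields are controlled only for nonnegative times. Extending by the value at time 0 gives an
integrand continuous on the whole line, to which the parametric and fundamental theorems of calculus
apply. -/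
theorem primitive_eq_integral_max (f : ScalarField) (x : E3) {t : ℝ} (ht : 0 ≤ t) :
    primitive f x t = ∫ s in (0 : ℝ)..t, f x (max s 0) := by
  refine intervalIntegral.integral_congr fun s hs => ?_
  rw [uIcc_of_le ht] at hs
  simp only [max_eq_left hs.1]

theorem Cont.timeDeriv_primitive {f : ScalarField} (hf : b.Cont f) :
    b.TimeDeriv (primitive f) f where
  cont := by
    have hF : Continuous (Function.uncurry fun (x : closure b.B) (s : ℝ) => f x (max s 0)) :=
      ContinuousOn.comp_continuous (g := fun p : E3 × ℝ => f p.1 p.2)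
        (f := fun p : closure b.B × ℝ => ((p.1 : E3), max p.2 0)) hf (by fun_prop)
        fun p => ⟨p.1.2, show (0 : ℝ) ≤ max p.2 0 from le_max_right _ _⟩
    have hP := intervalIntegral.continuous_parametric_primitive_of_continuous (μ := volume)
      (a₀ := 0) hF
    rw [Cont, continuousOn_iff_continuous_domRestrict]
    have hcomp : Continuous fun p : ↥(closure b.B ×ˢ Ici (0 : ℝ)) =>
        ((⟨p.1.1, p.2.1⟩ : closure b.B), p.1.2) := by fun_prop
    refine (hP.comp hcomp).congr fun p => ?_
    exact (primitive_eq_integral_max f p.1.1 p.2.2).symm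
  cont' := hf
  hasDeriv x hx t ht := by
    have hF : Continuous fun s : ℝ => f x (max s 0) :=
      (hf.time hx).comp_continuous (by fun_prop) fun s => le_max_right s 0
    have h := (hF.integral_hasStrictDerivAt 0 t).hasDerivAt.hasDerivWithinAt (s := Ici 0)
    rw [max_eq_left ht] at h
    exact h.congr (fun s hs => primitive_eq_integral_max f x hs) (primitive_eq_integral_max f x ht)

theorem pair_eq_zero_of_left {f h : ScalarField} {r s : ℝ} (hf : ∀ x ∈ closure b.B, f x r = 0) :
    b.pair f h r s = 0 := by
  rw [pair, setIntegral_congr_fun (g := fun _ => (0 : ℝ)) b.isOpen.measurableSet, integral_zero]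
  exact fun x hx => mul_eq_zero_of_left (hf x (subset_closure hx)) _

section Path

variable {f f' h h' : ScalarField} {r₀ s₀ ε δ T : ℝ}

theorem Cont.comp_path (hf : b.Cont f) (hr : ∀ a ∈ Icc 0 T, 0 ≤ r₀ + ε * a) :
    ContinuousOn (fun p : ℝ × E3 => f p.2 (r₀ + ε * p.1)) (Icc 0 T ×ˢ closure b.B) :=
  ContinuousOn.comp (g := fun p : E3 × ℝ => f p.1 p.2)
    (f := fun p : ℝ × E3 => (p.2, r₀ + ε * p.1)) hf (by fun_prop)
    fun p hp => ⟨hp.2, hr p.1 hp.1⟩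

theorem integrable_prod_of_continuousOn (hT : 0 ≤ T) {F : ℝ → E3 → ℝ}
    (hF : ContinuousOn (fun p : ℝ × E3 => F p.1 p.2) (Icc 0 T ×ˢ closure b.B)) :
    Integrable (Function.uncurry F)
      ((volume.restrict (uIoc 0 T)).prod (volume.restrict b.B)) := by
  rw [Measure.prod_restrict, ← Measure.volume_eq_prod]
  have h := hF.integrableOn_compact (μ := volume) (isCompact_Icc.prod b.isCompact_closure)
  refine IntegrableOn.mono_set h (prod_mono ?_ subset_closure)
  rw [uIoc_of_le hT]
  exact Ioc_subset_Icc_self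

theorem intervalIntegrable_pair (hT : 0 ≤ T) (hf : b.Cont f) (hh : b.Cont h)
    (hr : ∀ a ∈ Icc 0 T, 0 ≤ r₀ + ε * a) (hs : ∀ a ∈ Icc 0 T, 0 ≤ s₀ + δ * a) :
    IntervalIntegrable (fun a => b.pair f h (r₀ + ε * a) (s₀ + δ * a)) volume 0 T := by
  have hi := integrable_prod_of_continuousOn (b := b) hT
    (F := fun a x => f x (r₀ + ε * a) * h x (s₀ + δ * a))
    ((hf.comp_path hr).mul (hh.comp_path hs))
  rw [intervalIntegrable_iff]
  exact hi.integral_prod_left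

theorem TimeDeriv.hasDerivWithinAt_path (hf : b.TimeDeriv f f')
    (hr : ∀ a ∈ Icc 0 T, 0 ≤ r₀ + ε * a) {x : E3} (hx : x ∈ closure b.B) {a : ℝ}
    (ha : a ∈ Icc 0 T) :
    HasDerivWithinAt (fun a => f x (r₀ + ε * a)) (f' x (r₀ + ε * a) * ε) (Icc 0 T) a := by
  have h1 : HasDerivWithinAt (fun a => r₀ + ε * a) ε (Icc 0 T) a := by
    simpa using (((hasDerivAt_id a).const_mul ε).const_add r₀).hasDerivWithinAt
  exact (hf.hasDeriv x hx _ (hr a ha)).comp a h1 fun a ha => hr a ha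

/-- The evolution of a pairing along an affine path in the plane of times. -/
theorem integral_pair_path (hT : 0 ≤ T) (hf : b.TimeDeriv f f') (hh : b.TimeDeriv h h')
    (hr : ∀ a ∈ Icc 0 T, 0 ≤ r₀ + ε * a) (hs : ∀ a ∈ Icc 0 T, 0 ≤ s₀ + δ * a) :
    ∫ a in (0 : ℝ)..T, (ε * b.pair f' h (r₀ + ε * a) (s₀ + δ * a)
        + δ * b.pair f h' (r₀ + ε * a) (s₀ + δ * a))
      = b.pair f h (r₀ + ε * T) (s₀ + δ * T) - b.pair f h r₀ s₀ := by
  have hc : ContinuousOn (fun p : ℝ × E3 =>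
      f' p.2 (r₀ + ε * p.1) * ε * h p.2 (s₀ + δ * p.1)
        + f p.2 (r₀ + ε * p.1) * (h' p.2 (s₀ + δ * p.1) * δ)) (Icc 0 T ×ˢ closure b.B) :=
    (((hf.cont'.comp_path hr).mul continuousOn_const).mul (hh.cont.comp_path hs)).add
      ((hf.cont.comp_path hr).mul ((hh.cont'.comp_path hs).mul continuousOn_const))
  -- Fubini takes the place of differentiation under the integral sign: after the exchange, the
  -- fundamental theorem of calculus is applied at each fixed point of the body.
  have hsw := intervalIntegral_integral_swap (integrable_prod_of_continuousOn (b := b) hT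
    (F := fun a x => f' x (r₀ + ε * a) * ε * h x (s₀ + δ * a)
        + f x (r₀ + ε * a) * (h' x (s₀ + δ * a) * δ)) hc)
  have hl : ∫ a in (0 : ℝ)..T, (ε * b.pair f' h (r₀ + ε * a) (s₀ + δ * a)
        + δ * b.pair f h' (r₀ + ε * a) (s₀ + δ * a))
      = ∫ a in (0 : ℝ)..T, ∫ x in b.B, (f' x (r₀ + ε * a) * ε * h x (s₀ + δ * a)
        + f x (r₀ + ε * a) * (h' x (s₀ + δ * a) * δ)) := by
    refine intervalIntegral.integral_congr fun a ha => ?_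
    rw [uIcc_of_le hT] at ha
    simp only [pair]
    rw [← integral_const_mul, ← integral_const_mul, ← integral_add]
    · refine integral_congr_ae (ae_of_all _ fun x => ?_)
      ring
    · exact (hf.cont'.integrableOn_mul hh.cont (hr a ha) (hs a ha)).const_mul ε
    · exact (hf.cont.integrableOn_mul hh.cont' (hr a ha) (hs a ha)).const_mul δ
  have h0 : (0 : ℝ) ∈ Icc 0 T := left_mem_Icc.2 hT
  have h1 : T ∈ Icc 0 T := right_mem_Icc.2 hT
  have hr0 : 0 ≤ r₀ := by simpa using hr 0 h0
  have hs0 : 0 ≤ s₀ := by simpa using hs 0 h0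
  rw [hl, hsw, pair, pair, ← integral_sub (hf.cont.integrableOn_mul hh.cont (hr T h1) (hs T h1))
    (hf.cont.integrableOn_mul hh.cont hr0 hs0)]
  refine setIntegral_congr_fun b.isOpen.measurableSet fun x hx => ?_
  have hcl := subset_closure hx
  have hd : ∀ a ∈ Icc 0 T, HasDerivWithinAt (fun a => f x (r₀ + ε * a) * h x (s₀ + δ * a))
      (f' x (r₀ + ε * a) * ε * h x (s₀ + δ * a) + f x (r₀ + ε * a) * (h' x (s₀ + δ * a) * δ))
      (Icc 0 T) a := fun a ha =>
    (hf.hasDerivWithinAt_path hr hcl ha).mul (hh.hasDerivWithinAt_path hs hcl ha)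
  have hint : IntervalIntegrable (fun a => f' x (r₀ + ε * a) * ε * h x (s₀ + δ * a)
      + f x (r₀ + ε * a) * (h' x (s₀ + δ * a) * δ)) volume 0 T := by
    refine ContinuousOn.intervalIntegrable ?_
    rw [uIcc_of_le hT]
    exact hc.comp (f := fun a => (a, x)) (by fun_prop) fun a ha => ⟨ha, hcl⟩
  have := intervalIntegral.integral_eq_sub_of_hasDerivAt_of_le hT
    (fun a ha => (hd a ha).continuousWithinAt)
    (fun a ha => (hd a (Ioo_subset_Icc_self ha)).hasDerivAt (Icc_mem_nhds ha.1 ha.2)) hint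
  simpa using this

end Path

section Reflection

variable {f f' f'' h h' : ScalarField} {t : ℝ}

theorem nonneg_sub {t : ℝ} : ∀ a ∈ Icc 0 t, 0 ≤ t + (-1) * a := fun a ha => by linarith [ha.2]

theorem nonneg_add {t : ℝ} (ht : 0 ≤ t) : ∀ a ∈ Icc 0 t, 0 ≤ t + 1 * a := fun a ha => by
  linarith [ha.1]

theorem intervalIntegrable_reflect (ht : 0 ≤ t) (hf : b.Cont f) (hh : b.Cont h) :
    IntervalIntegrable (fun a => b.pair f h (t - a) (t + a)) volume 0 t := by
  have := intervalIntegrable_pair (b := b) ht hf hh nonneg_sub (nonneg_add ht)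
  simpa only [neg_one_mul, one_mul, ← sub_eq_add_neg] using this

/-- The integrand is minus the derivative in a of ⟨f(t - a), h(t + a)⟩. At a = t the first factor is
taken at time 0, where it vanishes, so only the endpoint a = 0 contributes. -/
theorem integral_reflect (ht : 0 ≤ t) (hf : b.TimeDeriv f f') (hh : b.TimeDeriv h h')
    (h0 : ∀ x ∈ closure b.B, f x 0 = 0) :
    ∫ a in (0 : ℝ)..t, (b.pair f' h (t - a) (t + a) - b.pair f h' (t - a) (t + a))
      = b.pair f h t t := by
  have := integral_pair_path (b := b) ht hf hh nonneg_sub (nonneg_add ht)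
  simp only [neg_one_mul, one_mul, ← sub_eq_add_neg, sub_self] at this
  rw [pair_eq_zero_of_left h0, zero_sub] at this
  rw [← neg_inj, ← this, ← intervalIntegral.integral_neg]
  exact intervalIntegral.integral_congr fun a _ => by ring

/-- Add the first-order formula for the pairs (f', f) and (f, f'): the terms ⟨f'(t - a), f'(t + a)⟩
cancel. Both initial values must vanish, which is where the initial displacement and velocity enter.
-/
theorem integral_reflect_second (ht : 0 ≤ t) (hf : b.TimeDeriv f f') (hf' : b.TimeDeriv f' f'')
    (h0 : ∀ x ∈ closure b.B, f x 0 = 0) (h0' : ∀ x ∈ closure b.B, f' x 0 = 0) :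
    ∫ a in (0 : ℝ)..t, (b.pair f'' f (t - a) (t + a) - b.pair f f'' (t - a) (t + a))
      = 2 * b.pair f f' t t := by
  have h1 := integral_reflect ht hf' hf h0'
  have h2 := integral_reflect ht hf hf' h0
  rw [pair_comm f' f] at h1
  rw [two_mul]
  nth_rewrite 1 [← h1]
  rw [← h2, ← intervalIntegral.integral_add]
  · exact intervalIntegral.integral_congr fun a _ => by ring
  · exact (intervalIntegrable_reflect ht hf'.cont' hf.cont).sub
      (intervalIntegrable_reflect ht hf'.cont hf.cont')
  · exact (intervalIntegrable_reflect ht hf.cont' hf'.cont).sub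
      (intervalIntegrable_reflect ht hf.cont hf'.cont')

theorem intervalIntegrable_diag (ht : 0 ≤ t) (hf : b.Cont f) (hh : b.Cont h) :
    IntervalIntegrable (fun a => b.pair f h a a) volume 0 t := by
  have := intervalIntegrable_pair (b := b) (r₀ := 0) (s₀ := 0) (ε := 1) (δ := 1) ht hf hh
    (fun a ha => by linarith [ha.1]) (fun a ha => by linarith [ha.1])
  simpa only [one_mul, zero_add] using this

theorem integral_diag (ht : 0 ≤ t) (hf : b.TimeDeriv f f') (hh : b.TimeDeriv h h')
    (h0 : ∀ x ∈ closure b.B, f x 0 = 0) :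
    ∫ a in (0 : ℝ)..t, (b.pair f' h a a + b.pair f h' a a) = b.pair f h t t := by
  have := integral_pair_path (b := b) (r₀ := 0) (s₀ := 0) (ε := 1) (δ := 1) ht hf hh
    (fun a ha => by linarith [ha.1]) (fun a ha => by linarith [ha.1])
  simp only [one_mul, zero_add] at this
  rwa [pair_eq_zero_of_left h0, sub_zero] at this

/-- Integration in the first time alone. -/
theorem integral_pair_left {r s : ℝ} (hr : 0 ≤ r) (hs : 0 ≤ s) (hf : b.TimeDeriv f f')
    (hh : b.Cont h) (h0 : ∀ x ∈ closure b.B, f x 0 = 0) :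
    ∫ a in (0 : ℝ)..r, b.pair f' h a s = b.pair f h r s := by
  have := integral_pair_path (b := b) (r₀ := 0) (s₀ := s) (ε := 1) (δ := 0) hr hf
    (TimeDeriv.of_const (hh.slice hs))
    (fun a ha => by linarith [ha.1]) (fun a ha => by linarith [ha.1])
  simp only [one_mul, zero_add, zero_mul, add_zero] at this
  rw [pair_eq_zero_of_left h0, sub_zero] at this
  exact this

theorem intervalIntegrable_pair_left {r s : ℝ} (hr : 0 ≤ r) (hs : 0 ≤ s) (hf : b.Cont f)
    (hh : b.Cont h) : IntervalIntegrable (fun a => b.pair f h a s) volume 0 r := by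
  have := intervalIntegrable_pair (b := b) (r₀ := 0) (s₀ := s) (ε := 1) (δ := 0) hr hf
    hh (fun a ha => by linarith [ha.1]) (fun a ha => by linarith [ha.1])
  simpa only [one_mul, zero_add, zero_mul, add_zero] using this

end Reflection

end Body

/-! ### Energy identities from reciprocity along the times t - a and t + a. -/

section Energy

variable {b : Body} {M : Material} {p : BoundaryParts b} {π : ThermoProcess}

/-- Integrate the tested energy equation in its first time from 0. The entropy starts from zero, so
its rate integrates to the entropy itself, while the temperature gradient becomes its time
primitive. -/
theorem IsSolution.pair_entropy (hM : M.Standing) (h : IsSolution b M p ProblemData.zero π)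
    {r s : ℝ} (hr : 0 ≤ r) (hs : 0 ≤ s) :
    M.ρ * b.pair π.η π.θ r s
      = -∑ j, ∑ l, M.k j l * b.pair (Body.primitive (π.gradθ l)) (π.gradθ j) r s := by
  have hA := h.admissible
  have hθ : b.Cont π.θ := hA.θ_class.continuousOn
  have hg : ∀ j, b.Cont (π.gradθ j) := fun j => (hA.gradθ_class j).continuousOn
  rw [← Body.integral_pair_left hr hs (hA.η_class.timeDeriv le_rfl) hθ h.initial.η_init,
    ← intervalIntegral.integral_const_mul]
  simp only [← Body.integral_pair_left hr hs (hg _).timeDeriv_primitive (hg _)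
    (fun x _ => Body.primitive_zero _ x), ← intervalIntegral.integral_const_mul]
  have hi : ∀ j l, IntervalIntegrable
      (fun a => M.k j l * b.pair (π.gradθ l) (π.gradθ j) a s) volume 0 r := fun j l =>
    (Body.intervalIntegrable_pair_left hr hs (hg l) (hg j)).const_mul _
  have hi' : ∀ j, IntervalIntegrable
      (fun a => ∑ l, M.k j l * b.pair (π.gradθ l) (π.gradθ j) a s) volume 0 r := fun j => by
    simpa only [Finset.sum_fn] using IntervalIntegrable.sum Finset.univ fun l _ => hi j l
  simp only [← intervalIntegral.integral_finsetSum fun l _ => hi _ l]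
  rw [← intervalIntegral.integral_finsetSum fun j _ => hi' j,
    ← intervalIntegral.integral_neg]
  refine intervalIntegral.integral_congr fun a ha => ?_
  rw [uIcc_of_le hr] at ha
  simpa using h.integral_energy hM ha.1 hs

end Energy

section Energy

variable {b : Body} {M : Material} {p : BoundaryParts b} {π : ThermoProcess}

/-- The quadratic functional of the accumulated temperature gradient. -/
noncomputable def heatForm (b : Body) (M : Material) (π : ThermoProcess) (t : ℝ) : ℝ :=
  ∑ j, ∑ l, M.k j l * b.pair (Body.primitive (π.gradθ l)) (Body.primitive (π.gradθ j)) t t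

theorem sum_k_symm (hM : M.Standing) (A : Fin 3 → Fin 3 → ℝ) :
    ∑ j, ∑ l, M.k j l * A l j = ∑ j, ∑ l, M.k j l * A j l := by
  rw [Finset.sum_comm]
  exact Finset.sum_congr rfl fun j _ => Finset.sum_congr rfl fun l _ => by
    rw [hM.symmetric.k_symm l j]

/-- By `IsSolution.pair_entropy` and the symmetry of `k`, the antisymmetric part of ρ⟨η, θ⟩ is the
reflected derivative of the pairing of accumulated gradients, and these vanish at time 0. -/
theorem IsSolution.integral_heat_reflect (hM : M.Standing)
    (h : IsSolution b M p ProblemData.zero π) {t : ℝ} (ht : 0 ≤ t) :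
    M.ρ * ∫ a in (0 : ℝ)..t, (b.pair π.η π.θ (t - a) (t + a) - b.pair π.θ π.η (t - a) (t + a))
      = heatForm b M π t := by
  have hA := h.admissible
  have hg : ∀ j, b.TimeDeriv (Body.primitive (π.gradθ j)) (π.gradθ j) := fun j =>
    Body.Cont.timeDeriv_primitive (hA.gradθ_class j).continuousOn
  have hg0 : ∀ j, ∀ x ∈ closure b.B, Body.primitive (π.gradθ j) x 0 = 0 := fun j x _ =>
    Body.primitive_zero _ x
  simp only [heatForm, ← Body.integral_reflect ht (hg _) (hg _) (hg0 _),
    ← intervalIntegral.integral_const_mul]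
  have hi : ∀ j l, IntervalIntegrable (fun a => M.k j l *
      (b.pair (π.gradθ l) (Body.primitive (π.gradθ j)) (t - a) (t + a)
        - b.pair (Body.primitive (π.gradθ l)) (π.gradθ j) (t - a) (t + a))) volume 0 t :=
    fun j l => ((Body.intervalIntegrable_reflect ht (hg l).cont' (hg j).cont).sub
      (Body.intervalIntegrable_reflect ht (hg l).cont (hg j).cont')).const_mul _
  have hi' : ∀ j, IntervalIntegrable (fun a => ∑ l, M.k j l *
      (b.pair (π.gradθ l) (Body.primitive (π.gradθ j)) (t - a) (t + a)
        - b.pair (Body.primitive (π.gradθ l)) (π.gradθ j) (t - a) (t + a))) volume 0 t :=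
    fun j => by
    simpa only [Finset.sum_fn] using IntervalIntegrable.sum Finset.univ fun l _ => hi j l
  simp only [← intervalIntegral.integral_finsetSum fun l _ => hi _ l]
  rw [← intervalIntegral.integral_finsetSum fun j _ => hi' j]
  refine intervalIntegral.integral_congr fun a ha => ?_
  rw [uIcc_of_le ht] at ha
  have h1 := h.pair_entropy hM (r := t - a) (s := t + a) (by linarith [ha.2]) (by linarith [ha.1])
  have h2 := h.pair_entropy hM (r := t + a) (s := t - a) (by linarith [ha.1]) (by linarith [ha.2])
  simp only [mul_sub, Finset.sum_sub_distrib]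
  rw [Body.pair_comm π.θ π.η, h1, h2,
    sum_k_symm hM fun l j => b.pair (π.gradθ l) (Body.primitive (π.gradθ j)) (t - a) (t + a)]
  simp only [Body.pair_comm (π.gradθ _) (Body.primitive _)]
  ring

/-- Apply the reflection formula to (η, θ) and to (θ, η) and add. The terms with the entropy rate
cancel, because the energy equation makes ⟨η̇(r), θ(s)⟩ symmetric in r and s when `k` is symmetric.
-/
theorem IsSolution.integral_entropy_reflect (hM : M.Standing)
    (h : IsSolution b M p ProblemData.zero π) {t : ℝ} (ht : 0 ≤ t) :
    ∫ a in (0 : ℝ)..t,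
        (b.pair π.η (dt π.θ) (t - a) (t + a) - b.pair (dt π.θ) π.η (t - a) (t + a))
      = -(2 * b.pair π.η π.θ t t) := by
  have hA := h.admissible
  have hθ := hA.θ_class.timeDeriv (by norm_num)
  have hη := hA.η_class.timeDeriv le_rfl
  have h1 := Body.integral_reflect ht hη hθ h.initial.η_init
  have h2 := Body.integral_reflect ht hθ hη h.initial.θ_init
  rw [Body.pair_comm π.θ π.η t t] at h2
  have h3 : ∀ a ∈ uIcc 0 t, b.pair (dt π.η) π.θ (t - a) (t + a)
      = b.pair π.θ (dt π.η) (t - a) (t + a) := by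
    intro a ha
    rw [uIcc_of_le ht] at ha
    have e1 := h.integral_energy hM (r := t - a) (s := t + a) (by linarith [ha.2])
      (by linarith [ha.1])
    have e2 := h.integral_energy hM (r := t + a) (s := t - a) (by linarith [ha.1])
      (by linarith [ha.2])
    rw [sum_k_symm hM fun l j => b.pair (π.gradθ l) (π.gradθ j) (t - a) (t + a)] at e1
    simp only [Body.pair_comm (π.gradθ _) (π.gradθ _) (t + a)] at e2
    rw [Body.pair_comm π.θ]
    exact mul_left_cancel₀ hM.ρ_pos.ne' (e1.trans e2.symm)
  rw [two_mul]
  nth_rewrite 1 [← h1]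
  rw [← h2, ← intervalIntegral.integral_add, ← intervalIntegral.integral_neg]
  · refine intervalIntegral.integral_congr fun a ha => ?_
    simp only [h3 a ha]
    ring
  · exact (Body.intervalIntegrable_reflect ht hη.cont' hθ.cont).sub
      (Body.intervalIntegrable_reflect ht hη.cont hθ.cont')
  · exact (Body.intervalIntegrable_reflect ht hθ.cont' hη.cont).sub
      (Body.intervalIntegrable_reflect ht hθ.cont hη.cont')

/-- The instantaneous energy identity. -/
theorem IsSolution.energy_identity (hM : M.Standing)
    (h : IsSolution b M p ProblemData.zero π) {t : ℝ} (ht : 0 ≤ t) :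
    (∑ i, M.ρ * (2 * b.pair (π.u i) (dt (π.u i)) t t)) + heatForm b M π t
      + 2 * M.β * (∑ j, ∑ l, M.k j l *
          b.pair (Body.primitive (π.gradθ l)) (π.gradθ j) t t)
      + M.γ / M.β * b.pair π.θ π.θ t t = 0 := by
  have hA := h.admissible
  have hθ := hA.θ_class.timeDeriv (by norm_num)
  have hη := hA.η_class.timeDeriv le_rfl
  have hu := fun i => (hA.u_class i).timeDeriv (by norm_num)
  have hu' := fun i => (hA.u_class i).timeDeriv_dt le_rfl
  have I : ∀ {f g : ScalarField}, b.Cont f → b.Cont g →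
      IntervalIntegrable (fun a => b.pair f g (t - a) (t + a)) volume 0 t :=
    fun hf hg => Body.intervalIntegrable_reflect ht hf hg
  have ia := fun i => ((I (hu' i).cont' (hu i).cont).sub (I (hu i).cont (hu' i).cont')).const_mul M.ρ
  have ia' : IntervalIntegrable (fun a => ∑ i, M.ρ *
      (b.pair (dt (dt (π.u i))) (π.u i) (t - a) (t + a)
        - b.pair (π.u i) (dt (dt (π.u i))) (t - a) (t + a))) volume 0 t := by
    simpa only [Finset.sum_fn] using IntervalIntegrable.sum Finset.univ fun i _ => ia i
  have ib := ((I hη.cont hθ.cont).sub (I hθ.cont hη.cont)).const_mul M.ρ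
  have ic := ((I hη.cont hθ.cont').sub (I hθ.cont' hη.cont)).const_mul (M.ρ * M.β)
  have id' := ((I hθ.cont' hθ.cont).sub (I hθ.cont hθ.cont')).const_mul (M.γ / M.β)
  have hsum : ∫ a in (0 : ℝ)..t,
      (((∑ i, M.ρ * (b.pair (dt (dt (π.u i))) (π.u i) (t - a) (t + a)
          - b.pair (π.u i) (dt (dt (π.u i))) (t - a) (t + a)))
        + M.ρ * (b.pair π.η π.θ (t - a) (t + a) - b.pair π.θ π.η (t - a) (t + a)))
        + M.ρ * M.β * (b.pair π.η (dt π.θ) (t - a) (t + a)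
          - b.pair (dt π.θ) π.η (t - a) (t + a)))
        + M.γ / M.β * (b.pair (dt π.θ) π.θ (t - a) (t + a)
          - b.pair π.θ (dt π.θ) (t - a) (t + a)) = 0 := by
    refine Eq.trans (intervalIntegral.integral_congr (g := fun _ => (0 : ℝ)) fun a ha => ?_)
      intervalIntegral.integral_zero
    rw [uIcc_of_le ht] at ha
    have hr := h.reciprocity hM (r := t - a) (s := t + a) (by linarith [ha.2])
      (by linarith [ha.1])
    simp only [Body.pair_comm _ _ (t + a) (t - a)] at hr
    simp only [mul_sub, Finset.sum_sub_distrib]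
    linarith
  have ib' := ia'.add ib
  have ic' := ib'.add ic
  rw [intervalIntegral.integral_add (by exact ic') id', intervalIntegral.integral_add
    (by exact ib') ic, intervalIntegral.integral_add ia' ib,
    intervalIntegral.integral_finsetSum fun i _ => ia i] at hsum
  simp only [intervalIntegral.integral_const_mul] at hsum
  rw [h.integral_heat_reflect hM ht, h.integral_entropy_reflect hM ht,
    Body.integral_reflect ht hθ hθ h.initial.θ_init] at hsum
  simp only [Body.integral_reflect_second ht (hu _) (hu' _) (fun x hx => h.initial.u_init x hx _)
    (fun x hx => h.initial.v_init x hx _)] at hsum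
  have hent := h.pair_entropy hM ht ht
  -- The entropy term -2ρβ⟨η, θ⟩ at time t is rewritten through the accumulated gradient, which
  -- makes it β times the time derivative of `heatForm`.
  linear_combination hsum + 2 * M.β * hent

/-- The integrated energy identity. -/
theorem IsSolution.integrated_energy_identity (hM : M.Standing)
    (h : IsSolution b M p ProblemData.zero π) {t : ℝ} (ht : 0 ≤ t) :
    (∑ i, M.ρ * b.pair (π.u i) (π.u i) t t) + (∫ a in (0 : ℝ)..t, heatForm b M π a)
      + M.β * heatForm b M π t + M.γ / M.β * (∫ a in (0 : ℝ)..t, b.pair π.θ π.θ a a) = 0 := by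
  have hA := h.admissible
  have hθ := hA.θ_class.timeDeriv (by norm_num)
  have hu := fun i => (hA.u_class i).timeDeriv (by norm_num)
  have hg : ∀ j, b.TimeDeriv (Body.primitive (π.gradθ j)) (π.gradθ j) := fun j =>
    Body.Cont.timeDeriv_primitive (hA.gradθ_class j).continuousOn
  have hg0 : ∀ j, ∀ x ∈ closure b.B, Body.primitive (π.gradθ j) x 0 = 0 := fun j x _ =>
    Body.primitive_zero _ x
  have I : ∀ {f g : ScalarField}, b.Cont f → b.Cont g →
      IntervalIntegrable (fun a => b.pair f g a a) volume 0 t :=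
    fun hf hg => Body.intervalIntegrable_diag ht hf hg
  have S : ∀ {F : Fin 3 → ℝ → ℝ}, (∀ i, IntervalIntegrable (F i) volume 0 t) →
      IntervalIntegrable (fun a => ∑ i, F i a) volume 0 t := fun hF => by
    simpa only [Finset.sum_fn] using IntervalIntegrable.sum Finset.univ fun i _ => hF i
  have ia := fun i => ((I (hu i).cont' (hu i).cont).add (I (hu i).cont (hu i).cont')).const_mul M.ρ
  have ib : IntervalIntegrable (heatForm b M π) volume 0 t :=
    S fun j => S fun l => (I (hg l).cont (hg j).cont).const_mul _
  have ic := fun j l => ((I (hg l).cont' (hg j).cont).add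
    (I (hg l).cont (hg j).cont')).const_mul (M.k j l)
  have ic' := (S fun j => S fun l => ic j l).const_mul M.β
  have id' := (I hθ.cont hθ.cont).const_mul (M.γ / M.β)
  have hsum : ∫ a in (0 : ℝ)..t,
      (((∑ i, M.ρ * (b.pair (dt (π.u i)) (π.u i) a a + b.pair (π.u i) (dt (π.u i)) a a))
        + heatForm b M π a)
        + M.β * (∑ j, ∑ l, M.k j l * (b.pair (π.gradθ l) (Body.primitive (π.gradθ j)) a a
          + b.pair (Body.primitive (π.gradθ l)) (π.gradθ j) a a)))
        + M.γ / M.β * b.pair π.θ π.θ a a = 0 := by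
    refine Eq.trans (intervalIntegral.integral_congr (g := fun _ => (0 : ℝ)) fun a ha => ?_)
      intervalIntegral.integral_zero
    rw [uIcc_of_le ht] at ha
    have he := h.energy_identity hM ha.1
    simp only [mul_add, Finset.sum_add_distrib]
    -- Symmetry of `k` equates the two halves of the derivative of `heatForm`, which accounts for
    -- the factor 2 in the instantaneous identity.
    rw [sum_k_symm hM fun l j => b.pair (π.gradθ l) (Body.primitive (π.gradθ j)) a a]
    simp only [Body.pair_comm (π.gradθ _) (Body.primitive _),
      Body.pair_comm (dt (π.u _)) (π.u _)]
    simp only [two_mul, mul_add, Finset.sum_add_distrib] at he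
    linarith
  have iu := S ia
  have iub := iu.add ib
  rw [intervalIntegral.integral_add (by exact iub.add ic') id', intervalIntegral.integral_add
    (by exact iub) ic', intervalIntegral.integral_add iu ib,
    intervalIntegral.integral_finsetSum fun i _ => ia i,
    intervalIntegral.integral_const_mul M.β,
    intervalIntegral.integral_finsetSum fun j _ => S fun l => ic j l] at hsum
  simp only [intervalIntegral.integral_finsetSum fun l _ => ic _ l,
    intervalIntegral.integral_const_mul,
    Body.integral_diag ht (hu _) (hu _) fun x hx => h.initial.u_init x hx _,
    Body.integral_diag ht (hg _) (hg _) (hg0 _)] at hsum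
  exact hsum

/-! ### Positivity, and vanishing of displacement and temperature. -/

theorem Body.pair_self_nonneg (f : ScalarField) (t : ℝ) : 0 ≤ b.pair f f t t :=
  integral_nonneg fun x => mul_self_nonneg (f x t)

theorem heatForm_nonneg (hM : M.Standing) (hA : Admissible b π) {t : ℝ} (ht : 0 ≤ t) :
    0 ≤ heatForm b M π t := by
  have hg : ∀ j, b.Cont (Body.primitive (π.gradθ j)) := fun j =>
    (Body.Cont.timeDeriv_primitive (hA.gradθ_class j).continuousOn).cont
  have hi : ∀ j l, IntegrableOn (fun x => M.k j l *
      (Body.primitive (π.gradθ l) x t * Body.primitive (π.gradθ j) x t)) b.B := fun j l =>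
    ((hg l).integrableOn_mul (hg j) ht ht).const_mul _
  simp only [heatForm, Body.pair, ← integral_const_mul]
  simp only [← integral_finsetSum _ fun l _ => hi _ l]
  rw [← integral_finsetSum _ fun j _ => integrable_finsetSum _ fun l _ => hi j l]
  refine integral_nonneg fun x => ?_
  refine (hM.dissipation_k fun j => Body.primitive (π.gradθ j) x t).trans_eq ?_
  exact Finset.sum_congr rfl fun j _ => Finset.sum_congr rfl fun l _ => by ring

/-- A continuous nonnegative function with vanishing integral over the body vanishes. -/
theorem Body.eq_zero_of_integral_eq_zero {f : E3 → ℝ} (hf : ContinuousOn f (closure b.B))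
    (h0 : ∀ x ∈ b.B, 0 ≤ f x) (hint : ∫ x in b.B, f x = 0) : ∀ x ∈ closure b.B, f x = 0 := by
  have hae := (setIntegral_eq_zero_iff_of_nonneg_ae
    ((ae_restrict_iff' b.isOpen.measurableSet).2 (ae_of_all _ h0))
    (Body.integrableOn_of_continuousOn hf)).1 hint
  have hB : EqOn f (fun _ => (0 : ℝ)) b.B :=
    Measure.eqOn_open_of_ae_eq hae b.isOpen (hf.mono subset_closure) continuousOn_const
  exact Body.eq_zero_of_mem_closure hf subset_closure hB

theorem Body.eq_zero_of_pair_self_eq_zero {f : ScalarField} (hf : b.Cont f) {t : ℝ} (ht : 0 ≤ t)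
    (h : b.pair f f t t = 0) : ∀ x ∈ closure b.B, f x t = 0 := fun x hx =>
  mul_self_eq_zero.1 (Body.eq_zero_of_integral_eq_zero ((hf.slice ht).mul (hf.slice ht))
    (fun _ _ => mul_self_nonneg _) h x hx)

/-- A vanishing sum of nonnegative terms: every summand of the integrated identity is zero. The
displacement is controlled at each time, the temperature only through a time integral, so continuity
in time must finish the argument for θ. -/
theorem IsSolution.u_θ_eq_zero (hM : M.Standing) (hβ : 0 < M.β) (hγ : 0 < M.γ)
    (h : IsSolution b M p ProblemData.zero π) :
    (∀ x ∈ closure b.B, ∀ t, 0 ≤ t → ∀ i, π.u i x t = 0)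
      ∧ ∀ x ∈ closure b.B, ∀ t, 0 ≤ t → π.θ x t = 0 := by
  have hA := h.admissible
  have hρ := hM.ρ_pos
  have hθ : b.Cont π.θ := hA.θ_class.continuousOn
  have key : ∀ t, 0 ≤ t → (∀ i, b.pair (π.u i) (π.u i) t t = 0)
      ∧ ∫ a in (0 : ℝ)..t, b.pair π.θ π.θ a a = 0 := by
    intro t ht
    have he := h.integrated_energy_identity hM ht
    have h1 : ∀ i, 0 ≤ M.ρ * b.pair (π.u i) (π.u i) t t := fun i =>
      mul_nonneg hρ.le (Body.pair_self_nonneg _ t)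
    have h2 : 0 ≤ ∫ a in (0 : ℝ)..t, heatForm b M π a :=
      intervalIntegral.integral_nonneg ht fun a ha => heatForm_nonneg hM hA ha.1
    have h3 : 0 ≤ M.β * heatForm b M π t := mul_nonneg hβ.le (heatForm_nonneg hM hA ht)
    have h4 : 0 ≤ ∫ a in (0 : ℝ)..t, b.pair π.θ π.θ a a :=
      intervalIntegral.integral_nonneg ht fun a _ => Body.pair_self_nonneg _ a
    have hγβ : 0 < M.γ / M.β := div_pos hγ hβ
    have h5 := mul_nonneg hγβ.le h4
    have h6 := Finset.sum_nonneg fun i (_ : i ∈ Finset.univ) => h1 i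
    refine ⟨fun i => ?_, ?_⟩
    · have h7 := (Finset.sum_eq_zero_iff_of_nonneg fun i _ => h1 i).1
        (show ∑ i, M.ρ * b.pair (π.u i) (π.u i) t t = 0 by linarith) i (Finset.mem_univ i)
      exact (mul_eq_zero.1 h7).resolve_left hρ.ne'
    · exact (mul_eq_zero.1 (show M.γ / M.β * ∫ a in (0 : ℝ)..t, b.pair π.θ π.θ a a = 0 by
        linarith)).resolve_left hγβ.ne'
  refine ⟨fun x hx t ht i => ?_, fun x hx t ht => ?_⟩
  · exact Body.eq_zero_of_pair_self_eq_zero (hA.u_class i).continuousOn ht ((key t ht).1 i) x hx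
  · rcases ht.eq_or_lt with ht0 | ht0
    · rw [← ht0]
      exact h.initial.θ_init x hx
    -- A longer interval makes `t` an interior point, so that vanishing for almost every time in the
    -- open interval gives vanishing at `t` by continuity; time 0 is covered by the initial
    -- condition.
    · have hT : (0 : ℝ) ≤ t + 1 := by linarith
      have hint := (key (t + 1) hT).2
      rw [intervalIntegral.integral_of_le hT] at hint
      have hI := (intervalIntegrable_iff_integrableOn_Ioc_of_le hT).1
        (Body.intervalIntegrable_diag hT hθ hθ)
      have hae := (setIntegral_eq_zero_iff_of_nonneg_ae
        (ae_of_all _ fun a => Body.pair_self_nonneg π.θ a) hI).1 hint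
      have hae' : π.θ x =ᵐ[volume.restrict (Ioo 0 (t + 1))] fun _ => 0 := by
        have hae2 := ae_restrict_of_ae_restrict_of_subset Ioo_subset_Ioc_self hae
        filter_upwards [hae2, ae_restrict_mem measurableSet_Ioo] with a ha ha'
        exact Body.eq_zero_of_pair_self_eq_zero hθ ha'.1.le ha x hx
      exact Measure.eqOn_open_of_ae_eq hae' isOpen_Ioo
        ((hθ.time hx).mono fun a ha => ha.1.le) continuousOn_const ⟨ht0, by linarith⟩

/-! ### Vanishing of the electric fields and of the potential. -/

theorem Body.pd_eq_zero {f : ScalarField} {t : ℝ} (hf : ∀ x ∈ closure b.B, f x t = 0) (j : Fin 3)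
    {x : E3} (hx : x ∈ closure b.B) : b.pd j f x t = 0 :=
  (Body.pdx_congr (f := fun y => f y t) (g := fun _ => (0 : ℝ)) hf hx j).trans
    (Body.pdx_const 0 x j)

/-- The problem with vanishing data has only the trivial solution. -/
theorem IsSolution.eq_zero (hM : M.Standing) (hβ : 0 < M.β) (hγ : 0 < M.γ) (hF : M.FDefinite)
    (hS₄ : p.S₄.Nonempty) (h : IsSolution b M p ProblemData.zero π) {x : E3}
    (hx : x ∈ closure b.B) {t : ℝ} (ht : 0 ≤ t) :
    (∀ i, π.u i x t = 0) ∧ π.θ x t = 0 ∧ π.φ x t = 0 ∧ (∀ i j, π.e i j x t = 0)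
      ∧ (∀ i j k, π.κ i j k x t = 0) ∧ (∀ i, π.gradθ i x t = 0) ∧ (∀ i, π.E i x t = 0)
      ∧ (∀ i j, π.V i j x t = 0) ∧ dt π.θ x t = 0 := by
  have hA := h.admissible
  have hC := h.constitutive
  obtain ⟨hu, hθ⟩ := h.u_θ_eq_zero hM hβ hγ
  -- The geometric equations hold only in the open body; continuity extends their consequences to
  -- the closure.
  have ext : ∀ {f : ScalarField} {m n : ℕ}, b.ClassC m n f → (∀ y ∈ b.B, f y t = 0) →
      ∀ y ∈ closure b.B, f y t = 0 := fun hf h0 =>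
    Body.eq_zero_of_mem_closure (Body.Cont.slice hf.continuousOn ht) subset_closure h0
  have hpd : ∀ i j, ∀ y ∈ closure b.B, b.pd j (π.u i) y t = 0 := fun i j y hy =>
    Body.pd_eq_zero (fun z hz => hu z hz t ht i) j hy
  have he : ∀ i j, ∀ y ∈ closure b.B, π.e i j y t = 0 := fun i j =>
    ext (hA.e_class i j) fun y hy => by
      rw [h.balance.strain y hy t ht, hpd _ _ y (subset_closure hy),
        hpd _ _ y (subset_closure hy)]
      ring
  have hκ : ∀ i j k, ∀ y ∈ closure b.B, π.κ i j k y t = 0 := fun i j k =>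
    ext (hA.κ_class i j k) fun y hy => by
      rw [h.balance.strain_grad y hy t ht, Body.pd_eq_zero (hpd k i) j (subset_closure hy)]
  have hgθ : ∀ i, ∀ y ∈ closure b.B, π.gradθ i y t = 0 := fun i =>
    ext (hA.gradθ_class i) fun y hy => by
      rw [h.balance.temp_grad y hy t ht,
        Body.pd_eq_zero (fun z hz => hθ z hz t ht) i (subset_closure hy)]
  have hdθ : ∀ y ∈ closure b.B, dt π.θ y t = 0 := fun y hy => by
    have h1 : derivWithin (π.θ y) (Ici 0) t = derivWithin (fun _ => (0 : ℝ)) (Ici 0) t :=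
      derivWithin_congr (fun s hs => hθ y hy s hs) (hθ y hy t ht)
    rw [dt, h1]
    simp
  have hF0 : ∀ y ∈ closure b.B,
      M.F (fun i => π.E i y t) (fun i j => π.V i j y t) = -((∑ i, π.σ i y t * π.E i y t)
        + ∑ i, ∑ j, π.Q i j y t * π.V i j y t) := by
    intro y hy
    have h1 : ∀ i, π.σ i y t = -∑ j, M.a33 i j * π.E j y t := fun i => by
      have := hC.sigma y hy t ht i
      simp only [hκ _ _ _ y hy, mul_zero, Finset.sum_const_zero, zero_add] at this
      rw [← this, neg_neg]
    have h2 : ∀ i j, π.Q i j y t = -∑ k, ∑ l, M.a77 i j k l * π.V k l y t := fun i j => by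
      have := hC.quadrupole y hy t ht i j
      simp only [he _ _ y hy, hθ y hy t ht, hdθ y hy, mul_zero, Finset.sum_const_zero, zero_add,
        add_zero] at this
      rw [← this, neg_neg]
    simp only [h1, h2, Material.F, neg_mul, Finset.sum_neg_distrib, Finset.sum_mul]
    rw [neg_add, neg_neg, neg_neg]
    congr 1
    exact Finset.sum_congr rfl fun i _ => Finset.sum_congr rfl fun j _ => by ring
  have hFc : ContinuousOn (fun y => M.F (fun i => π.E i y t) (fun i j => π.V i j y t))
      (closure b.B) := by
    have hE := fun i => Body.Cont.slice (hA.E_class i).continuousOn ht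
    have hV := fun i j => Body.Cont.slice (hA.V_class i j).continuousOn ht
    refine ContinuousOn.add ?_ ?_
    · exact continuousOn_finsetSum _ fun i _ => continuousOn_finsetSum _ fun j _ =>
        (continuousOn_const.mul (hE i)).mul (hE j)
    · exact continuousOn_finsetSum _ fun i _ => continuousOn_finsetSum _ fun j _ =>
        continuousOn_finsetSum _ fun k _ => continuousOn_finsetSum _ fun l _ =>
        (continuousOn_const.mul (hV k l)).mul (hV i j)
  -- The orthogonality of the electric quantities, now used at equal times.
  have hFint : ∫ y in b.B, M.F (fun i => π.E i y t) (fun i j => π.V i j y t) = 0 := by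
    rw [setIntegral_congr_fun b.isOpen.measurableSet fun y hy => hF0 y (subset_closure hy),
      integral_neg, h.integral_electric ht ht, neg_zero]
  have hEV : ∀ y ∈ closure b.B, (fun i => π.E i y t) = 0 ∧ (fun i j => π.V i j y t) = 0 := by
    intro y hy
    have hz : M.F 0 0 = 0 := by simp [Material.F]
    by_contra hcon
    have hcon' : (fun i => π.E i y t) ≠ 0 ∨ (fun i j => π.V i j y t) ≠ 0 := by tauto
    -- Either sign of definiteness serves: F, or -F, is then a continuous nonnegative function with
    -- zero integral. The symmetry of V is needed because definiteness is assumed for symmetric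
    -- tensors only.
    rcases hF with hF | hF
    · have hnn : ∀ y ∈ b.B, 0 ≤ M.F (fun i => π.E i y t) (fun i j => π.V i j y t) := by
        intro y hy
        by_cases hc : (fun i => π.E i y t) ≠ 0 ∨ (fun i j => π.V i j y t) ≠ 0
        · exact (hF _ _ (hA.V_symm y (subset_closure hy) t ht) hc).le
        · push Not at hc
          rw [hc.1, hc.2, hz]
      have h0 := Body.eq_zero_of_integral_eq_zero hFc hnn hFint y hy
      exact (hF _ _ (hA.V_symm y hy t ht) hcon').ne' h0
    · have hnn : ∀ y ∈ b.B, 0 ≤ -M.F (fun i => π.E i y t) (fun i j => π.V i j y t) := by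
        intro y hy
        by_cases hc : (fun i => π.E i y t) ≠ 0 ∨ (fun i j => π.V i j y t) ≠ 0
        · exact (neg_pos.2 (hF _ _ (hA.V_symm y (subset_closure hy) t ht) hc)).le
        · push Not at hc
          rw [hc.1, hc.2, hz, neg_zero]
      have h0 := Body.eq_zero_of_integral_eq_zero hFc.neg hnn
        ((integral_neg _).trans (by rw [hFint, neg_zero])) y hy
      exact (hF _ _ (hA.V_symm y hy t ht) hcon').ne (neg_eq_zero.1 h0)
  have hE : ∀ i, ∀ y ∈ closure b.B, π.E i y t = 0 := fun i y hy => congrFun (hEV y hy).1 i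
  have hV : ∀ i j, ∀ y ∈ closure b.B, π.V i j y t = 0 := fun i j y hy =>
    congrFun (congrFun (hEV y hy).2 i) j
  have hφ1 : ContDiffOn ℝ 1 (fun y => π.φ y t) (closure b.B) :=
    hA.φ_class.contDiffOn_space_of_le (m := 1) (by norm_num) ht
  have hfd : EqOn (fderiv ℝ fun y => π.φ y t) 0 b.B := by
    intro y hy
    have hj : ∀ j, fderiv ℝ (fun y => π.φ y t) y (basisVec j) = 0 := fun j => by
      rw [← Body.pdx_eq_fderiv hy]
      have := h.balance.field y hy t ht j
      rw [hE j y (subset_closure hy), eq_comm, neg_eq_zero] at this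
      exact this
    refine ContinuousLinearMap.coe_injective
      ((EuclideanSpace.basisFun (Fin 3) ℝ).toBasis.ext fun j => ?_)
    simpa [basisVec] using hj j
  obtain ⟨x₀, hx₀⟩ := hS₄
  have hx₀cl : x₀ ∈ closure b.B := b.frontier_subset (subset_frontier_of_cover p.cover₄ hx₀)
  -- Connectedness gives a single constant for the whole body, so one point of S₄ is enough to fix
  -- it.
  obtain ⟨a, ha⟩ := b.isOpen.exists_is_const_of_fderiv_eq_zero b.connected.isPreconnected
    ((hφ1.differentiableOn (by norm_num)).mono subset_closure) hfd
  have hconst : EqOn (fun y => π.φ y t) (fun _ => a) (closure b.B) :=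
    EqOn.of_subset_closure (fun y hy => ha y hy) hφ1.continuousOn continuousOn_const
      subset_closure subset_rfl
  have ha0 : a = 0 := (hconst hx₀cl).symm.trans (h.boundary.φ_bc x₀ hx₀ t ht)
  exact ⟨hu x hx t ht, hθ x hx t ht, (hconst hx).trans ha0, fun i j => he i j x hx,
    fun i j k => hκ i j k x hx, fun i => hgθ i x hx, fun i => hE i x hx, fun i j => hV i j x hx,
    hdθ x hx⟩

end Energy

end Thermopiezo

/-! ### Uniqueness for all components. -/

theorem mainTheorem1 (b : Thermopiezo.Body) (M : Thermopiezo.Material) (hM : M.Standing)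
    (p : Thermopiezo.BoundaryParts b) (D : Thermopiezo.ProblemData)
    (hβ : 0 < M.β) (hγ : 0 < M.γ) (hF : M.FDefinite) (hS₄ : p.S₄.Nonempty)
    (π₁ π₂ : Thermopiezo.ThermoProcess)
    (h₁ : Thermopiezo.IsSolution b M p D π₁) (h₂ : Thermopiezo.IsSolution b M p D π₂) :
    ∀ x ∈ closure b.B, ∀ t : ℝ, 0 ≤ t → Thermopiezo.SameAt π₁ π₂ x t := by
  intro x hx t ht
  have h := h₁.sub h₂
  have hC := h.constitutive
  obtain ⟨hu, hθ, hφ, he, hκ, hg, hE, hV, hdθ⟩ := h.eq_zero hM hβ hγ hF hS₄ hx ht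
  have hρ := hM.ρ_pos.ne'
  have hT := hM.T₀_pos.ne'
  refine ⟨fun i => sub_eq_zero.1 (hu i), sub_eq_zero.1 hθ, sub_eq_zero.1 hφ,
    fun i j => sub_eq_zero.1 (he i j), fun i j k => sub_eq_zero.1 (hκ i j k),
    fun i => sub_eq_zero.1 (hg i), fun i => sub_eq_zero.1 (hE i),
    fun i j => sub_eq_zero.1 (hV i j), fun i j => sub_eq_zero.1 ?_,
    fun i j k => sub_eq_zero.1 ?_, fun i => sub_eq_zero.1 ?_, fun i j => sub_eq_zero.1 ?_,
    sub_eq_zero.1 ?_, fun i => sub_eq_zero.1 ?_⟩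
  -- The remaining components are linear in quantities already known to vanish, θ̇ among them; the
  -- entropy and the heat flux are recovered by dividing by ρ and T₀.
  · have := hC.stress x hx t ht i j
    simp only [he, hV, hθ, hdθ, mul_zero, Finset.sum_const_zero, add_zero] at this
    exact this
  · have := hC.hyperstress x hx t ht i j k
    simp only [hκ, hE, mul_zero, Finset.sum_const_zero, add_zero] at this
    exact this
  · have := hC.sigma x hx t ht i
    simp only [hκ, hE, mul_zero, Finset.sum_const_zero, add_zero, neg_eq_zero] at this
    exact this
  · have := hC.quadrupole x hx t ht i j
    simp only [he, hV, hθ, hdθ, mul_zero, Finset.sum_const_zero, add_zero, neg_eq_zero] at this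
    exact this
  · have := hC.entropy x hx t ht
    simp only [he, hV, hθ, hdθ, mul_zero, Finset.sum_const_zero, add_zero, neg_eq_zero] at this
    exact (mul_eq_zero.1 this).resolve_left hρ
  · have := hC.heat_flux x hx t ht i
    simp only [hg, mul_zero, Finset.sum_const_zero, neg_eq_zero] at this
    exact (div_eq_zero_iff.1 this).resolve_right hT
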